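/- Let $(V,\Omega)$ be a finite-dimensional real symplectic vector space of dimension $2n$, $\hbar>0$, $h=2\pi\hbar$, and let $j$ be a positive compatible complex structure: a real linear map with $j^2=-I$, $\Omega(jv,jw)=\Omega(v,w)$ and $\Omega(v,jv)>0$ for $v\ne 0$. Put $G_j(v,w)=\Omega(v,jw)$, $\langle v,w\rangle_j=G_j(v,w)-i\,\Omega(v,w)$ and $|v|_j^2=G_j(v,v)$. Let $\mathcal H=\mathcal H(V,\Omega,j)$ be the space of holomorphic functions $f$ on $(V,j)$ with $\|f\|^2=h^{-n}\int_V|f(z)|^2e^{-|z|_j^2/2\hbar}\,dz<\infty$, where $dz$ is Lebesgue measure normalised by $G_j$. For $(v,t)\in V\times\mathbb R$ let $(U_j(v,t)f)(z)=e^{-it/\hbar+\langle z,v\rangle_j/2\hbar-|v|_j^2/4\hbar}f(z-v)$, and let $e_v(z)=e^{\langle z,v\rangle_j/2\hbar}$. The group $Mp^c(V,\Omega,j)$ consists of the pairs $(U,g)$, with $U$ a unitary operator on $\mathcal H$ and $g\in Sp(V,\Omega)$, such that $U_j(gv,t)=U\,U_j(v,t)\,U^{-1}$ for all $(v,t)$,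 with componentwise multiplication. For $g\in Sp(V,\Omega)$ put $C_g=\frac12(g-jgj)$ (which is invertible) and $Z_g=C_g^{-1}\cdot\frac12(g+jgj)$. An element $(U,g)$ of $Mp^c(V,\Omega,j)$ has parameters $(g,\lambda)$, $\lambda\in\mathbb C$, if $|\lambda^2\operatorname{Det}_jC_g|=1$ and, for all $z,v\in V$, $$(Ue_v)(z)=\lambda\exp\frac1{4\hbar}\Big\{2\langle C_g^{-1}z,v\rangle_j-\langle z,Z_{g^{-1}}z\rangle_j-\langle Z_gv,v\rangle_j\Big\}.$$ Let $F\subset V$ be a real Lagrangian subspace and $Sp(V,\Omega,F)=\{g\in Sp(V,\Omega): g(F)\subset F\}$. For $g\in Sp(V,\Omega,F)$ let $A_g=g|_F$, let $A_g^T$ be its transpose relative to $G_j|_F$, and let $S_g$ be the endomorphism of $F$ such that $A_gS_gv$ is the $F$-component of $gjv$ relative to $V=F\oplus jF$, for $v\in F$. Let $F^{\mathbb C}=\mathbb C\otimes_{\mathbb R}F$ and let $GL(F^{\mathbb C})_+$ be the set of complex endomorphisms of $F^{\mathbb C}$ whose real (self-adjoint) part is positive definite for the Hermitian extension of $G_j$.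 Then there is a smooth function $a_F:GL(F^{\mathbb C})_+\to\mathbb C$, and only one, with $\operatorname{Det}_{F^{\mathbb C}}X=e^{a_F(X)}$ for all $X$ and $a_F(I)=0$. For every $g\in Sp(V,\Omega,F)$ the endomorphism $\frac12\big(I+(A_g^TA_g)^{-1}-iS_g\big)$ lies in $GL(F^{\mathbb C})_+$, and the function $$f_F(g)=|\operatorname{Det}_FA_g|^{-1/2}\exp\Big(-\tfrac12\,a_F\big(\tfrac12(I+(A_g^TA_g)^{-1}-iS_g)\big)\Big)$$ is smooth on $Sp(V,\Omega,F)$. There is a homomorphism $Sp(V,\Omega,F)\to Mp^c(V,\Omega,j)$, and only one, that maps each $g\in Sp(V,\Omega,F)$ to an element $(U,g)$ with parameters $(g,f_F(g))$; in particular it lifts the inclusion $Sp(V,\Omega,F)\subset Sp(V,\Omega)$. -/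

import Mathlib

open scoped TensorProduct ContDiff

set_option linter.unusedSectionVars false

noncomputable section

/-! ## Symplectic vector spaces, the symplectic group, Lagrangian subspaces -/

/-- A symplectic form on a real vector space. -/
structure SymplecticForm (V : Type*) [AddCommGroup V] [Module ℝ V] where
  form : LinearMap.BilinForm ℝ V
  alt : form.IsAlt
  nondegenerate : form.Nondegenerate

namespace SymplecticForm

variable {V : Type*} [AddCommGroup V] [Module ℝ V]

instance : CoeFun (SymplecticForm V) (fun _ => V → (V →ₗ[ℝ] ℝ)) := ⟨fun Ω => Ω.form⟩

theorem swap (Ω : SymplecticForm V) (v w : V) : Ω v w = - Ω w v := by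
  rw [Ω.alt.neg_eq w v]

/-- The symplectic group `Sp(V, Ω)`. -/
def Sp (Ω : SymplecticForm V) : Subgroup (V ≃ₗ[ℝ] V) where
  carrier := {g | ∀ v w, Ω (g v) (g w) = Ω v w}
  mul_mem' := by
    intro a b ha hb v w
    change ∀ v w, Ω (a v) (a w) = Ω v w at ha
    change ∀ v w, Ω (b v) (b w) = Ω v w at hb
    rw [LinearEquiv.mul_apply, LinearEquiv.mul_apply, ha, hb]
  one_mem' := fun _ _ => rfl
  inv_mem' := by
    intro a ha v w
    have h := ha (a⁻¹ v) (a⁻¹ w)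
    have e : ∀ x, a (a⁻¹ x) = x := fun x => a.apply_symm_apply x
    rw [e, e] at h
    exact h.symm

/-- `F` is a (real) Lagrangian subspace: it equals its own `Ω`-orthogonal. -/
def IsLagrangian (Ω : SymplecticForm V) (F : Submodule ℝ V) : Prop :=
  ∀ v, v ∈ F ↔ ∀ w ∈ F, Ω v w = 0

theorem map_eq_of_le [FiniteDimensional ℝ V] {F : Submodule ℝ V} (g : V ≃ₗ[ℝ] V)
    (h : ∀ v ∈ F, g v ∈ F) : F.map (g : V →ₗ[ℝ] V) = F := by
  apply Submodule.eq_of_le_of_finrank_eq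
  · rintro _ ⟨v, hv, rfl⟩
    exact h v hv
  · exact LinearEquiv.finrank_map_eq g F

/-- The stabiliser `Sp(V, Ω, F)` of a subspace `F`: the `g ∈ Sp(V, Ω)` with `g(F) ⊆ F`. -/
def stabilizer [FiniteDimensional ℝ V] (Ω : SymplecticForm V) (F : Submodule ℝ V) :
    Subgroup Ω.Sp where
  carrier := {g | ∀ v ∈ F, (g : V ≃ₗ[ℝ] V) v ∈ F}
  mul_mem' := fun ha hb v hv => ha _ (hb v hv)
  one_mem' := fun _ hv => hv
  inv_mem' := by
    intro a ha v hv
    rw [← map_eq_of_le (a : V ≃ₗ[ℝ] V) ha] at hv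
    obtain ⟨w, hw, rfl⟩ := hv
    have e : ((a⁻¹ : Ω.Sp) : V ≃ₗ[ℝ] V) ((a : V ≃ₗ[ℝ] V) w) = w :=
      (a : V ≃ₗ[ℝ] V).symm_apply_apply w
    change ((a⁻¹ : Ω.Sp) : V ≃ₗ[ℝ] V) ((a : V ≃ₗ[ℝ] V) w) ∈ F
    rw [e]
    exact hw

end SymplecticForm

/-! ## Positive compatible complex structures and the Hilbert space `(V, Ω, j)` -/

/-- A positive compatible complex structure on `(V, Ω)`. -/
structure PCCS {V : Type*} [AddCommGroup V] [Module ℝ V] (Ω : SymplecticForm V) where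
  J : V →ₗ[ℝ] V
  symplectic : ∀ v w, Ω (J v) (J w) = Ω v w
  sq : ∀ v, J (J v) = -v
  pos : ∀ v, v ≠ 0 → 0 < Ω v (J v)

namespace PCCS

variable {V : Type*} [AddCommGroup V] [Module ℝ V] {Ω : SymplecticForm V} (j : PCCS Ω)

/-- The real inner product `G_j(v, w) = Ω(v, j w)`. -/
def G : LinearMap.BilinForm ℝ V := Ω.form.compl₂ j.J

theorem G_apply (v w : V) : j.G v w = Ω v (j.J w) := rfl

theorem G_symm (v w : V) : j.G v w = j.G w v := by
  rw [G_apply, G_apply, ← j.symplectic, j.sq, Ω.swap, map_neg, LinearMap.neg_apply, neg_neg]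

/-- The Hermitian structure `⟨v, w⟩_j = Ω(v, j w) - i Ω(v, w)`, complex linear in the first
argument and antilinear in the second. -/
def herm (v w : V) : ℂ := (j.G v w : ℂ) - Complex.I * (Ω v w : ℂ)

/-- The space `V`, regarded as a complex vector space through `j` and as a complex Hilbert space
through `⟨ , ⟩_j`. -/
def Space (_ : PCCS Ω) : Type _ := V

instance : AddCommGroup j.Space := inferInstanceAs (AddCommGroup V)

/-- The identity map `(V, j) → V` on the underlying additive groups. -/
def toV : j.Space ≃+ V := AddEquiv.refl V

/-- Scalar multiplication on `(V, j)`: `(x + i y) v = x v + y j v`. -/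
instance : SMul ℂ j.Space where
  smul z v := j.toV.symm (z.re • j.toV v + z.im • j.J (j.toV v))

theorem toV_smul (z : ℂ) (v : j.Space) :
    j.toV (z • v) = z.re • j.toV v + z.im • j.J (j.toV v) := rfl

instance : Module ℂ j.Space where
  one_smul v := by
    apply j.toV.injective
    simp [toV_smul]
  mul_smul a b v := by
    apply j.toV.injective
    simp only [toV_smul, map_add, map_smul, j.sq, Complex.mul_re, Complex.mul_im]
    module
  smul_zero a := by
    apply j.toV.injective
    simp [toV_smul]
  smul_add a v w := by
    apply j.toV.injective
    simp only [toV_smul, map_add]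
    module
  add_smul a b v := by
    apply j.toV.injective
    simp only [toV_smul, map_add, Complex.add_re, Complex.add_im]
    module
  zero_smul v := by
    apply j.toV.injective
    simp [toV_smul]

/-- The identity map `V → (V, j)`, which is real linear. -/
def toSpace : V ≃ₗ[ℝ] j.Space where
  toFun v := j.toV.symm v
  invFun v := j.toV v
  map_add' := map_add _
  map_smul' r v := by
    apply j.toV.injective
    change r • v = j.toV ((r : ℂ) • j.toV.symm v)
    rw [toV_smul]
    simp
  left_inv := j.toV.apply_symm_apply
  right_inv := j.toV.symm_apply_apply

theorem smul_def (z : ℂ) (v : j.Space) :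
    z • v = j.toSpace (z.re • j.toSpace.symm v + z.im • j.J (j.toSpace.symm v)) := rfl

/-- Mathlib's inner products are antilinear in the first argument, hence the swap. -/
@[reducible] def innerCore : InnerProductSpace.Core ℂ j.Space where
  inner v w := j.herm (j.toSpace.symm w) (j.toSpace.symm v)
  conj_inner_symm v w := by
    simp only [herm, map_sub, map_mul, Complex.conj_I, Complex.conj_ofReal]
    rw [j.G_symm, Ω.swap (j.toSpace.symm v)]
    push_cast
    ring
  re_inner_nonneg v := by
    by_cases h : j.toSpace.symm v = 0
    · simp [herm, h]
    · have := (j.pos _ h).le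
      simpa [herm, G_apply] using this
  add_left x y z := by
    simp only [herm, map_add]
    push_cast
    ring
  smul_left x y r := by
    rw [smul_def]
    simp only [herm, LinearEquiv.symm_apply_apply, map_add, map_smul, smul_eq_mul, G_apply, j.sq,
      map_neg]
    apply Complex.ext <;> simp <;> ring
  definite x h := by
    by_contra hx
    have hx' : j.toSpace.symm x ≠ 0 := fun h0 => hx (by simpa using h0)
    have h1 := congrArg Complex.re h
    have h2 := j.pos _ hx'
    simp [herm, G_apply] at h1
    exact h2.ne' h1

instance : NormedAddCommGroup j.Space := j.innerCore.toNormedAddCommGroup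

instance : InnerProductSpace ℂ j.Space := InnerProductSpace.ofCore j.innerCore.toCore

instance : InnerProductSpace ℝ j.Space := InnerProductSpace.complexToReal

instance : MeasurableSpace j.Space := borel _

instance : BorelSpace j.Space := ⟨rfl⟩

instance [FiniteDimensional ℝ V] : FiniteDimensional ℝ j.Space := j.toSpace.finiteDimensional

theorem inner_def (v w : V) : inner ℂ (j.toSpace v) (j.toSpace w) = j.herm w v := rfl

theorem norm_sq (v : V) : ‖j.toSpace v‖ ^ 2 = j.G v v := by
  rw [← inner_self_eq_norm_sq (𝕜 := ℂ), inner_def]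
  simp [herm]

theorem herm_re (v w : V) : (j.herm v w).re = j.G v w := by simp [herm]

/-- A `j`-linear endomorphism of `V`, as a complex linear endomorphism of `(V, j)`. -/
def complexLinear (T : V →ₗ[ℝ] V) (hT : ∀ v, T (j.J v) = j.J (T v)) : j.Space →ₗ[ℂ] j.Space where
  toFun v := j.toSpace (T (j.toSpace.symm v))
  map_add' v w := by simp
  map_smul' z v := by
    simp only [smul_def, LinearEquiv.symm_apply_apply, map_add, map_smul, hT, RingHom.id_apply]

/-! ## The parameters `C_g`, `Z_g` of a symplectic map -/

/-- The `j`-linear part `C_g = (g - j g j) / 2` of `g`. -/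
def linPart (g : V ≃ₗ[ℝ] V) : V →ₗ[ℝ] V :=
  (1 / 2 : ℝ) • ((g : V →ₗ[ℝ] V) - j.J ∘ₗ (g : V →ₗ[ℝ] V) ∘ₗ j.J)

/-- The `j`-antilinear part `D_g = (g + j g j) / 2` of `g`. -/
def antiPart (g : V ≃ₗ[ℝ] V) : V →ₗ[ℝ] V :=
  (1 / 2 : ℝ) • ((g : V →ₗ[ℝ] V) + j.J ∘ₗ (g : V →ₗ[ℝ] V) ∘ₗ j.J)

theorem linPart_J (g : V ≃ₗ[ℝ] V) (v : V) : j.linPart g (j.J v) = j.J (j.linPart g v) := by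
  simp only [linPart, LinearMap.smul_apply, LinearMap.sub_apply, LinearMap.comp_apply,
    LinearEquiv.coe_coe, map_smul, map_sub, j.sq, map_neg]
  module

theorem linPart_injective (g : Ω.Sp) : Function.Injective (j.linPart (g : V ≃ₗ[ℝ] V)) := by
  rw [← LinearMap.ker_eq_bot, LinearMap.ker_eq_bot']
  intro v hv
  by_contra h0
  set a := (g : V ≃ₗ[ℝ] V) v with ha
  set b := (g : V ≃ₗ[ℝ] V) (j.J v) with hb
  have hab : a = j.J b := by
    have : (1 / 2 : ℝ) • (a - j.J b) = 0 := hv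
    rw [smul_eq_zero] at this
    rcases this with h | h
    · norm_num at h
    · exact sub_eq_zero.mp h
  have h1 : Ω a b = Ω v (j.J v) := g.2 v (j.J v)
  have h2 : 0 < Ω v (j.J v) := j.pos v h0
  have h3 : b ≠ 0 := by
    intro hb0
    rw [hb0, map_zero] at h1
    exact h2.ne h1
  have h4 := j.pos b h3
  rw [hab, Ω.swap] at h1
  linarith

variable [FiniteDimensional ℝ V]

/-- `C_g` for symplectic `g`, as an invertible map. -/
def C (g : Ω.Sp) : V ≃ₗ[ℝ] V :=
  LinearEquiv.ofInjectiveEndo (j.linPart (g : V ≃ₗ[ℝ] V)) (j.linPart_injective g)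

theorem C_apply (g : Ω.Sp) (v : V) : j.C g v = j.linPart (g : V ≃ₗ[ℝ] V) v := rfl

/-- `Z_g = C_g⁻¹ D_g`. -/
def Z (g : Ω.Sp) : V →ₗ[ℝ] V := (j.C g).symm.toLinearMap ∘ₗ j.antiPart (g : V ≃ₗ[ℝ] V)

/-- The complex determinant `Det_j C_g`. -/
def detC (g : Ω.Sp) : ℂ := LinearMap.det (j.complexLinear (j.linPart (g : V ≃ₗ[ℝ] V)) (j.linPart_J _))

/-! ## The Fock space and the Heisenberg group action -/

variable (hbar : ℝ)

/-- The Gaussian weight `exp(-|z|_j² / 2ħ)`. -/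
def weight (z : j.Space) : ℝ := Real.exp (-‖z‖ ^ 2 / (2 * hbar))

theorem weight_pos (z : j.Space) : 0 < j.weight hbar z := Real.exp_pos _

theorem continuous_weight : Continuous (j.weight hbar) := by
  unfold weight
  fun_prop

theorem integrable_mul_weight {f g : j.Space → ℂ} (hf : Continuous f) (hg : Continuous g)
    (hf2 : MeasureTheory.Integrable fun z => ‖f z‖ ^ 2 * j.weight hbar z)
    (hg2 : MeasureTheory.Integrable fun z => ‖g z‖ ^ 2 * j.weight hbar z) :
    MeasureTheory.Integrable fun z => starRingEnd ℂ (f z) * g z * (j.weight hbar z : ℂ) := by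
  have hw := j.continuous_weight hbar
  refine (hf2.add hg2).mono' ?_ (Filter.Eventually.of_forall fun z => ?_)
  · exact (Continuous.mul ((Complex.continuous_conj.comp hf).mul hg)
      (Complex.continuous_ofReal.comp hw)).aestronglyMeasurable
  · have := j.weight_pos hbar z
    simp only [norm_mul, RCLike.norm_conj, Complex.norm_real, Real.norm_eq_abs, abs_of_pos this,
      Pi.add_apply]
    rw [← add_mul]
    refine mul_le_mul_of_nonneg_right ?_ this.le
    nlinarith [sq_nonneg (‖f z‖ - ‖g z‖), sq_nonneg ‖f z‖, sq_nonneg ‖g z‖]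

/-- The functions on `V` that are holomorphic on `(V, j)` and square integrable for the Gaussian
weight. -/
def fockSubmodule : Submodule ℂ (V → ℂ) where
  carrier := {f | Differentiable ℂ (fun z : j.Space => f (j.toSpace.symm z)) ∧
    MeasureTheory.Integrable fun z : j.Space => ‖f (j.toSpace.symm z)‖ ^ 2 * j.weight hbar z}
  zero_mem' := by
    refine ⟨differentiable_const 0, ?_⟩
    simp
  add_mem' := by
    rintro f g ⟨hf, hf2⟩ ⟨hg, hg2⟩
    refine ⟨hf.add hg, ?_⟩
    refine ((hf2.add hg2).const_mul 2).mono' ?_ (Filter.Eventually.of_forall fun z => ?_)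
    · exact (Continuous.mul ((hf.continuous.add hg.continuous).norm.pow 2)
        (j.continuous_weight hbar)).aestronglyMeasurable
    · have := j.weight_pos hbar z
      rw [Real.norm_eq_abs, abs_of_nonneg (by positivity)]
      simp only [Pi.add_apply]
      rw [← add_mul, ← mul_assoc]
      refine mul_le_mul_of_nonneg_right ?_ this.le
      have h := norm_add_le (f (j.toSpace.symm z)) (g (j.toSpace.symm z))
      have h0 := norm_nonneg (f (j.toSpace.symm z) + g (j.toSpace.symm z))
      nlinarith [sq_nonneg (‖f (j.toSpace.symm z)‖ - ‖g (j.toSpace.symm z)‖)]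
  smul_mem' := by
    rintro c f ⟨hf, hf2⟩
    refine ⟨hf.const_mul c, ?_⟩
    have := hf2.const_mul (‖c‖ ^ 2)
    refine this.congr (Filter.Eventually.of_forall fun z => ?_)
    simp only [Pi.smul_apply, smul_eq_mul, norm_mul]
    ring

/-- The Fock space `H(V, Ω, j)`. -/
def Fock : Type _ := j.fockSubmodule hbar

instance : AddCommGroup (j.Fock hbar) := inferInstanceAs (AddCommGroup (j.fockSubmodule hbar))

instance : Module ℂ (j.Fock hbar) := inferInstanceAs (Module ℂ (j.fockSubmodule hbar))

/-- The inclusion of the Fock space in the functions on `V`. -/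
def fockFun : j.Fock hbar →ₗ[ℂ] (V → ℂ) := (j.fockSubmodule hbar).subtype

instance : CoeFun (j.Fock hbar) (fun _ => V → ℂ) := ⟨fun f => j.fockFun hbar f⟩

variable {hbar}

theorem fock_ext {f g : j.Fock hbar} (h : ∀ z, f z = g z) : f = g := Subtype.ext (funext h)

theorem fock_differentiable (f : j.Fock hbar) :
    Differentiable ℂ (fun z : j.Space => f (j.toSpace.symm z)) := f.2.1

theorem fock_integrable (f : j.Fock hbar) :
    MeasureTheory.Integrable fun z : j.Space => ‖f (j.toSpace.symm z)‖ ^ 2 * j.weight hbar z := f.2.2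

theorem fock_integrable_mul (f g : j.Fock hbar) :
    MeasureTheory.Integrable fun z : j.Space =>
      starRingEnd ℂ (f (j.toSpace.symm z)) * g (j.toSpace.symm z) * (j.weight hbar z : ℂ) :=
  j.integrable_mul_weight hbar (j.fock_differentiable f).continuous
    (j.fock_differentiable g).continuous (j.fock_integrable f) (j.fock_integrable g)

variable (hbar)

/-- The inner product of the Fock space, antilinear in the first argument, with
`‖f‖² = h⁻ⁿ ∫ |f(z)|² exp(-|z|_j² / 2ħ) dz`, where `h = 2πħ`, `n = dim_ℂ (V, j)` and `dz` is the
Lebesgue measure of the Euclidean space `(V, G_j)`. -/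
@[reducible] def fockCore [hb : Fact (0 < hbar)] : InnerProductSpace.Core ℂ (j.Fock hbar) where
  inner f g := (((2 * Real.pi * hbar) ^ Module.finrank ℂ j.Space)⁻¹ : ℝ) *
    ∫ z : j.Space,
      starRingEnd ℂ (f (j.toSpace.symm z)) * g (j.toSpace.symm z) * (j.weight hbar z : ℂ)
  conj_inner_symm f g := by
    rw [map_mul, Complex.conj_ofReal, ← integral_conj]
    congr 2
    ext z
    simp only [map_mul, Complex.conj_conj, Complex.conj_ofReal]
    ring
  re_inner_nonneg f := by
    have h : ∀ z : j.Space, starRingEnd ℂ (f (j.toSpace.symm z)) * f (j.toSpace.symm z) *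
        (j.weight hbar z : ℂ) = ((‖f (j.toSpace.symm z)‖ ^ 2 * j.weight hbar z : ℝ) : ℂ) := by
      intro z
      rw [Complex.conj_mul']
      push_cast
      rfl
    simp_rw [h]
    rw [integral_complex_ofReal, ← Complex.ofReal_mul]
    simp only [RCLike.re_to_complex, Complex.ofReal_re]
    have := hb.out
    refine mul_nonneg (by positivity) (MeasureTheory.integral_nonneg fun z => ?_)
    exact mul_nonneg (sq_nonneg _) (j.weight_pos hbar z).le
  add_left f g k := by
    rw [← mul_add, ← MeasureTheory.integral_add (j.fock_integrable_mul f k)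
      (j.fock_integrable_mul g k)]
    congr 2
    ext z
    simp only [map_add, Pi.add_apply]
    ring
  smul_left f g r := by
    rw [mul_left_comm]
    refine congrArg _ ((MeasureTheory.integral_congr_ae (Filter.Eventually.of_forall
      fun z => ?_)).trans (MeasureTheory.integral_const_mul (starRingEnd ℂ r) _))
    simp only [map_smul, Pi.smul_apply, smul_eq_mul, map_mul]
    ring
  definite f h := by
    have hw := hb.out
    have h' : ∀ z : j.Space, starRingEnd ℂ (f (j.toSpace.symm z)) * f (j.toSpace.symm z) *
        (j.weight hbar z : ℂ) = ((‖f (j.toSpace.symm z)‖ ^ 2 * j.weight hbar z : ℝ) : ℂ) := by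
      intro z
      rw [Complex.conj_mul']
      push_cast
      rfl
    simp_rw [h'] at h
    rw [integral_complex_ofReal, ← Complex.ofReal_mul, Complex.ofReal_eq_zero, mul_eq_zero] at h
    have h2 := h.resolve_left (by positivity)
    rw [MeasureTheory.integral_eq_zero_iff_of_nonneg
      (fun z => mul_nonneg (sq_nonneg _) (j.weight_pos hbar z).le) (j.fock_integrable f)] at h2
    have hc : Continuous fun z : j.Space => ‖f (j.toSpace.symm z)‖ ^ 2 * j.weight hbar z :=
      ((j.fock_differentiable f).continuous.norm.pow 2).mul (j.continuous_weight hbar)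
    have h3 := (Continuous.ae_eq_iff_eq MeasureTheory.volume hc continuous_const).mp h2
    apply j.fock_ext
    intro z
    have h4 : ‖f (j.toSpace.symm (j.toSpace z))‖ ^ 2 * j.weight hbar (j.toSpace z) = 0 :=
      congrFun h3 (j.toSpace z)
    have h5 := j.weight_pos hbar (j.toSpace z)
    rw [LinearEquiv.symm_apply_apply, mul_eq_zero] at h4
    have h6 := h4.resolve_right h5.ne'
    simpa using h6

instance [Fact (0 < hbar)] : NormedAddCommGroup (j.Fock hbar) :=
  (j.fockCore hbar).toNormedAddCommGroup

instance [Fact (0 < hbar)] : InnerProductSpace ℂ (j.Fock hbar) :=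
  InnerProductSpace.ofCore (j.fockCore hbar).toCore

/-- The multiplier `exp(-i t/ħ + ⟨z, v⟩_j / 2ħ - |v|_j² / 4ħ)` of the Heisenberg action. -/
def heisFactor (v : V) (t : ℝ) (z : V) : ℂ :=
  Complex.exp (-Complex.I * t / hbar + j.herm z v / (2 * hbar) - j.G v v / (4 * hbar))

theorem heisFactor_weight (v : V) (t : ℝ) (z : j.Space) :
    ‖j.heisFactor hbar v t (j.toSpace.symm z)‖ ^ 2 * j.weight hbar z =
      j.weight hbar (z - j.toSpace v) := by
  obtain ⟨z, rfl⟩ := j.toSpace.surjective z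
  rw [heisFactor, Complex.norm_exp, weight, weight, ← Real.exp_nat_mul, ← Real.exp_add, ← map_sub,
    norm_sq, norm_sq, LinearEquiv.symm_apply_apply]
  congr 1
  have e1 : (-Complex.I * (t : ℂ) / hbar).re = 0 := by
    rw [Complex.div_ofReal_re]; simp
  have e2 : (j.herm z v / (2 * hbar)).re = j.G z v / (2 * hbar) := by
    rw [← herm_re]
    exact_mod_cast Complex.div_ofReal_re _ (2 * hbar)
  have e3 : ((j.G v v : ℂ) / (4 * hbar)).re = j.G v v / (4 * hbar) := by
    exact_mod_cast Complex.ofReal_re (j.G v v / (4 * hbar))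
  rw [Complex.sub_re, Complex.add_re, e1, e2, e3]
  have e4 : j.G (z - v) (z - v) = j.G z z - 2 * j.G z v + j.G v v := by
    simp only [map_sub, LinearMap.sub_apply]
    rw [j.G_symm v z]
    ring
  rw [e4]
  by_cases h : hbar = 0
  · simp [h]
  · field_simp
    push_cast
    ring

theorem differentiable_herm (v : V) :
    Differentiable ℂ fun z : j.Space => j.herm (j.toSpace.symm z) v := by
  have : (fun z : j.Space => j.herm (j.toSpace.symm z) v) =
      fun z : j.Space => inner ℂ (j.toSpace v) z := rfl
  rw [this]
  exact (innerSL ℂ (j.toSpace v)).differentiable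

theorem differentiable_herm_div (v : V) :
    Differentiable ℂ fun z : j.Space => j.herm (j.toSpace.symm z) v / (2 * (hbar : ℂ)) := by
  simp_rw [div_eq_mul_inv]
  exact (j.differentiable_herm v).mul_const _

/-- The action `U_j(v, t)` of the element `(v, t)` of the Heisenberg group on the Fock space:
`(U_j(v, t) f)(z) = exp(-i t/ħ + ⟨z, v⟩_j / 2ħ - |v|_j² / 4ħ) f(z - v)`. -/
def heis (v : V) (t : ℝ) : j.Fock hbar →ₗ[ℂ] j.Fock hbar where
  toFun f := ⟨fun z => j.heisFactor hbar v t z * f (z - v), by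
    refine ⟨?_, ?_⟩
    · refine Differentiable.mul ?_ ?_
      · unfold heisFactor
        exact (((j.differentiable_herm_div hbar v).const_add _).sub_const _).cexp
      · have h1 := (j.fock_differentiable f).comp
          (differentiable_id.sub_const (j.toSpace v))
        exact h1
    · have h1 := (j.fock_integrable f).comp_sub_right (j.toSpace v)
      refine h1.congr (Filter.Eventually.of_forall fun z => ?_)
      simp only
      rw [← j.heisFactor_weight hbar v t z, norm_mul, map_sub, LinearEquiv.symm_apply_apply]
      ring⟩
  map_add' f g := by
    apply j.fock_ext
    intro z
    change j.heisFactor hbar v t z * (f + g : j.Fock hbar) (z - v) =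
      j.heisFactor hbar v t z * f (z - v) + j.heisFactor hbar v t z * g (z - v)
    simp only [map_add, Pi.add_apply]
    ring
  map_smul' c f := by
    apply j.fock_ext
    intro z
    change j.heisFactor hbar v t z * (c • f : j.Fock hbar) (z - v) =
      c * (j.heisFactor hbar v t z * f (z - v))
    simp only [map_smul, Pi.smul_apply, smul_eq_mul]
    ring

theorem heis_apply (v : V) (t : ℝ) (f : j.Fock hbar) (z : V) :
    j.heis hbar v t f z = j.heisFactor hbar v t z * f (z - v) := rfl

theorem integrable_weight [hb : Fact (0 < hbar)] : MeasureTheory.Integrable (j.weight hbar) := by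
  have hb' := hb.out
  have h := GaussianFourier.integrable_cexp_neg_mul_sq_norm_add (V := j.Space)
    (b := ((1 / (2 * hbar) : ℝ) : ℂ)) (by rw [Complex.ofReal_re]; positivity) 0 0
  refine h.norm.congr (Filter.Eventually.of_forall fun z => ?_)
  simp only [Complex.norm_exp, weight]
  congr 1
  simp only [zero_mul, add_zero]
  have : -((1 / (2 * hbar) : ℝ) : ℂ) * (‖z‖ : ℂ) ^ 2 = ((-‖z‖ ^ 2 / (2 * hbar) : ℝ) : ℂ) := by
    push_cast
    ring
  rw [this, Complex.ofReal_re]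

/-- The coherent state `e_v(z) = exp(⟨z, v⟩_j / 2ħ)`. -/
def coherent [hb : Fact (0 < hbar)] (v : V) : j.Fock hbar :=
  ⟨fun z => Complex.exp (j.herm z v / (2 * hbar)), by
    refine ⟨(j.differentiable_herm_div hbar v).cexp, ?_⟩
    have h1 := ((j.integrable_weight hbar).comp_sub_right (j.toSpace v)).const_mul
      (‖Complex.exp (j.G v v / (4 * hbar))‖ ^ 2)
    refine h1.congr (Filter.Eventually.of_forall fun z => ?_)
    simp only
    rw [← j.heisFactor_weight hbar v 0 z, ← mul_assoc, ← mul_pow, ← norm_mul, heisFactor,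
      ← Complex.exp_add]
    congr 4
    simp⟩

theorem coherent_apply [Fact (0 < hbar)] (v z : V) :
    j.coherent hbar v z = Complex.exp (j.herm z v / (2 * hbar)) := rfl

/-! ## The group `Mp^c` and its parameters -/

/-- The group `Mp^c(V, Ω, j)` of the pairs `(U, g)`, with `U` a unitary transformation of the Fock
space and `g ∈ Sp(V, Ω)`, such that `U_j(g v, t) = U U_j(v, t) U⁻¹` for all `(v, t)` in the
Heisenberg group; the multiplication is componentwise. -/
def Mpc [Fact (0 < hbar)] : Subgroup ((j.Fock hbar ≃ₗᵢ[ℂ] j.Fock hbar) × Ω.Sp) where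
  carrier := {p | ∀ (v : V) (t : ℝ) (f : j.Fock hbar),
    j.heis hbar ((p.2 : V ≃ₗ[ℝ] V) v) t f = p.1 (j.heis hbar v t (p.1⁻¹ f))}
  mul_mem' := by
    intro a b ha hb v t f
    change ∀ v t f, _ at ha
    change ∀ v t f, _ at hb
    have h1 := ha ((b.2 : V ≃ₗ[ℝ] V) v) t f
    rw [hb] at h1
    rw [Prod.fst_mul, mul_inv_rev]
    exact h1
  one_mem' := fun _ _ _ => rfl
  inv_mem' := by
    intro a ha v t f
    have h1 := ha (((a.2⁻¹ : Ω.Sp) : V ≃ₗ[ℝ] V) v) t (a.1 f)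
    have e : (a.2 : V ≃ₗ[ℝ] V) (((a.2⁻¹ : Ω.Sp) : V ≃ₗ[ℝ] V) v) = v :=
      (a.2 : V ≃ₗ[ℝ] V).apply_symm_apply v
    have e2 : a.1⁻¹ (a.1 f) = f := a.1.symm_apply_apply f
    rw [e, e2] at h1
    have e3 : (a⁻¹).1⁻¹ = a.1 := by rw [Prod.fst_inv, inv_inv]
    rw [e3, h1]
    exact (a.1.symm_apply_apply _).symm

/-- The element `(U, g)` of `Mp^c(V, Ω, j)` has parameters `g, l`: one has `|l² Det_j C_g| = 1`,
and the Berezin kernel `(U e_v)(z)` of `U` is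
`l exp ((2⟨C_g⁻¹ z, v⟩_j - ⟨z, Z_{g⁻¹} z⟩_j - ⟨Z_g v, v⟩_j) / 4ħ)`. -/
def HasParameters [Fact (0 < hbar)] (p : j.Mpc hbar) (g : Ω.Sp) (l : ℂ) : Prop :=
  p.1.2 = g ∧ ‖l ^ 2 * j.detC g‖ = 1 ∧
    ∀ z v : V, p.1.1 (j.coherent hbar v) z = l * Complex.exp (1 / (4 * hbar) *
      (2 * j.herm ((j.C g).symm z) v - j.herm z (j.Z g⁻¹ z) - j.herm (j.Z g v) v))

/-! ## The Lagrangian data `A_g`, `S_g`, `a_F`, `f_F` -/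

variable (F : Submodule ℝ V)

/-- The inner product `G_j` restricted to `F`. -/
def GF : LinearMap.BilinForm ℝ F := j.G.restrict F

theorem GF_apply (v w : F) : j.GF F v w = j.G v w := rfl

theorem GF_nondegenerate : (j.GF F).Nondegenerate := by
  have h : ∀ v : F, j.GF F v v = 0 → v = 0 := by
    intro v hv
    by_contra h0
    exact (j.pos v (fun h => h0 (Subtype.ext h))).ne' hv
  exact ⟨fun v hv => h v (hv v), fun v hv => h v (hv v)⟩

/-- The transpose of an endomorphism of `F` relative to `G_j`. -/
def transpose (T : Module.End ℝ F) : Module.End ℝ F :=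
  (j.GF F).leftAdjointOfNondegenerate (j.GF_nondegenerate F) T

theorem transpose_spec (T : Module.End ℝ F) (v w : F) :
    j.G (j.transpose F T v) w = j.G v (T w) :=
  (j.GF F).isAdjointPairLeftAdjointOfNondegenerate (j.GF_nondegenerate F) T v w

variable {F}

/-- `A_g = g|_F`, for `g` in the stabiliser of `F`. -/
def A (g : Ω.stabilizer F) : F ≃ₗ[ℝ] F :=
  LinearEquiv.ofInjectiveEndo
    (((g : Ω.Sp) : V ≃ₗ[ℝ] V).toLinearMap.restrict (p := F) (q := F) g.2)
    (fun _ _ h => Subtype.ext (((g : Ω.Sp) : V ≃ₗ[ℝ] V).injective (congrArg Subtype.val h)))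

theorem A_apply (g : Ω.stabilizer F) (v : F) :
    (A g v : V) = ((g : Ω.Sp) : V ≃ₗ[ℝ] V) v := rfl

theorem isCompl (hF : Ω.IsLagrangian F) : IsCompl F (F.map j.J) := by
  have hr : j.G.IsRefl := fun _ _ h => by rw [j.G_symm, h]
  have h := LinearMap.BilinForm.isCompl_orthogonal_of_restrict_nondegenerate hr
    (j.GF_nondegenerate F)
  have e : j.G.orthogonal F = F.map j.J := by
    ext w
    rw [LinearMap.BilinForm.mem_orthogonal_iff]
    constructor
    · intro hw
      refine ⟨-(j.J w), ?_, by rw [map_neg, j.sq, neg_neg]⟩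
      rw [SetLike.mem_coe, neg_mem_iff, hF]
      intro v hv
      rw [Ω.swap, ← G_apply, show j.G v w = 0 from hw v hv, neg_zero]
    · rintro ⟨u, hu, rfl⟩ v hv
      change Ω v (j.J (j.J u)) = 0
      rw [j.sq, map_neg, (hF v).mp hv u hu, neg_zero]
  rwa [e] at h

/-- `S_g`: `A_g S_g v` is the `F` component of `g j v` relative to `V = F ⊕ j F`. -/
def S (hF : Ω.IsLagrangian F) (g : Ω.stabilizer F) : Module.End ℝ F :=
  (A g).symm.toLinearMap ∘ₗ F.projectionOnto (F.map j.J) (j.isCompl hF) ∘ₗ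
    ((g : Ω.Sp) : V ≃ₗ[ℝ] V).toLinearMap ∘ₗ j.J ∘ₗ F.subtype

/-- The endomorphism `(I + (A_gᵀ A_g)⁻¹ - i S_g) / 2` of the complexification of `F`. -/
def arg (hF : Ω.IsLagrangian F) (g : Ω.stabilizer F) : Module.End ℂ (ℂ ⊗[ℝ] F) :=
  (1 / 2 : ℂ) • (1 +
    LinearMap.baseChange ℂ (Ring.inverse (j.transpose F (A g).toLinearMap * (A g).toLinearMap)) -
    Complex.I • LinearMap.baseChange ℂ (j.S hF g))

variable (F)

/-- The Hermitian extension of `G_j` to the complexification of `F`: linear in the first and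
antilinear in the second argument. -/
def hermC (x y : ℂ ⊗[ℝ] F) : ℂ :=
  LinearMap.BilinForm.baseChange ℂ (j.GF F) x
    (LinearMap.rTensor F Complex.conjAe.toLinearMap y)

theorem hermC_tmul (a b : ℂ) (v w : F) :
    j.hermC F (a ⊗ₜ v) (b ⊗ₜ w) = a * starRingEnd ℂ b * (j.G v w : ℂ) := by
  simp [hermC, GF_apply, mul_comm]

/-- The endomorphisms of the complexification of `F` with positive definite real part; they are
automatically invertible. -/
def GLpos : Set (Module.End ℂ (ℂ ⊗[ℝ] F)) :=
  {X | ∀ x, x ≠ 0 → 0 < (j.hermC F (X x) x).re}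

end PCCS

/-- Smoothness of a complex valued function on a subset of a finite-dimensional real vector space,
in linear coordinates. -/
def SmoothOn {W : Type*} [AddCommGroup W] [Module ℝ W] [FiniteDimensional ℝ W]
    (f : W → ℂ) (s : Set W) : Prop :=
  ∀ e : (Fin (Module.finrank ℝ W) → ℝ) ≃ₗ[ℝ] W, ContDiffOn ℝ ∞ (f ∘ e) (e ⁻¹' s)

namespace PCCS

variable {V : Type*} [AddCommGroup V] [Module ℝ V] {Ω : SymplecticForm V} (j : PCCS Ω)
  [FiniteDimensional ℝ V] (F : Submodule ℝ V)

instance finiteEnd : FiniteDimensional ℝ (Module.End ℂ (ℂ ⊗[ℝ] F)) :=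
  Module.Finite.trans ℂ _

/-- `a` is a smooth logarithm of the complex determinant on the endomorphisms of the
complexification of `F` with positive definite real part, normalised by `a(I) = 0`. -/
def IsLogDet (a : Module.End ℂ (ℂ ⊗[ℝ] F) → ℂ) : Prop :=
  SmoothOn a (j.GLpos F) ∧ (∀ X ∈ j.GLpos F, LinearMap.det X = Complex.exp (a X)) ∧ a 1 = 0

variable {F}

/-- `f_F(g) = |Det_F A_g|^(-1/2) exp(-a((I + (A_gᵀ A_g)⁻¹ - i S_g) / 2) / 2)`. -/
def fF (hF : Ω.IsLagrangian F) (a : Module.End ℂ (ℂ ⊗[ℝ] F) → ℂ) (g : Ω.stabilizer F) : ℂ :=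
  ((|LinearMap.det (A g).toLinearMap| ^ (-(1 / 2) : ℝ) : ℝ) : ℂ) *
    Complex.exp (-(1 / 2) * a (j.arg hF g))

end PCCS

/-- Smoothness of a complex valued function on the stabiliser of `F`, as a closed subgroup (hence a
submanifold) of `GL(V) ⊆ End(V)`. -/
def SymplecticForm.SmoothOnStabilizer {V : Type*} [AddCommGroup V] [Module ℝ V]
    [FiniteDimensional ℝ V] (Ω : SymplecticForm V) (F : Submodule ℝ V)
    (f : Ω.stabilizer F → ℂ) : Prop :=
  ∃ φ : Module.End ℝ V → ℂ,
    SmoothOn φ (Set.range fun g : Ω.stabilizer F => ((g : Ω.Sp) : V ≃ₗ[ℝ] V).toLinearMap) ∧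
    ∀ g : Ω.stabilizer F, φ ((g : Ω.Sp) : V ≃ₗ[ℝ] V).toLinearMap = f g

end

noncomputable section

open scoped Matrix
open Set

/-! In unitary coordinates adapted to F, the space (V, j) becomes ℂⁿ with F = ℝⁿ, and the stabiliser
acts on L²(ℝⁿ) with no choice of sign: ρ(g)ψ(x) = |det A|^(1/2) exp(i⟨S Aᵀx, Aᵀx⟩/2ħ) ψ(Aᵀx), where
A = A_g and S = S_g. Since A_{gh} = A_g A_h and S_{gh} = S_h + A_h⁻¹ S_g A_h⁻ᵀ, this is a true
unitary representation (`rho_mul`). Conjugating it with the Bargmann transform (`bargmann`) gives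
operators on the Fock space that multiply correctly, and it remains to read off their parameters.

The Bargmann transform carries explicit Gaussians φ_v to the coherent states e_v, so the Berezin
kernel of the conjugated operator is ⟨φ_z, ρ(g)φ_v⟩. After the substitution y = Aᵀx this is a
Gaussian integral with matrix X = (1 + (AᵀA)⁻¹ - iS)/2, whose real part is positive definite. Its
value contains (det X)^(-1/2), on the branch exp(-a(X)/2), and the Jacobian turns |det A|^(1/2) into
|det A|^(-1/2) (`Matrix.IsLogDet.integral_gaussian`, `fockOp_coherent`). Thus f_F(g) appears as the
value of an integral, and no product formula for f_F has to be checked.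

The exponent is the required one because C_g = AX and Z_g = (X⁻¹ - 1) ∘ conjugation in these
coordinates (`kernelForm_eq`). Covariance under the Heisenberg group is tested on coherent states,
where it becomes an identity of quadratic forms (`Matrix.kernelForm_translate`, `heis_fockOp`).

The logarithm a exists because the determinant has no zero on an open convex set, and it is unique
because exp is a covering map and the set is connected. Smoothness of f_F follows from rational
formulas for A and S in the entries of g. The homomorphism is unique because coherent states are
total, so that parameters determine an element of Mp^c. -/

/-! ### Logarithms on convex sets -/

theorem Convex.isSimplyConnected {E : Type*} [NormedAddCommGroup E] [NormedSpace ℝ E] {s : Set E}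
    (hs : Convex ℝ s) (hne : s.Nonempty) : IsSimplyConnected s := by
  have := hs.contractibleSpace hne
  exact (inferInstance : SimplyConnectedSpace s)

/-- Continuous logarithms of the same function on a preconnected set that agree at one point agree
everywhere. -/
theorem IsPreconnected.eqOn_of_exp_eq {X : Type*} [TopologicalSpace X] {s : Set X}
    (hs : IsPreconnected s) {a b : X → ℂ} (ha : ContinuousOn a s) (hb : ContinuousOn b s)
    (h : ∀ x ∈ s, Complex.exp (a x) = Complex.exp (b x)) {x₀ : X} (hx₀ : x₀ ∈ s)
    (h₀ : a x₀ = b x₀) : EqOn a b s := by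
  refine Complex.isCoveringMap_exp.eqOn_of_comp_eqOn hs ha hb (fun x hx => ?_) hx₀ h₀
  exact Subtype.ext (h x hx)

/-- A smooth nonvanishing function on an open convex set has a smooth logarithm. -/
theorem Convex.exists_contDiffOn_log {E : Type*} [NormedAddCommGroup E] [NormedSpace ℝ E]
    {s : Set E} (hs : Convex ℝ s) (ho : IsOpen s) {d : E → ℂ} (hd : ContDiff ℝ ∞ d)
    (h0 : ∀ x ∈ s, d x ≠ 0) {x₀ : E} (hx₀ : x₀ ∈ s) (h1 : d x₀ = 1) :
    ∃ a : E → ℂ, ContDiffOn ℝ ∞ a s ∧ (∀ x ∈ s, d x = Complex.exp (a x)) ∧ a x₀ = 0 := by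
  obtain ⟨f, hfc, hf⟩ := Complex.exists_continuousOn_eqOn_exp_comp
    (hs.isSimplyConnected ⟨x₀, hx₀⟩) ho hd.continuous.continuousOn
    (by rintro ⟨x, hx, hx'⟩; exact h0 x hx hx')
  have hf' : ∀ x ∈ s, Complex.exp (f x) = d x := hf
  refine ⟨fun x => f x - f x₀, ?_, ?_, by simp⟩
  · intro x hx
    refine ContDiffAt.contDiffWithinAt ?_
    -- The continuous logarithm is smooth because near x it is a branch of the principal one: d y /
    -- d x is close to 1, away from the cut.
    have hlog : ContDiffAt ℝ ∞ (fun y => Complex.log (d y / d x) + (f x - f x₀)) x := by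
      refine ContDiffAt.add ?_ contDiffAt_const
      have hl : ContDiffAt ℝ ∞ Complex.log (d x / d x) := by
        refine ContDiffAt.restrict_scalars ℝ (Complex.contDiffAt_log ?_)
        rw [div_self (h0 x hx)]
        simp
      exact hl.comp x (hd.contDiffAt.div_const (d x))
    refine hlog.congr_of_eventuallyEq ?_
    have hc : ContinuousAt f x := hfc.continuousAt (ho.mem_nhds hx)
    have hc2 : ContinuousAt (fun y => ‖f y - f x‖) x := (hc.sub continuousAt_const).norm
    -- Closeness within π keeps the imaginary part in the strip where the principal logarithm
    -- inverts exp.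
    have hsmall : ∀ᶠ y in nhds x, ‖f y - f x‖ < Real.pi :=
      hc2.eventually_lt continuousAt_const (by simpa using Real.pi_pos)
    filter_upwards [hsmall, ho.mem_nhds hx] with y hy hys
    have him := (Complex.abs_im_le_norm (f y - f x)).trans_lt hy
    rw [abs_lt] at him
    rw [← hf' y hys, ← hf' x hx, ← Complex.exp_sub, Complex.log_exp him.1 him.2.le]
    ring
  · intro x hx
    rw [Complex.exp_sub, hf' x hx, hf' x₀ hx₀, h1, div_one]

/-! ### Complex matrices with positive real part and their Gaussian integrals -/

namespace Matrix

variable {ι : Type*} [Fintype ι] [DecidableEq ι]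

open scoped MatrixOrder in
/-- A positive definite and a symmetric real matrix are diagonalised by one congruence. -/
theorem PosDef.exists_congr_diagonal {P Q : Matrix ι ι ℝ} (hP : P.PosDef) (hQ : Qᵀ = Q) :
    ∃ (R : Matrix ι ι ℝ) (d : ι → ℝ), R.det ≠ 0 ∧ P = Rᵀ * R ∧ Q = Rᵀ * diagonal d * R := by
  obtain ⟨B, hB⟩ := CStarAlgebra.nonneg_iff_eq_star_mul_self.mp hP.posSemidef.nonneg
  rw [star_eq_conjTranspose, conjTranspose_eq_transpose_of_trivial] at hB
  have hBdet : B.det ≠ 0 := by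
    intro h
    have := hP.det_pos
    rw [hB, det_mul, h] at this
    simp at this
  have hBu : IsUnit B.det := hBdet.isUnit
  -- With P = BᵀB, the congruence by B⁻¹ takes P to 1 and leaves Q symmetric. An orthogonal
  -- diagonalisation O of the result preserves 1, whence R = OᵀB.
  have hH : ((B⁻¹)ᵀ * Q * B⁻¹).IsHermitian := by
    rw [IsHermitian, conjTranspose_eq_transpose_of_trivial]
    simp only [transpose_mul, transpose_transpose, hQ, Matrix.mul_assoc]
  have hs := hH.spectral_theorem
  set O : Matrix ι ι ℝ := (hH.eigenvectorUnitary : Matrix ι ι ℝ) with hO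
  have hOO : O * Oᵀ = 1 := by
    have := Unitary.mul_star_self_of_mem hH.eigenvectorUnitary.2
    rwa [star_eq_conjTranspose, conjTranspose_eq_transpose_of_trivial] at this
  have hs' : (B⁻¹)ᵀ * Q * B⁻¹ = O * diagonal hH.eigenvalues * Oᵀ := by
    rw [Unitary.conjStarAlgAut_apply, star_eq_conjTranspose,
      conjTranspose_eq_transpose_of_trivial] at hs
    exact hs
  have hBB : B⁻¹ * B = 1 := nonsing_inv_mul _ hBu
  have hBT : Bᵀ * (B⁻¹)ᵀ = 1 := by rw [← transpose_mul, hBB, transpose_one]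
  refine ⟨Oᵀ * B, hH.eigenvalues, ?_, ?_, ?_⟩
  · rw [det_mul]
    refine mul_ne_zero ?_ hBdet
    intro h
    have := congrArg det hOO
    rw [det_mul, h] at this
    simp at this
  · rw [hB, transpose_mul, transpose_transpose, Matrix.mul_assoc, ← Matrix.mul_assoc O, hOO,
      Matrix.one_mul]
  · calc Q = (Bᵀ * (B⁻¹)ᵀ) * Q * (B⁻¹ * B) := by rw [hBB, hBT, Matrix.one_mul, Matrix.mul_one]
      _ = Bᵀ * ((B⁻¹)ᵀ * Q * B⁻¹) * B := by simp only [Matrix.mul_assoc]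
      _ = _ := by
        simp only [hs'.trans rfl]
        simp only [transpose_mul, transpose_transpose, Matrix.mul_assoc]

variable (ι) in
/-- The complex matrices with positive definite real part. -/
def posRe : Set (Matrix ι ι ℂ) := {M | ∀ x : ι → ℂ, x ≠ 0 → 0 < (star x ⬝ᵥ (M *ᵥ x)).re}

theorem convex_posRe : Convex ℝ (posRe ι) := by
  intro M hM N hN s t hs ht hst x hx
  have h1 := hM x hx
  have h2 := hN x hx
  rw [add_mulVec, smul_mulVec, smul_mulVec, dotProduct_add, dotProduct_smul, dotProduct_smul,
    Complex.add_re, Complex.smul_re, Complex.smul_re, smul_eq_mul, smul_eq_mul]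
  rcases hs.eq_or_lt with rfl | hs'
  · rw [zero_add] at hst
    subst hst
    linarith
  · have := mul_pos hs' h1
    have := mul_nonneg ht h2.le
    linarith

open scoped ComplexOrder in
theorem one_mem_posRe : (1 : Matrix ι ι ℂ) ∈ posRe ι := by
  intro x hx
  rw [one_mulVec]
  have := dotProduct_star_self_pos_iff (v := x) |>.mpr hx
  exact (Complex.lt_def.mp this).1

/-- A kernel vector would make the Hermitian form vanish. -/
theorem det_ne_zero_of_mem_posRe {M : Matrix ι ι ℂ} (hM : M ∈ posRe ι) : M.det ≠ 0 := by
  intro h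
  obtain ⟨v, hv, hv0⟩ := exists_mulVec_eq_zero_iff.mpr h
  have := hM v hv
  simp [hv0] at this

/-- `Rᵀ (1 + i diag d) R`. -/
def complexCongr (R : Matrix ι ι ℝ) (d : ι → ℝ) : Matrix ι ι ℂ :=
  (R.map Complex.ofReal)ᵀ * diagonal (fun k => 1 + Complex.I * d k) * R.map Complex.ofReal

theorem complexCongr_eq (R : Matrix ι ι ℝ) (d : ι → ℝ) :
    complexCongr R d = (Rᵀ * R).map Complex.ofReal +
      Complex.I • (Rᵀ * diagonal d * R).map Complex.ofReal := by
  have h : diagonal (fun k => 1 + Complex.I * (d k : ℂ)) =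
      1 + Complex.I • (diagonal d).map Complex.ofReal := by
    ext i k
    by_cases hik : i = k
    · subst hik; simp
    · simp [hik]
  have hm : ∀ A B : Matrix ι ι ℝ, (A * B).map Complex.ofReal =
      A.map Complex.ofReal * B.map Complex.ofReal := fun A B =>
    Matrix.map_mul (f := Complex.ofRealHom)
  rw [complexCongr, h, hm, hm, hm, transpose_map]
  simp [Matrix.mul_add, Matrix.add_mul]

/-- With y = Rx the form is ∑ (1 + i d_k)|y_k|², whose real part is |y|²; y is nonzero because R is
invertible. -/
theorem complexCongr_mem_posRe {R : Matrix ι ι ℝ} (hR : R.det ≠ 0) (d : ι → ℝ) :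
    complexCongr R d ∈ posRe ι := by
  intro x hx
  set y := R.map Complex.ofReal *ᵥ x with hy
  have hdet : (R.map Complex.ofReal).det ≠ 0 := by
    have : (R.map Complex.ofReal).det = Complex.ofRealHom R.det :=
      (RingHom.map_det Complex.ofRealHom R).symm
    rw [this]
    simpa using hR
  have hy0 : y ≠ 0 := by
    intro h
    exact hx (eq_zero_of_mulVec_eq_zero hdet h)
  have hstar : star x ᵥ* (R.map Complex.ofReal)ᵀ = star y := by
    rw [hy, star_mulVec]
    congr 1
    ext i k
    simp
  have e : star x ⬝ᵥ (complexCongr R d *ᵥ x) = ∑ k, (1 + Complex.I * d k) * (‖y k‖ ^ 2 : ℝ) := by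
    rw [complexCongr, ← mulVec_mulVec, ← mulVec_mulVec, dotProduct_mulVec, hstar]
    simp only [dotProduct, mulVec_diagonal]
    refine Finset.sum_congr rfl fun k _ => ?_
    rw [Pi.star_apply, mul_left_comm, RCLike.star_def, Complex.conj_mul']
    push_cast
    rfl
  rw [e, Complex.re_sum]
  have e2 : ∀ k, ((1 + Complex.I * (d k : ℂ)) * ((‖y k‖ ^ 2 : ℝ) : ℂ)).re = ‖y k‖ ^ 2 := by
    intro k
    rw [Complex.re_mul_ofReal]
    simp
  simp_rw [e2]
  obtain ⟨k, hk⟩ := Function.ne_iff.mp hy0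
  refine Finset.sum_pos' (fun _ _ => by positivity) ⟨k, Finset.mem_univ _, ?_⟩
  have : 0 < ‖y k‖ := norm_pos_iff.mpr hk
  positivity

theorem det_complexCongr (R : Matrix ι ι ℝ) (d : ι → ℝ) :
    (complexCongr R d).det = (R.det : ℂ) ^ 2 * ∏ k, (1 + Complex.I * d k) := by
  have : (R.map Complex.ofReal).det = (R.det : ℂ) :=
    (RingHom.map_det Complex.ofRealHom R).symm
  rw [complexCongr, det_mul, det_mul, det_transpose, det_diagonal, this]
  ring

theorem complexCongr_zero (R : Matrix ι ι ℝ) :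
    complexCongr R 0 = (Rᵀ * R).map Complex.ofReal := by
  rw [complexCongr_eq]
  simp

/-- A continuous logarithm of the determinant on the complex matrices with positive definite real
part, normalised at the identity. -/
structure IsLogDet (a : Matrix ι ι ℂ → ℂ) : Prop where
  continuousOn : ContinuousOn a (posRe ι)
  det_eq : ∀ M ∈ posRe ι, M.det = Complex.exp (a M)
  one : a 1 = 0

/-- This determines the branch exp(-a/2) up to sign. The sign is then fixed by continuity, along a
path to a point where the value is known. -/
theorem IsLogDet.exp_neg_half_sq {a : Matrix ι ι ℂ → ℂ} (ha : IsLogDet a) {M : Matrix ι ι ℂ}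
    (hM : M ∈ posRe ι) : Complex.exp (-(1 / 2) * a M) ^ 2 = M.det⁻¹ := by
  rw [ha.det_eq M hM, ← Complex.exp_neg, ← Complex.exp_nat_mul]
  congr 1
  push_cast
  ring

/-- Along the segment from 1 to RᵀR both exp(-a/2) and the positive root of 1/det are continuous
with equal squares. They agree at 1, hence also at the other end. -/
theorem IsLogDet.exp_real {a : Matrix ι ι ℂ → ℂ} (ha : IsLogDet a) {R : Matrix ι ι ℝ}
    (hR : R.det ≠ 0) :
    Complex.exp (-(1 / 2) * a (complexCongr R 0)) = ((|R.det|⁻¹ : ℝ) : ℂ) := by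
  let N : ℝ → Matrix ι ι ℝ := fun s => (1 - s) • 1 + s • (Rᵀ * R)
  have hNM : ∀ s, (N s).map Complex.ofReal =
      (1 - s) • (1 : Matrix ι ι ℂ) + s • complexCongr R 0 := by
    intro s
    rw [complexCongr_zero]
    ext i k
    by_cases hik : i = k <;> simp [N, hik]
  have hN : ∀ s ∈ Icc (0 : ℝ) 1, (N s).map Complex.ofReal ∈ posRe ι := by
    intro s hs
    rw [hNM]
    exact convex_posRe one_mem_posRe (complexCongr_mem_posRe hR 0) (by linarith [hs.2]) hs.1
      (by ring)
  have hdet : ∀ s, ((N s).map Complex.ofReal).det = ((N s).det : ℂ) := fun s =>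
    (RingHom.map_det Complex.ofRealHom (N s)).symm
  have hcN : Continuous N := by fun_prop
  have hcd : Continuous fun s => (N s).det := hcN.matrix_det
  have hd0 : ∀ s ∈ Icc (0 : ℝ) 1, (N s).det ≠ 0 := by
    intro s hs h
    have := det_ne_zero_of_mem_posRe (hN s hs)
    rw [hdet, h] at this
    simp at this
  -- The determinant starts at 1 and never vanishes on the segment, so it cannot change sign.
  have hpos : ∀ s ∈ Icc (0 : ℝ) 1, 0 < (N s).det := by
    intro s hs
    by_contra hneg
    have h0 : (N 0).det = 1 := by simp [N]
    obtain ⟨t, ht, ht0⟩ := intermediate_value_Icc' hs.1 hcd.continuousOn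
      (show (0 : ℝ) ∈ Icc (N s).det (N 0).det by
        rw [h0]; exact ⟨not_lt.mp hneg, zero_le_one⟩)
    exact hd0 t ⟨ht.1, ht.2.trans hs.2⟩ ht0
  have key := isPreconnected_Icc.eq_of_sq_eq (S := Icc (0 : ℝ) 1)
    (f := fun s => Complex.exp (-(1 / 2) * a ((N s).map Complex.ofReal)))
    (g := fun s => (((Real.sqrt (N s).det)⁻¹ : ℝ) : ℂ))
    (by
      refine ContinuousOn.cexp (continuousOn_const.mul (ha.continuousOn.comp ?_ hN))
      exact (hcN.matrix_map Complex.continuous_ofReal).continuousOn)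
    (by
      refine Complex.continuous_ofReal.comp_continuousOn (ContinuousOn.inv₀ ?_ ?_)
      · exact (Real.continuous_sqrt.comp hcd).continuousOn
      · intro s hs
        exact (Real.sqrt_pos.mpr (hpos s hs)).ne')
    (by
      intro s hs
      simp only [Pi.pow_apply]
      rw [ha.exp_neg_half_sq (hN s hs), hdet, ← Complex.ofReal_pow, inv_pow,
        Real.sq_sqrt (hpos s hs).le]
      push_cast
      rfl)
    (by
      intro s hs
      exact Complex.ofReal_ne_zero.mpr (inv_ne_zero (Real.sqrt_pos.mpr (hpos s hs)).ne'))
    (y := 0) (by simp)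
    (by
      have : (N 0).map Complex.ofReal = 1 := by rw [hNM]; simp
      simp only [this, ha.one]
      simp [N])
  have h1 := key (show (1 : ℝ) ∈ Icc (0 : ℝ) 1 by simp)
  have hN1 : N 1 = Rᵀ * R := by simp [N]
  simp only [hN1] at h1
  rw [complexCongr_zero, h1, det_mul, det_transpose, Real.sqrt_mul_self_eq_abs]

/-- The scaling of d by t ∈ ℝ deforms the real case t = 0 to t = 1. The principal roots vary
continuously since each 1/(1 + i t d_k) stays in the right half plane, so equality of squares
propagates. -/
theorem IsLogDet.exp_complexCongr {a : Matrix ι ι ℂ → ℂ} (ha : IsLogDet a) {R : Matrix ι ι ℝ}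
    (hR : R.det ≠ 0) (d : ι → ℝ) :
    Complex.exp (-(1 / 2) * a (complexCongr R d)) =
      ((|R.det|⁻¹ : ℝ) : ℂ) * ∏ k, (1 / (1 + Complex.I * d k)) ^ (1 / 2 : ℂ) := by
  have hre : ∀ (t : ℝ) (k : ι), 0 < (1 / (1 + Complex.I * ((t * d k : ℝ) : ℂ))).re := by
    intro t k
    rw [one_div, Complex.inv_re]
    refine div_pos (by simp) (Complex.normSq_pos.mpr fun h => ?_)
    have := congrArg Complex.re h
    simp at this
  have hne : ∀ (t : ℝ) (k : ι), 1 + Complex.I * ((t * d k : ℝ) : ℂ) ≠ 0 := by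
    intro t k h
    have := hre t k
    rw [h] at this
    simp at this
  have hcont : Continuous fun t : ℝ => complexCongr R (fun k => t * d k) := by
    unfold complexCongr
    fun_prop
  have hsq : ∀ z : ℂ, (z ^ (1 / 2 : ℂ)) ^ 2 = z := by
    intro z
    rw [← Complex.cpow_nat_mul]
    norm_num
  have key := isPreconnected_univ.eq_of_sq_eq (S := (univ : Set ℝ))
    (f := fun t => Complex.exp (-(1 / 2) * a (complexCongr R (fun k => t * d k))))
    (g := fun t => ((|R.det|⁻¹ : ℝ) : ℂ) *
      ∏ k, (1 / (1 + Complex.I * ((t * d k : ℝ) : ℂ))) ^ (1 / 2 : ℂ))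
    (ContinuousOn.cexp (continuousOn_const.mul (ha.continuousOn.comp hcont.continuousOn
      fun t _ => complexCongr_mem_posRe hR _)))
    (by
      refine continuousOn_const.mul (continuousOn_finsetProd _ fun k _ => ?_)
      refine ContinuousOn.cpow ?_ continuousOn_const fun t _ => Or.inl (hre t k)
      refine ContinuousOn.div continuousOn_const ?_ fun t _ => hne t k
      fun_prop)
    (by
      intro t _
      simp only [Pi.pow_apply]
      rw [ha.exp_neg_half_sq (complexCongr_mem_posRe hR _), det_complexCongr, mul_pow,
        ← Finset.prod_pow, mul_inv, ← Complex.ofReal_pow, ← Complex.ofReal_pow, inv_pow, sq_abs]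
      simp_rw [hsq, one_div]
      rw [Finset.prod_inv_distrib]
      push_cast
      rfl)
    (by
      intro t _
      refine mul_ne_zero (Complex.ofReal_ne_zero.mpr (inv_ne_zero (abs_ne_zero.mpr hR)))
        (Finset.prod_ne_zero_iff.mpr fun k _ h => ?_)
      have := hre t k
      rw [← hsq (1 / (1 + Complex.I * ((t * d k : ℝ) : ℂ))), h] at this
      simp at this)
    (y := 0) (mem_univ _)
    (by
      have h0 : (fun k => (0 : ℝ) * d k) = 0 := by ext; simp
      simp only [h0]
      rw [ha.exp_real hR]
      simp)
  simpa using key (mem_univ 1)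

theorem measurableEmbedding_mulVec {R : Matrix ι ι ℝ} (hR : R.det ≠ 0) :
    MeasurableEmbedding fun y : ι → ℝ => R *ᵥ y := by
  have hc : Continuous fun y : ι → ℝ => R *ᵥ y := by fun_prop
  exact hc.measurableEmbedding (mulVec_injective_iff_isUnit.mpr
    ((isUnit_iff_isUnit_det R).mpr hR.isUnit))

theorem map_mulVec_volume {R : Matrix ι ι ℝ} (hR : R.det ≠ 0) :
    MeasureTheory.Measure.map (fun y : ι → ℝ => R *ᵥ y) MeasureTheory.volume =
      ENNReal.ofReal |R.det|⁻¹ • MeasureTheory.volume := by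
  have h2 := Real.map_matrix_volume_pi_eq_smul_volume_pi hR
  have h3 : (⇑(toLin' R) : (ι → ℝ) → ι → ℝ) = fun y => R *ᵥ y := by ext; simp
  rwa [h3, abs_inv] at h2

theorem integral_comp_mulVec {R : Matrix ι ι ℝ} (hR : R.det ≠ 0) (f : (ι → ℝ) → ℂ) :
    ∫ y, f (R *ᵥ y) = ((|R.det|⁻¹ : ℝ) : ℂ) * ∫ y, f y := by
  rw [← (measurableEmbedding_mulVec hR).integral_map, map_mulVec_volume hR,
    MeasureTheory.integral_smul_measure, ENNReal.toReal_ofReal (inv_nonneg.mpr (abs_nonneg _)),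
    Complex.real_smul]

theorem integrable_comp_mulVec {R : Matrix ι ι ℝ} (hR : R.det ≠ 0) {f : (ι → ℝ) → ℝ}
    (hf : MeasureTheory.Integrable f) : MeasureTheory.Integrable fun y => f (R *ᵥ y) := by
  have := ((measurableEmbedding_mulVec hR).integrable_map_iff (g := f)
    (μ := MeasureTheory.volume)).mp (by
      rw [map_mulVec_volume hR]
      exact hf.smul_measure ENNReal.ofReal_ne_top)
  exact this

theorem quasiMeasurePreserving_mulVec {R : Matrix ι ι ℝ} (hR : R.det ≠ 0) :
    MeasureTheory.Measure.QuasiMeasurePreserving (fun y : ι → ℝ => R *ᵥ y) := by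
  refine ⟨(measurableEmbedding_mulVec hR).measurable, ?_⟩
  rw [map_mulVec_volume hR]
  exact MeasureTheory.Measure.smul_absolutelyContinuous

/-- The Gaussian integral of a complex symmetric matrix with positive definite real part. -/
theorem IsLogDet.integral_gaussian {a : Matrix ι ι ℂ → ℂ} (ha : IsLogDet a) {P Q : Matrix ι ι ℝ}
    (hP : P.PosDef) (hQ : Qᵀ = Q) {M : Matrix ι ι ℂ}
    (hM : M = P.map Complex.ofReal + Complex.I • Q.map Complex.ofReal) {c : ℝ} (hc : 0 < c)
    (b : ι → ℂ) :
    ∫ y : ι → ℝ, Complex.exp (-c * ((Complex.ofReal ∘ y) ⬝ᵥ M *ᵥ (Complex.ofReal ∘ y)) +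
        b ⬝ᵥ (Complex.ofReal ∘ y)) =
      ((Real.sqrt (Real.pi / c) ^ Fintype.card ι : ℝ) : ℂ) * Complex.exp (-(1 / 2) * a M) *
        Complex.exp ((b ⬝ᵥ M⁻¹ *ᵥ b) / (4 * c)) := by
  -- Simultaneous diagonalisation and the substitution u = Ry split the integral into
  -- one-dimensional Gaussians.
  obtain ⟨R, d, hR, rfl, rfl⟩ := hP.exists_congr_diagonal hQ
  rw [← complexCongr_eq] at hM
  subst hM
  set RC := R.map Complex.ofReal with hRC
  have hRCdet : IsUnit RC.det := by
    have : RC.det = (R.det : ℂ) := (RingHom.map_det Complex.ofRealHom R).symm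
    rw [this]
    exact (Complex.ofReal_ne_zero.mpr hR).isUnit
  have hI1 : RC * RC⁻¹ = 1 := mul_nonsing_inv _ hRCdet
  have hI2 : RC⁻¹ * RC = 1 := nonsing_inv_mul _ hRCdet
  have hI3 : (RC⁻¹)ᵀ * RCᵀ = 1 := by rw [← transpose_mul, hI1, transpose_one]
  have hI4 : RCᵀ * (RC⁻¹)ᵀ = 1 := by rw [← transpose_mul, hI2, transpose_one]
  have hne : ∀ k, 1 + Complex.I * (d k : ℂ) ≠ 0 := by
    intro k h
    have := congrArg Complex.re h
    simp at this
  have hMinv : (complexCongr R d)⁻¹ =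
      RC⁻¹ * diagonal (fun k => 1 / (1 + Complex.I * d k)) * (RC⁻¹)ᵀ := by
    refine inv_eq_right_inv ?_
    have hD : diagonal (fun k => 1 + Complex.I * (d k : ℂ)) *
        diagonal (fun k => 1 / (1 + Complex.I * (d k : ℂ))) = 1 := by
      rw [diagonal_mul_diagonal, ← diagonal_one]
      congr 1
      ext k
      exact mul_one_div_cancel (hne k)
    calc RCᵀ * diagonal (fun k => 1 + Complex.I * (d k : ℂ)) * RC *
          (RC⁻¹ * diagonal (fun k => 1 / (1 + Complex.I * (d k : ℂ))) * (RC⁻¹)ᵀ)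
        = RCᵀ * diagonal (fun k => 1 + Complex.I * (d k : ℂ)) * (RC * RC⁻¹) *
          diagonal (fun k => 1 / (1 + Complex.I * (d k : ℂ))) * (RC⁻¹)ᵀ := by
          simp only [Matrix.mul_assoc]
      _ = RCᵀ * (diagonal (fun k => 1 + Complex.I * (d k : ℂ)) *
          diagonal (fun k => 1 / (1 + Complex.I * (d k : ℂ)))) * (RC⁻¹)ᵀ := by
          rw [hI1]; simp only [Matrix.mul_assoc, Matrix.one_mul]
      _ = 1 := by rw [hD, Matrix.mul_one, hI4]
  set e := (RC⁻¹)ᵀ *ᵥ b with he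
  have hquad : b ⬝ᵥ (complexCongr R d)⁻¹ *ᵥ b = ∑ k, e k ^ 2 / (1 + Complex.I * d k) := by
    rw [hMinv, ← mulVec_mulVec, ← mulVec_mulVec, dotProduct_mulVec, ← mulVec_transpose, ← he]
    simp only [dotProduct, mulVec_diagonal]
    refine Finset.sum_congr rfl fun k _ => ?_
    ring
  let f : (ι → ℝ) → ℂ := fun u => Complex.exp
    (-∑ k, (c * (1 + Complex.I * d k)) * (u k : ℂ) ^ 2 + ∑ k, e k * u k)
  have hRy : ∀ y : ι → ℝ, (Complex.ofReal ∘ (R *ᵥ y)) = RC *ᵥ (Complex.ofReal ∘ y) := by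
    intro y
    ext k
    simp [mulVec, dotProduct, hRC]
  have hfR : ∀ y : ι → ℝ, Complex.exp (-c * ((Complex.ofReal ∘ y) ⬝ᵥ complexCongr R d *ᵥ
      (Complex.ofReal ∘ y)) + b ⬝ᵥ (Complex.ofReal ∘ y)) = f (R *ᵥ y) := by
    intro y
    have h1 : ∀ k, (((R *ᵥ y) k : ℝ) : ℂ) = (RC *ᵥ (Complex.ofReal ∘ y)) k := fun k =>
      congrFun (hRy y) k
    simp only [f, h1]
    congr 2
    · rw [neg_mul, neg_inj, complexCongr, ← hRC, ← mulVec_mulVec, ← mulVec_mulVec,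
        dotProduct_mulVec, vecMul_transpose]
      simp only [dotProduct, mulVec_diagonal, Finset.mul_sum]
      refine Finset.sum_congr rfl fun k _ => ?_
      ring
    · change _ = e ⬝ᵥ (RC *ᵥ (Complex.ofReal ∘ y))
      rw [dotProduct_mulVec, he, ← mulVec_transpose, mulVec_mulVec, hI4, one_mulVec]
  simp_rw [hfR]
  rw [integral_comp_mulVec hR f, GaussianFourier.integral_cexp_neg_sum_mul_add
    (fun k => by simpa using hc), Finset.prod_mul_distrib, ← Complex.exp_sum, hquad,
    ha.exp_complexCongr hR, ← mul_assoc]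
  congr 1
  -- The principal square root of this product factors because π/c is a positive real.
  · have hk : ∀ k, ((Real.pi : ℂ) / (c * (1 + Complex.I * d k))) ^ (1 / 2 : ℂ) =
        (Real.sqrt (Real.pi / c) : ℂ) * (1 / (1 + Complex.I * d k)) ^ (1 / 2 : ℂ) := by
      intro k
      have h1 : (Real.pi : ℂ) / (c * (1 + Complex.I * d k)) =
          ((Real.pi / c : ℝ) : ℂ) * (1 / (1 + Complex.I * d k)) := by
        push_cast
        field_simp
      have hpc : 0 < Real.pi / c := by positivity
      have hz : 1 / (1 + Complex.I * (d k : ℂ)) ≠ 0 := one_div_ne_zero (hne k)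
      rw [h1, Complex.cpow_def_of_ne_zero (mul_ne_zero (Complex.ofReal_ne_zero.mpr hpc.ne') hz),
        Complex.cpow_def_of_ne_zero hz, Complex.log_ofReal_mul hpc hz, add_mul, Complex.exp_add,
        Real.sqrt_eq_rpow, Real.rpow_def_of_pos hpc]
      push_cast
      rfl
    simp_rw [hk]
    rw [Finset.prod_mul_distrib, Finset.prod_const, Finset.card_univ]
    push_cast
    ring
  · congr 1
    rw [Finset.sum_div]
    refine Finset.sum_congr rfl fun k _ => ?_
    have := hne k
    have hc' : (c : ℂ) ≠ 0 := Complex.ofReal_ne_zero.mpr hc.ne'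
    field_simp

end Matrix

/-! ### Injectivity of the Fourier transform -/

open MeasureTheory in
open scoped FourierTransform SchwartzMap in
/-- The Fourier transform is injective on integrable functions. -/
theorem MeasureTheory.Integrable.ae_eq_zero_of_fourier_eq_zero {W : Type*} [NormedAddCommGroup W]
    [InnerProductSpace ℝ W] [FiniteDimensional ℝ W] [MeasurableSpace W] [BorelSpace W]
    {f : W → ℂ} (hf : Integrable f) (h : ∀ w, 𝓕 f w = 0) : ∀ᵐ x, f x = 0 := by
  refine ae_eq_zero_of_integral_contDiff_smul_eq_zero hf.locallyIntegrable fun g hg hgc => ?_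
  have hc : HasCompactSupport (fun x => (g x : ℂ)) := hgc.comp_left (g := Complex.ofReal) rfl
  have hs : ContDiff ℝ ∞ fun x => (g x : ℂ) := Complex.ofRealCLM.contDiff.comp hg
  -- Every test function is the Fourier transform of a Schwartz function. Moving the transform onto
  -- f turns ∫ g f into an integral against 𝓕 f = 0.
  set G : 𝓢(W, ℂ) := hc.toSchwartzMap hs with hG
  have key := VectorFourier.integral_fourierIntegral_smul_eq_flip (L := innerₗ W) (μ := volume)
    (ν := volume) Real.continuous_fourierChar continuous_inner
    (SchwartzMap.integrable (𝓕⁻ G : 𝓢(W, ℂ)) (μ := volume)) hf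
  have e1 : ∀ ξ, VectorFourier.fourierIntegral Real.fourierChar volume (innerₗ W)
      ((𝓕⁻ G : 𝓢(W, ℂ)) : W → ℂ) ξ = (g ξ : ℂ) := by
    intro ξ
    have : (𝓕 (𝓕⁻ G : 𝓢(W, ℂ)) : 𝓢(W, ℂ)) ξ = G ξ := by rw [FourierTransform.fourier_fourierInv_eq]
    rw [SchwartzMap.fourier_coe] at this
    exact this
  have e2 : ∀ x, VectorFourier.fourierIntegral Real.fourierChar volume (innerₗ W).flip f x = 0 := by
    intro x
    rw [flip_innerₗ]
    exact h x
  simp only [e1, e2, smul_zero, integral_zero] at key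
  simpa using key

/-! ### The Gaussians that model coherent states in L² -/

namespace Bargmann

variable {ι : Type*} [Fintype ι]

/-- The real vector `x`, as a complex vector. -/
abbrev toC (x : ι → ℝ) : ι → ℂ := Complex.ofReal ∘ x

theorem toC_add (x y : ι → ℝ) : toC (x + y) = toC x + toC y := by ext; simp

theorem toC_smul (r : ℝ) (x : ι → ℝ) : toC (r • x) = (r : ℂ) • toC x := by ext; simp

theorem star_toC (x : ι → ℝ) : star (toC x) = toC x := by ext; simp

theorem toC_dotProduct (x y : ι → ℝ) : toC x ⬝ᵥ toC y = ((x ⬝ᵥ y : ℝ) : ℂ) := by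
  simp [dotProduct]

theorem toC_mulVec (M : Matrix ι ι ℝ) (x : ι → ℝ) :
    toC (M *ᵥ x) = M.map Complex.ofReal *ᵥ toC x := by
  ext
  simp [Matrix.mulVec, dotProduct]

theorem continuous_toC : Continuous (toC : (ι → ℝ) → ι → ℂ) := by
  unfold toC
  fun_prop

theorem gauss_integrable {c : ℝ} (hc : 0 < c) (b : ι → ℂ) :
    MeasureTheory.Integrable fun x : ι → ℝ =>
      Complex.exp (-c * (toC x ⬝ᵥ toC x) + b ⬝ᵥ toC x) := by
  have := GaussianFourier.integrable_cexp_neg_mul_sum_add (b := (c : ℂ)) (by simpa using hc) b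
  simpa [dotProduct, sq] using this

theorem gauss_integral {c : ℝ} (hc : 0 < c) (b : ι → ℂ) :
    ∫ x : ι → ℝ, Complex.exp (-c * (toC x ⬝ᵥ toC x) + b ⬝ᵥ toC x) =
      ((Real.sqrt (Real.pi / c) ^ Fintype.card ι : ℝ) : ℂ) *
        Complex.exp ((b ⬝ᵥ b) / (4 * c)) := by
  have h := GaussianFourier.integral_cexp_neg_mul_sum_add (b := (c : ℂ)) (by simpa using hc) b
  have hpc : 0 ≤ Real.pi / c := by positivity
  have e : ((Real.pi : ℂ) / c) ^ (Fintype.card ι / 2 : ℂ) =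
      ((Real.sqrt (Real.pi / c) ^ Fintype.card ι : ℝ) : ℂ) := by
    rw [Real.sqrt_eq_rpow, ← Real.rpow_natCast, ← Real.rpow_mul hpc, Complex.ofReal_cpow hpc]
    push_cast
    congr 1
    ring
  rw [e] at h
  simpa [dotProduct, sq] using h

theorem gauss_memLp {c : ℝ} (hc : 0 < c) (b : ι → ℂ) :
    MeasureTheory.MemLp (fun x : ι → ℝ =>
      Complex.exp (-c * (toC x ⬝ᵥ toC x) + b ⬝ᵥ toC x)) 2 := by
  have hcont : Continuous fun x : ι → ℝ => Complex.exp (-c * (toC x ⬝ᵥ toC x) + b ⬝ᵥ toC x) := by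
    have := continuous_toC (ι := ι)
    fun_prop
  rw [MeasureTheory.memLp_two_iff_integrable_sq_norm hcont.aestronglyMeasurable]
  refine (gauss_integrable (ι := ι) (c := 2 * c) (by positivity) ((2 : ℂ) • b)).norm.congr
    (Filter.Eventually.of_forall fun x => ?_)
  simp only
  rw [← norm_pow, ← Complex.exp_nat_mul]
  congr 2
  rw [smul_dotProduct, smul_eq_mul]
  push_cast
  ring

variable (ι) in
/-- The Hilbert space `L²(ℝ^ι)`. -/
abbrev L2 : Type _ := MeasureTheory.Lp ℂ 2 (MeasureTheory.volume : MeasureTheory.Measure (ι → ℝ))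

variable (ι) in
/-- The normalising constant `(π ħ)^(-n/4)`. -/
def gaussConst (hbar : ℝ) : ℝ := (Real.sqrt (Real.sqrt (Real.pi * hbar) ^ Fintype.card ι))⁻¹

theorem gaussConst_pos {hbar : ℝ} (hb : 0 < hbar) : 0 < gaussConst ι hbar := by
  have := Real.pi_pos
  unfold gaussConst
  positivity

theorem gaussConst_sq {hbar : ℝ} (hb : 0 < hbar) :
    gaussConst ι hbar * gaussConst ι hbar * Real.sqrt (Real.pi / (1 / hbar)) ^ Fintype.card ι
      = 1 := by
  have := Real.pi_pos
  have h : 0 < Real.sqrt (Real.pi * hbar) ^ Fintype.card ι := by positivity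
  rw [gaussConst, ← mul_inv, Real.mul_self_sqrt h.le, div_div_eq_mul_div, div_one]
  exact inv_mul_cancel₀ h.ne'

/-- The Gaussian in `L²(ℝ^ι)` that corresponds to the coherent state `e_v`. -/
def phi (hbar : ℝ) (v : ι → ℂ) (x : ι → ℝ) : ℂ :=
  gaussConst ι hbar * Complex.exp (1 / (4 * hbar) *
    (-2 * (toC x ⬝ᵥ toC x) + 4 * Complex.I * (star v ⬝ᵥ toC x) + star v ⬝ᵥ star v))

theorem conj_phi (hbar : ℝ) (v : ι → ℂ) (x : ι → ℝ) :
    starRingEnd ℂ (phi hbar v x) = gaussConst ι hbar * Complex.exp (1 / (4 * hbar) *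
      (-2 * (toC x ⬝ᵥ toC x) - 4 * Complex.I * (v ⬝ᵥ toC x) + v ⬝ᵥ v)) := by
  have hd : ∀ a b : ι → ℂ, starRingEnd ℂ (a ⬝ᵥ b) = star a ⬝ᵥ star b := by
    intro a b
    simp [dotProduct]
  rw [phi, map_mul, Complex.conj_ofReal, ← Complex.exp_conj]
  congr 2
  simp only [map_mul, map_add, map_div₀, map_one, map_neg, map_ofNat, Complex.conj_ofReal,
    Complex.conj_I, hd, star_toC, star_star]
  ring

variable {hbar : ℝ} (hb : 0 < hbar)
include hb

theorem phi_memLp (v : ι → ℂ) : MeasureTheory.MemLp (phi hbar v) 2 := by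
  have h := (gauss_memLp (ι := ι) (c := 1 / (2 * hbar)) (by positivity)
    ((Complex.I / hbar) • star v)).const_mul
    (gaussConst ι hbar * Complex.exp (1 / (4 * hbar) * (star v ⬝ᵥ star v)))
  refine h.ae_eq (Filter.Eventually.of_forall fun x => ?_)
  simp only [phi]
  rw [mul_assoc, ← Complex.exp_add, smul_dotProduct, smul_eq_mul]
  have : (hbar : ℂ) ≠ 0 := Complex.ofReal_ne_zero.mpr hb.ne'
  congr 2
  push_cast
  field_simp
  ring

/-- `phi` as an element of `L²`. -/
def phiL (v : ι → ℂ) : L2 ι := (phi_memLp hb v).toLp _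

theorem coeFn_phiL (v : ι → ℂ) : phiL hb v =ᵐ[MeasureTheory.volume] phi hbar v :=
  (phi_memLp hb v).coeFn_toLp

theorem inner_phiL_left (v : ι → ℂ) (ψ : L2 ι) :
    inner ℂ (phiL hb v) ψ = ∫ x, starRingEnd ℂ (phi hbar v x) * ψ x := by
  rw [MeasureTheory.L2.inner_def]
  refine MeasureTheory.integral_congr_ae ?_
  filter_upwards [coeFn_phiL hb v] with x hx
  rw [hx, RCLike.inner_apply, mul_comm]

/-- The product of the two Gaussians has linear term (i/ħ)(v̄ - z). Completing the square
contributes -(v̄ - z)²/4ħ, which cancels the factors with z² and v̄² and leaves the cross term, the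
reproducing kernel of the Fock space. -/
theorem inner_phiL_phiL (z v : ι → ℂ) :
    inner ℂ (phiL hb z) (phiL hb v) = Complex.exp ((z ⬝ᵥ star v) / (2 * hbar)) := by
  have hh : (hbar : ℂ) ≠ 0 := Complex.ofReal_ne_zero.mpr hb.ne'
  have e : ∀ x : ι → ℝ, starRingEnd ℂ (phi hbar z x) * phi hbar v x =
      (gaussConst ι hbar * gaussConst ι hbar *
        Complex.exp (1 / (4 * hbar) * (z ⬝ᵥ z + star v ⬝ᵥ star v))) *
      Complex.exp (-((1 / hbar : ℝ) : ℂ) * (toC x ⬝ᵥ toC x) +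
        ((Complex.I / hbar) • (star v - z)) ⬝ᵥ toC x) := by
    intro x
    rw [conj_phi, phi, mul_mul_mul_comm, ← Complex.exp_add, mul_assoc (_ * _), ← Complex.exp_add,
      smul_dotProduct, smul_eq_mul, sub_dotProduct]
    congr 2
    push_cast
    field_simp
    ring
  rw [inner_phiL_left]
  have e' : (fun x => starRingEnd ℂ (phi hbar z x) * phiL hb v x) =ᵐ[MeasureTheory.volume]
      fun x => starRingEnd ℂ (phi hbar z x) * phi hbar v x := by
    filter_upwards [coeFn_phiL hb v] with x hx
    rw [hx]
  rw [MeasureTheory.integral_congr_ae e']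
  simp_rw [e]
  rw [MeasureTheory.integral_const_mul,
    gauss_integral (by positivity : 0 < 1 / hbar)]
  have hc : (gaussConst ι hbar : ℂ) * gaussConst ι hbar *
      ((Real.sqrt (Real.pi / (1 / hbar)) ^ Fintype.card ι : ℝ) : ℂ) = 1 := by
    exact_mod_cast gaussConst_sq (ι := ι) hb
  rw [mul_mul_mul_comm, hc, one_mul, ← Complex.exp_add]
  congr 1
  simp only [smul_dotProduct, dotProduct_smul, sub_dotProduct, dotProduct_sub, smul_eq_mul]
  rw [dotProduct_comm (star v) z]
  push_cast
  field_simp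
  rw [Complex.I_sq]
  ring

/-- The Gaussians `phi` are total in `L²`. -/
theorem eq_zero_of_inner_phiL (ψ : L2 ι) (h : ∀ v : ι → ℂ, inner ℂ (phiL hb v) ψ = 0) :
    ψ = 0 := by
  have hh : (hbar : ℂ) ≠ 0 := Complex.ofReal_ne_zero.mpr hb.ne'
  -- The Gaussian for v = 0 has no zeros, so it suffices to show that w vanishes. Unlike ψ, which is
  -- only square integrable, w is integrable and has a pointwise Fourier transform.
  let w : (ι → ℝ) → ℂ := fun x => starRingEnd ℂ (phi hbar 0 x) * ψ x
  have hw : MeasureTheory.Integrable w := by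
    have h1 := (phi_memLp hb (0 : ι → ℂ)).star
    exact h1.integrable_mul (MeasureTheory.Lp.memLp ψ)
  have hw0 : ∀ x, starRingEnd ℂ (phi hbar (0 : ι → ℂ) x) ≠ 0 := by
    intro x
    rw [conj_phi]
    exact mul_ne_zero (Complex.ofReal_ne_zero.mpr (gaussConst_pos hb).ne') (Complex.exp_ne_zero _)
  have hmp := PiLp.volume_preserving_ofLp ι
  have hemb : MeasurableEmbedding (WithLp.ofLp : EuclideanSpace ℝ ι → ι → ℝ) :=
    (MeasurableEquiv.toLp 2 (ι → ℝ)).symm.measurableEmbedding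
  have hw' : MeasureTheory.Integrable (w ∘ (WithLp.ofLp : EuclideanSpace ℝ ι → ι → ℝ)) :=
    (hmp.integrable_comp_emb hemb).mpr hw
  have hz := hw'.ae_eq_zero_of_fourier_eq_zero (fun ξ => by
    rw [Real.fourier_eq']
    -- Real v suffice: for v = 2πħξ the factor exp(-i v·x/ħ) is the Fourier character exp(-2πi ξ·x).
    have h1 := h (toC ((2 * Real.pi * hbar) • ξ.ofLp))
    rw [inner_phiL_left] at h1
    have h2 : ∀ x : ι → ℝ, starRingEnd ℂ (phi hbar (toC ((2 * Real.pi * hbar) • ξ.ofLp)) x) * ψ x =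
        Complex.exp (1 / (4 * hbar) * (toC ((2 * Real.pi * hbar) • ξ.ofLp) ⬝ᵥ
          toC ((2 * Real.pi * hbar) • ξ.ofLp))) *
        (Complex.exp (((-2 * Real.pi * (ξ.ofLp ⬝ᵥ x) : ℝ) : ℂ) * Complex.I) * w x) := by
      intro x
      simp only [w]
      rw [conj_phi, conj_phi]
      simp only [zero_dotProduct, mul_zero, sub_zero, add_zero]
      rw [← mul_assoc, ← mul_assoc, ← Complex.exp_add, mul_left_comm, ← Complex.exp_add]
      congr 3
      rw [toC_smul, smul_dotProduct _ _ (toC x), toC_dotProduct ξ.ofLp x]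
      push_cast
      simp only [smul_eq_mul]
      field_simp
      ring
    simp_rw [h2] at h1
    rw [MeasureTheory.integral_const_mul] at h1
    have h3 := (mul_eq_zero.mp h1).resolve_left (Complex.exp_ne_zero _)
    rw [← hmp.integral_comp hemb] at h3
    rw [← h3]
    refine MeasureTheory.integral_congr_ae (Filter.Eventually.of_forall fun x => ?_)
    simp only [Function.comp, smul_eq_mul]
    rw [EuclideanSpace.inner_eq_star_dotProduct]
    simp)
  have hz2 : ∀ᵐ x : ι → ℝ, w x = 0 := by
    rw [← hmp.map_eq]
    exact (hemb.ae_map_iff).mpr hz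
  refine (MeasureTheory.Lp.eq_zero_iff_ae_eq_zero).mpr ?_
  filter_upwards [hz2] with x hx
  exact (mul_eq_zero.mp hx).resolve_left (hw0 x)

end Bargmann

/-! ### Holomorphic dependence of the Gaussians, and phase-composition operators -/

namespace Bargmann

variable {ι : Type*} [Fintype ι] {hbar : ℝ}

/-- The linear functional `z ↦ z · x`. -/
def dotCLM (x : ι → ℝ) : (ι → ℂ) →L[ℂ] ℂ :=
  ∑ i, (x i : ℂ) • ContinuousLinearMap.proj (R := ℂ) (φ := fun _ : ι => ℂ) i

theorem dotCLM_apply (x : ι → ℝ) (z : ι → ℂ) : dotCLM x z = z ⬝ᵥ toC x := by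
  simp [dotCLM, dotProduct, mul_comm]

theorem continuous_dotCLM : Continuous (dotCLM : (ι → ℝ) → (ι → ℂ) →L[ℂ] ℂ) := by
  unfold dotCLM
  fun_prop

theorem norm_dotCLM_le (x : ι → ℝ) : ‖dotCLM x‖ ≤ ∑ i, |x i| := by
  refine ContinuousLinearMap.opNorm_le_bound _ (Finset.sum_nonneg fun _ _ => abs_nonneg _)
    fun z => ?_
  rw [dotCLM_apply, Finset.sum_mul]
  refine (norm_sum_le _ _).trans (Finset.sum_le_sum fun i _ => ?_)
  rw [norm_mul, mul_comm]
  simp only [toC, Function.comp, Complex.norm_real, Real.norm_eq_abs]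
  exact mul_le_mul_of_nonneg_left (norm_le_pi_norm z i) (abs_nonneg _)

/-- This supplies a z-independent majorant for differentiation under the integral. The factor from
the derivative is absorbed by t ≤ exp t, and in each coordinate half of the Gaussian decay is spent:
the remaining inequality is (|x_i|/2 - (R + 1))² ≥ 0. -/
theorem gauss_bound (hb : 0 < hbar) {R : ℝ} {z : ι → ℂ} (hz : ‖z‖ ≤ R) (x : ι → ℝ) :
    ‖Complex.exp (-(1 / (2 * hbar)) * (toC x ⬝ᵥ toC x) - Complex.I / hbar * (z ⬝ᵥ toC x))‖ *
      (1 / hbar * ∑ i, |x i|) ≤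
    Real.exp (Fintype.card ι * ((R + 1) ^ 2 / hbar)) * Real.exp (-(1 / (4 * hbar)) * (x ⬝ᵥ x)) := by
  have e1 : (-(1 / (2 * (hbar : ℂ))) * (toC x ⬝ᵥ toC x) - Complex.I / hbar * (z ⬝ᵥ toC x)).re =
      ∑ i, (-(1 / (2 * hbar)) * (x i * x i) + (z i).im / hbar * x i) := by
    have h1 : (-(1 / (2 * (hbar : ℂ))) * (toC x ⬝ᵥ toC x) - Complex.I / hbar * (z ⬝ᵥ toC x)) =
        ∑ i, (((-(1 / (2 * hbar)) * (x i * x i) : ℝ) : ℂ) -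
          Complex.I * z i * ((x i / hbar : ℝ) : ℂ)) := by
      rw [dotProduct, dotProduct, Finset.mul_sum, Finset.mul_sum, ← Finset.sum_sub_distrib]
      refine Finset.sum_congr rfl fun i _ => ?_
      simp only [toC, Function.comp]
      push_cast
      ring
    rw [h1, Complex.re_sum]
    refine Finset.sum_congr rfl fun i _ => ?_
    rw [Complex.sub_re, Complex.re_mul_ofReal, Complex.ofReal_re]
    simp
    ring
  have e2 : 1 / hbar * ∑ i, |x i| ≤ Real.exp (∑ i, |x i| / hbar) := by
    rw [Finset.mul_sum]
    simp_rw [one_div_mul_eq_div]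
    linarith [Real.add_one_le_exp (∑ i, |x i| / hbar)]
  rw [Complex.norm_exp, e1]
  refine (mul_le_mul_of_nonneg_left e2 (Real.exp_pos _).le).trans ?_
  rw [← Real.exp_add, ← Real.exp_add, Real.exp_le_exp, ← Finset.sum_add_distrib]
  have e3 : (Fintype.card ι : ℝ) * ((R + 1) ^ 2 / hbar) + -(1 / (4 * hbar)) * (x ⬝ᵥ x) =
      ∑ i, ((R + 1) ^ 2 / hbar + -(1 / (4 * hbar)) * (x i * x i)) := by
    rw [Finset.sum_add_distrib, Finset.sum_const, Finset.card_univ, nsmul_eq_mul, dotProduct,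
      Finset.mul_sum]
  rw [e3]
  refine Finset.sum_le_sum fun i _ => ?_
  have h1 : (z i).im * x i ≤ R * |x i| := by
    have h2 : |(z i).im| ≤ R :=
      (Complex.abs_im_le_norm _).trans ((norm_le_pi_norm z i).trans hz)
    calc (z i).im * x i ≤ |(z i).im * x i| := le_abs_self _
      _ = |(z i).im| * |x i| := abs_mul _ _
      _ ≤ R * |x i| := mul_le_mul_of_nonneg_right h2 (abs_nonneg _)
  have h3 : x i * x i = |x i| ^ 2 := by rw [sq_abs, sq]
  rw [h3]
  have h4 : -(1 / (2 * hbar)) * |x i| ^ 2 + (z i).im / hbar * x i + |x i| / hbar =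
      (-|x i| ^ 2 / 2 + (z i).im * x i + |x i|) / hbar := by
    field_simp
  have h5 : (R + 1) ^ 2 / hbar + -(1 / (4 * hbar)) * |x i| ^ 2 =
      ((R + 1) ^ 2 - |x i| ^ 2 / 4) / hbar := by
    field_simp
    ring
  rw [h4, h5]
  refine div_le_div_of_nonneg_right ?_ hb.le
  nlinarith [sq_nonneg (|x i| / 2 - (R + 1))]

/-- `z ↦ ⟨φ_z, ψ⟩` is holomorphic. -/
theorem differentiable_inner_phiL (hb : 0 < hbar) (ψ : L2 ι) :
    Differentiable ℂ fun z : ι → ℂ => inner ℂ (phiL hb z) ψ := by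
  have hh : (hbar : ℂ) ≠ 0 := Complex.ofReal_ne_zero.mpr hb.ne'
  let k : (ι → ℂ) → (ι → ℝ) → ℂ := fun z x =>
    Complex.exp (-(1 / (2 * hbar)) * (toC x ⬝ᵥ toC x) - Complex.I / hbar * (z ⬝ᵥ toC x))
  let F : (ι → ℂ) → (ι → ℝ) → ℂ := fun z x => k z x * ψ x
  have hk : ∀ z, Continuous (k z) := by
    intro z
    have := continuous_toC (ι := ι)
    fun_prop
  have hψ : MeasureTheory.AEStronglyMeasurable ψ MeasureTheory.volume :=
    MeasureTheory.Lp.aestronglyMeasurable ψ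
  have hF : ∀ z : ι → ℂ, inner ℂ (phiL hb z) ψ =
      gaussConst ι hbar * Complex.exp (1 / (4 * hbar) * (z ⬝ᵥ z)) * ∫ x, F z x := by
    intro z
    rw [inner_phiL_left, ← MeasureTheory.integral_const_mul]
    refine MeasureTheory.integral_congr_ae (Filter.Eventually.of_forall fun x => ?_)
    simp only [F, k]
    rw [conj_phi, ← mul_assoc, mul_assoc (gaussConst ι hbar : ℂ) (Complex.exp _) (Complex.exp _),
      ← Complex.exp_add]
    congr 3
    field_simp
    ring
  have hd : Differentiable ℂ fun z => ∫ x, F z x := by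
    intro z₀
    let F' : (ι → ℂ) → (ι → ℝ) → (ι → ℂ) →L[ℂ] ℂ := fun z x =>
      F z x • (-(Complex.I / hbar)) • dotCLM x
    -- The majorant is taken for R = ‖z₀‖ + 1, valid on the unit ball around z₀.
    let bound : (ι → ℝ) → ℝ := fun x =>
      Real.exp (Fintype.card ι * ((‖z₀‖ + 1 + 1) ^ 2 / hbar)) *
        Real.exp (-(1 / (4 * hbar)) * (x ⬝ᵥ x)) * ‖ψ x‖
    have hint : MeasureTheory.Integrable (F z₀) := by
      have h1 := gauss_memLp (ι := ι) (c := 1 / (2 * hbar)) (by positivity)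
        (-(Complex.I / hbar) • z₀)
      refine (h1.integrable_mul (MeasureTheory.Lp.memLp ψ)).congr
        (Filter.Eventually.of_forall fun x => ?_)
      simp only [F, k, Pi.mul_apply]
      congr 2
      rw [smul_dotProduct, smul_eq_mul]
      push_cast
      ring
    have hbound : MeasureTheory.Integrable bound := by
      have h1 := (gauss_memLp (ι := ι) (c := 1 / (4 * hbar)) (by positivity) 0).norm
      refine ((h1.integrable_mul (MeasureTheory.Lp.memLp ψ).norm).const_mul
        (Real.exp (Fintype.card ι * ((‖z₀‖ + 1 + 1) ^ 2 / hbar)))).congr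
        (Filter.Eventually.of_forall fun x => ?_)
      simp only [bound, Pi.mul_apply]
      rw [mul_assoc, Complex.norm_exp, toC_dotProduct, zero_dotProduct, add_zero,
        ← Complex.ofReal_neg, ← Complex.ofReal_mul, Complex.ofReal_re]
    refine (hasFDerivAt_integral_of_dominated_of_fderiv_le (F := F) (F' := F') (bound := bound)
      (Metric.ball_mem_nhds z₀ one_pos)
      (Filter.Eventually.of_forall fun z => (hk z).aestronglyMeasurable.mul hψ) hint
      ?_ ?_ hbound ?_).differentiableAt
    · exact ((hk z₀).aestronglyMeasurable.mul hψ).smul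
        (continuous_dotCLM.const_smul (-(Complex.I / (hbar : ℂ)))).aestronglyMeasurable
    · refine Filter.Eventually.of_forall fun x z hz => ?_
      have hz' : ‖z‖ ≤ ‖z₀‖ + 1 := by
        rw [mem_ball_iff_norm] at hz
        linarith [norm_le_norm_add_norm_sub' z z₀]
      have h1 := gauss_bound hb hz' x
      have h2 : ‖F' z x‖ ≤ (‖k z x‖ * (1 / hbar * ∑ i, |x i|)) * ‖ψ x‖ := by
        simp only [F', F]
        rw [norm_smul, norm_smul, norm_mul, norm_neg, norm_div, Complex.norm_I, Complex.norm_real,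
          Real.norm_of_nonneg hb.le, mul_right_comm]
        refine mul_le_mul_of_nonneg_right (mul_le_mul_of_nonneg_left ?_ (norm_nonneg _))
          (norm_nonneg _)
        exact mul_le_mul_of_nonneg_left (norm_dotCLM_le x) (by positivity)
      exact h2.trans (mul_le_mul_of_nonneg_right h1 (norm_nonneg _))
    · refine Filter.Eventually.of_forall fun x z _ => ?_
      have h1 : HasFDerivAt (fun z : ι → ℂ => z ⬝ᵥ toC x) (dotCLM x) z := by
        have := (dotCLM x).hasFDerivAt (x := z)
        refine this.congr_of_eventuallyEq (Filter.Eventually.of_forall fun y => ?_)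
        exact (dotCLM_apply x y).symm
      have h2 := (((h1.const_mul (Complex.I / hbar)).const_sub
        (-(1 / (2 * hbar)) * (toC x ⬝ᵥ toC x))).cexp).mul_const (ψ x)
      refine h2.congr_fderiv ?_
      simp only [F', F, k]
      ext y
      simp
      ring
  -- The conjugate of φ_z involves z but not its conjugate, so outside the integral only the entire
  -- factor exp(z·z/4ħ) remains.
  rw [show (fun z : ι → ℂ => inner ℂ (phiL hb z) ψ) = _ from funext hF]
  refine Differentiable.mul ?_ hd
  refine Differentiable.const_mul (Differentiable.cexp (Differentiable.const_mul ?_ _)) _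
  simp only [dotProduct]
  fun_prop

variable [DecidableEq ι]

/-- The function `x ↦ |det B|^(1/2) exp(i q(x)) ψ(B x)`. -/
def phaseComp (B : Matrix ι ι ℝ) (q : (ι → ℝ) → ℝ) (ψ : (ι → ℝ) → ℂ) (x : ι → ℝ) : ℂ :=
  Real.sqrt |B.det| * Complex.exp (Complex.I * q x) * ψ (B *ᵥ x)

theorem norm_phaseComp_sq (B : Matrix ι ι ℝ) (q : (ι → ℝ) → ℝ) (ψ : (ι → ℝ) → ℂ) (x : ι → ℝ) :
    ‖phaseComp B q ψ x‖ ^ 2 = |B.det| * ‖ψ (B *ᵥ x)‖ ^ 2 := by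
  rw [phaseComp, norm_mul, norm_mul, mul_comm Complex.I, Complex.norm_exp_ofReal_mul_I, mul_one,
    Complex.norm_real, mul_pow, Real.norm_eq_abs, sq_abs, Real.sq_sqrt (abs_nonneg _)]

theorem phaseComp_congr {B : Matrix ι ι ℝ} (hB : B.det ≠ 0) (q : (ι → ℝ) → ℝ)
    {ψ χ : (ι → ℝ) → ℂ} (h : ψ =ᵐ[MeasureTheory.volume] χ) :
    phaseComp B q ψ =ᵐ[MeasureTheory.volume] phaseComp B q χ := by
  have := (Matrix.quasiMeasurePreserving_mulVec hB).ae_eq_comp h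
  filter_upwards [this] with x hx
  simp only [Function.comp] at hx
  rw [phaseComp, phaseComp, hx]

theorem phaseComp_memLp {B : Matrix ι ι ℝ} (hB : B.det ≠ 0) {q : (ι → ℝ) → ℝ} (hq : Continuous q)
    {ψ : (ι → ℝ) → ℂ} (hψ : MeasureTheory.MemLp ψ 2) :
    MeasureTheory.MemLp (phaseComp B q ψ) 2 := by
  have hm : MeasureTheory.AEStronglyMeasurable (phaseComp B q ψ) MeasureTheory.volume := by
    refine MeasureTheory.AEStronglyMeasurable.mul (Continuous.aestronglyMeasurable ?_)
      (hψ.1.comp_quasiMeasurePreserving (Matrix.quasiMeasurePreserving_mulVec hB))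
    fun_prop
  rw [MeasureTheory.memLp_two_iff_integrable_sq_norm hm]
  simp_rw [norm_phaseComp_sq]
  exact (Matrix.integrable_comp_mulVec hB
    ((MeasureTheory.memLp_two_iff_integrable_sq_norm hψ.1).mp hψ)).const_mul _

/-- The unitary operator `ψ ↦ |det B|^(1/2) exp(i q) (ψ ∘ B)` on `L²`. -/
def phaseOp {B : Matrix ι ι ℝ} (hB : B.det ≠ 0) {q : (ι → ℝ) → ℝ} (hq : Continuous q) :
    L2 ι →ₗᵢ[ℂ] L2 ι :=
  LinearMap.isometryOfInner
    { toFun := fun ψ => (phaseComp_memLp hB hq (MeasureTheory.Lp.memLp ψ)).toLp _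
      map_add' := fun ψ χ => by
        rw [← MeasureTheory.MemLp.toLp_add, MeasureTheory.MemLp.toLp_eq_toLp_iff]
        refine (phaseComp_congr hB q (MeasureTheory.Lp.coeFn_add ψ χ)).trans
          (Filter.Eventually.of_forall fun x => ?_)
        simp only [phaseComp, Pi.add_apply, mul_add]
      map_smul' := fun c ψ => by
        rw [RingHom.id_apply, ← MeasureTheory.MemLp.toLp_const_smul,
          MeasureTheory.MemLp.toLp_eq_toLp_iff]
        refine (phaseComp_congr hB q (MeasureTheory.Lp.coeFn_smul c ψ)).trans
          (Filter.Eventually.of_forall fun x => ?_)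
        simp only [phaseComp, Pi.smul_apply, smul_eq_mul]
        ring }
    (fun ψ χ => by
      change inner ℂ ((phaseComp_memLp hB hq (MeasureTheory.Lp.memLp ψ)).toLp _)
        ((phaseComp_memLp hB hq (MeasureTheory.Lp.memLp χ)).toLp _) = _
      rw [MeasureTheory.L2.inner_def, MeasureTheory.L2.inner_def]
      have h1 : (fun x => inner ℂ
          ((phaseComp_memLp hB hq (MeasureTheory.Lp.memLp ψ)).toLp _ x)
          ((phaseComp_memLp hB hq (MeasureTheory.Lp.memLp χ)).toLp _ x)) =ᵐ[MeasureTheory.volume]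
          fun x => ((|B.det| : ℝ) : ℂ) * inner ℂ (ψ (B *ᵥ x)) (χ (B *ᵥ x)) := by
        filter_upwards [(phaseComp_memLp hB hq (MeasureTheory.Lp.memLp ψ)).coeFn_toLp,
          (phaseComp_memLp hB hq (MeasureTheory.Lp.memLp χ)).coeFn_toLp] with x h2 h3
        rw [h2, h3, phaseComp, phaseComp]
        simp only [RCLike.inner_apply, map_mul, Complex.conj_ofReal, ← Complex.exp_conj,
          Complex.conj_I]
        have h4 : Complex.exp (Complex.I * q x) * Complex.exp (-Complex.I * q x) = 1 := by
          rw [← Complex.exp_add]; simp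
        have h5 : ((Real.sqrt |B.det| : ℝ) : ℂ) * (Real.sqrt |B.det| : ℝ) = (|B.det| : ℝ) := by
          rw [← Complex.ofReal_mul, Real.mul_self_sqrt (abs_nonneg _)]
        rw [← h5]
        linear_combination (((Real.sqrt |B.det| : ℝ) : ℂ) * (Real.sqrt |B.det| : ℝ) *
          χ (B *ᵥ x) * starRingEnd ℂ (ψ (B *ᵥ x))) * h4
      rw [MeasureTheory.integral_congr_ae h1, MeasureTheory.integral_const_mul,
        Matrix.integral_comp_mulVec hB (fun x => inner ℂ (ψ x) (χ x)), ← mul_assoc,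
        ← Complex.ofReal_mul, mul_inv_cancel₀ (abs_ne_zero.mpr hB), Complex.ofReal_one, one_mul])

theorem coeFn_phaseOp {B : Matrix ι ι ℝ} (hB : B.det ≠ 0) {q : (ι → ℝ) → ℝ} (hq : Continuous q)
    (ψ : L2 ι) : phaseOp hB hq ψ =ᵐ[MeasureTheory.volume] phaseComp B q ψ :=
  (phaseComp_memLp hB hq (MeasureTheory.Lp.memLp ψ)).coeFn_toLp

/-- The square roots of Jacobians are positive, hence exactly multiplicative; no sign enters the
composition law. -/
theorem phaseOp_phaseOp {B B' B'' : Matrix ι ι ℝ} (hB : B.det ≠ 0) (hB' : B'.det ≠ 0)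
    (hB'' : B''.det ≠ 0) {q q' q'' : (ι → ℝ) → ℝ} (hq : Continuous q) (hq' : Continuous q')
    (hq'' : Continuous q'') (h1 : B'' = B' * B) (h2 : ∀ x, q'' x = q x + q' (B *ᵥ x)) (ψ : L2 ι) :
    phaseOp hB hq (phaseOp hB' hq' ψ) = phaseOp hB'' hq'' ψ := by
  refine MeasureTheory.Lp.ext ?_
  filter_upwards [coeFn_phaseOp hB hq (phaseOp hB' hq' ψ), coeFn_phaseOp hB'' hq'' ψ,
    phaseComp_congr hB q (coeFn_phaseOp hB' hq' ψ)] with x e1 e2 e3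
  rw [e1, e2, e3, phaseComp, phaseComp, phaseComp, h2, h1, Matrix.det_mul, abs_mul,
    Real.sqrt_mul (abs_nonneg _), Matrix.mulVec_mulVec]
  push_cast
  rw [mul_add, Complex.exp_add]
  ring

theorem phaseOp_one {q : (ι → ℝ) → ℝ} {B : Matrix ι ι ℝ} (hB : B.det ≠ 0) (hq : Continuous q)
    (h1 : B = 1) (h2 : ∀ x, q x = 0) (ψ : L2 ι) : phaseOp hB hq ψ = ψ := by
  refine MeasureTheory.Lp.ext ?_
  filter_upwards [coeFn_phaseOp hB hq ψ] with x e1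
  rw [e1, phaseComp, h1, h2]
  simp

end Bargmann

/-! ### Coherent states as a reproducing kernel -/

namespace PCCS

variable {V : Type*} [AddCommGroup V] [Module ℝ V] {Ω : SymplecticForm V} (j : PCCS Ω)
  [FiniteDimensional ℝ V] {hbar : ℝ} [hb : Fact (0 < hbar)]

theorem fock_inner (f g : j.Fock hbar) :
    inner ℂ f g = (((2 * Real.pi * hbar) ^ Module.finrank ℂ j.Space)⁻¹ : ℝ) *
      ∫ z : j.Space,
        starRingEnd ℂ (f (j.toSpace.symm z)) * g (j.toSpace.symm z) * (j.weight hbar z : ℂ) := rfl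

theorem fock_norm_sq (f : j.Fock hbar) :
    ‖f‖ ^ 2 = ((2 * Real.pi * hbar) ^ Module.finrank ℂ j.Space)⁻¹ *
      ∫ z : j.Space, ‖f (j.toSpace.symm z)‖ ^ 2 * j.weight hbar z := by
  have h : inner ℂ f f = ((((2 * Real.pi * hbar) ^ Module.finrank ℂ j.Space)⁻¹ *
      ∫ z : j.Space, ‖f (j.toSpace.symm z)‖ ^ 2 * j.weight hbar z : ℝ) : ℂ) := by
    rw [fock_inner, Complex.ofReal_mul, ← integral_complex_ofReal]
    congr 2
    ext z
    rw [Complex.conj_mul']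
    push_cast
    rfl
  rw [← inner_self_eq_norm_sq (𝕜 := ℂ), h]
  exact Complex.ofReal_re _

theorem planck_pos : 0 < (2 * Real.pi * hbar) ^ Module.finrank ℂ j.Space := by
  have := hb.out
  have := Real.pi_pos
  positivity

theorem integral_weight :
    ∫ z : j.Space, j.weight hbar z = (2 * Real.pi * hbar) ^ Module.finrank ℂ j.Space := by
  have hb' := hb.out
  have h := GaussianFourier.integral_rexp_neg_mul_sq_norm (V := j.Space)
    (b := 1 / (2 * hbar)) (by positivity)
  have h2 : Module.finrank ℝ j.Space = 2 * Module.finrank ℂ j.Space :=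
    finrank_real_of_complex j.Space
  have h3 : Real.pi / (1 / (2 * hbar)) = 2 * Real.pi * hbar := by field_simp
  rw [h2, h3] at h
  have h4 : (((2 * Module.finrank ℂ j.Space : ℕ) : ℝ) / 2) = (Module.finrank ℂ j.Space : ℝ) := by
    push_cast; ring
  rw [h4, Real.rpow_natCast] at h
  rw [← h]
  congr 1
  ext z
  rw [weight]
  congr 1
  ring

/-- The scalar multiplication by `exp(iθ)`, as an isometry of `(V, j)`. -/
def rotation (θ : ℝ) : j.Space ≃ₗᵢ[ℝ] j.Space where
  toFun z := Complex.exp (θ * Complex.I) • z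
  invFun z := Complex.exp (-(θ * Complex.I)) • z
  map_add' := smul_add _
  map_smul' r z := smul_comm _ _ _
  left_inv z := by
    change Complex.exp (-(θ * Complex.I)) • Complex.exp (θ * Complex.I) • z = z
    rw [smul_smul, ← Complex.exp_add, neg_add_cancel, Complex.exp_zero, one_smul]
  right_inv z := by
    change Complex.exp (θ * Complex.I) • Complex.exp (-(θ * Complex.I)) • z = z
    rw [smul_smul, ← Complex.exp_add, add_neg_cancel, Complex.exp_zero, one_smul]
  norm_map' z := by
    change ‖Complex.exp (θ * Complex.I) • z‖ = ‖z‖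
    rw [norm_smul, Complex.norm_exp_ofReal_mul_I, one_mul]

theorem rotation_apply (θ : ℝ) (z : j.Space) :
    j.rotation θ z = Complex.exp (θ * Complex.I) • z := rfl

theorem weight_rotation (θ : ℝ) (z : j.Space) :
    j.weight hbar (j.rotation θ z) = j.weight hbar z := by
  rw [weight, weight, LinearIsometryEquiv.norm_map]

/-- The mean value property of a holomorphic function for circles centred at the origin. -/
theorem integral_rotation {f : j.Space → ℂ} (hf : Differentiable ℂ f) (z : j.Space) :
    ∫ θ in (0)..(2 * Real.pi), f (j.rotation θ z) = (2 * Real.pi : ℝ) • f 0 := by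
  have hd : Differentiable ℂ fun c : ℂ => f (c • z) :=
    hf.comp (differentiable_id.smul_const z)
  have h := DiffContOnCl.circleAverage (f := fun c : ℂ => f (c • z)) (c := 0) (R := 1)
    hd.diffContOnCl
  rw [Real.circleAverage_def] at h
  have h2 : ∀ θ : ℝ, f (circleMap 0 1 θ • z) = f (j.rotation θ z) := by
    intro θ
    rw [rotation_apply, circleMap]
    simp
  simp only [h2, zero_smul] at h
  rw [← h, smul_inv_smul₀ (by have := Real.pi_pos; positivity)]

/-- The weight and the measure are invariant under z ↦ exp(iθ)z. Averaging f over these circles,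
with Fubini, replaces it by f(0) by the mean value property, and the integral of the weight remains.
-/
theorem integral_fock_weight (f : j.Fock hbar) :
    ∫ z : j.Space, f (j.toSpace.symm z) * (j.weight hbar z : ℂ) =
      ((2 * Real.pi * hbar) ^ Module.finrank ℂ j.Space : ℝ) * f 0 := by
  have hb' := hb.out
  let F : j.Space → ℂ := fun z => f (j.toSpace.symm z)
  have hF : Differentiable ℂ F := j.fock_differentiable f
  have hw := j.continuous_weight hbar
  -- Since e_0 = 1, this is the integrability of a product of two Fock functions.
  have hint : MeasureTheory.Integrable fun z : j.Space => F z * (j.weight hbar z : ℂ) := by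
    have := j.fock_integrable_mul (j.coherent hbar 0) f
    refine this.congr (Filter.Eventually.of_forall fun z => ?_)
    simp only [coherent_apply, F]
    simp [herm]
  have hrot : ∀ θ : ℝ, ∫ z : j.Space, F (j.rotation θ z) * (j.weight hbar z : ℂ) =
      ∫ z : j.Space, F z * (j.weight hbar z : ℂ) := by
    intro θ
    have h := (j.rotation θ).measurePreserving.integral_comp
      (j.rotation θ).toHomeomorph.measurableEmbedding (fun z : j.Space => F z * (j.weight hbar z : ℂ))
    rw [← h]
    simp_rw [j.weight_rotation]
  have hrotn : ∀ θ : ℝ, ∫ z : j.Space, ‖F (j.rotation θ z) * (j.weight hbar z : ℂ)‖ =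
      ∫ z : j.Space, ‖F z * (j.weight hbar z : ℂ)‖ := by
    intro θ
    have h := (j.rotation θ).measurePreserving.integral_comp
      (j.rotation θ).toHomeomorph.measurableEmbedding (fun z : j.Space => ‖F z * (j.weight hbar z : ℂ)‖)
    rw [← h]
    simp_rw [j.weight_rotation]
  have hcont : Continuous fun p : ℝ × j.Space =>
      F (j.rotation p.1 p.2) * (j.weight hbar p.2 : ℂ) := by
    have h1 : Continuous fun p : ℝ × j.Space => j.rotation p.1 p.2 := by
      simp_rw [rotation_apply]
      fun_prop
    exact (hF.continuous.comp h1).mul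
      (Complex.continuous_ofReal.comp (hw.comp continuous_snd))
  have hprod : MeasureTheory.Integrable
      (Function.uncurry fun (θ : ℝ) (z : j.Space) =>
        F (j.rotation θ z) * (j.weight hbar z : ℂ))
      ((MeasureTheory.volume.restrict (Ioc 0 (2 * Real.pi))).prod MeasureTheory.volume) := by
    have hcont' : Continuous (Function.uncurry fun (θ : ℝ) (z : j.Space) =>
        F (j.rotation θ z) * (j.weight hbar z : ℂ)) := hcont
    rw [MeasureTheory.integrable_prod_iff hcont'.aestronglyMeasurable]
    refine ⟨Filter.Eventually.of_forall fun θ => ?_, ?_⟩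
    · have := ((j.rotation θ).measurePreserving.integrable_comp_emb
        (j.rotation θ).toHomeomorph.measurableEmbedding).mpr hint
      refine this.congr (Filter.Eventually.of_forall fun z => ?_)
      simp only [Function.comp, Function.uncurry, j.weight_rotation]
    · simp only [Function.uncurry, hrotn]
      exact MeasureTheory.integrable_const _
  have hswap := MeasureTheory.integral_integral_swap hprod
  have hpi : (0 : ℝ) ≤ 2 * Real.pi := by have := Real.pi_pos; positivity
  have hinner : ∀ z : j.Space, ∫ θ in Ioc 0 (2 * Real.pi),
      F (j.rotation θ z) * (j.weight hbar z : ℂ) =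
      (2 * Real.pi : ℝ) * F 0 * (j.weight hbar z : ℂ) := by
    intro z
    rw [MeasureTheory.integral_mul_const, ← intervalIntegral.integral_of_le hpi,
      j.integral_rotation hF z, Complex.real_smul]
  simp only [hrot, hinner] at hswap
  rw [MeasureTheory.integral_const, MeasureTheory.integral_const_mul, integral_complex_ofReal,
    j.integral_weight, MeasureTheory.measureReal_restrict_apply_univ, Real.volume_real_Ioc_of_le hpi,
    sub_zero, Complex.real_smul, mul_assoc] at hswap
  have h2pi : ((2 * Real.pi : ℝ) : ℂ) ≠ 0 :=
    Complex.ofReal_ne_zero.mpr (by have := Real.pi_pos; positivity)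
  have := mul_left_cancel₀ h2pi hswap
  rw [this, mul_comm]
  simp [F]

theorem inner_coherent_zero (f : j.Fock hbar) : inner ℂ (j.coherent hbar 0) f = f 0 := by
  have h : (fun z : j.Space => starRingEnd ℂ (j.coherent hbar 0 (j.toSpace.symm z)) *
      f (j.toSpace.symm z) * (j.weight hbar z : ℂ)) =
      fun z : j.Space => f (j.toSpace.symm z) * (j.weight hbar z : ℂ) := by
    ext z
    rw [coherent_apply]
    simp [herm]
  rw [fock_inner, h, integral_fock_weight, ← mul_assoc, ← Complex.ofReal_mul,
    inv_mul_cancel₀ j.planck_pos.ne', Complex.ofReal_one, one_mul]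

/-- The squared modulus of the multiplier converts the weight at z into the weight at z - v;
translation invariance of the measure does the rest. -/
theorem heis_inner (v : V) (t : ℝ) (f g : j.Fock hbar) :
    inner ℂ (j.heis hbar v t f) (j.heis hbar v t g) = inner ℂ f g := by
  rw [fock_inner, fock_inner]
  congr 1
  rw [← MeasureTheory.integral_sub_right_eq_self (fun z : j.Space =>
    starRingEnd ℂ (f (j.toSpace.symm z)) * g (j.toSpace.symm z) * (j.weight hbar z : ℂ))
    (j.toSpace v)]
  congr 1
  ext z
  rw [heis_apply, heis_apply, ← j.heisFactor_weight hbar v t z, map_sub,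
    LinearEquiv.symm_apply_apply, map_mul]
  push_cast
  rw [← Complex.conj_mul']
  ring

theorem norm_heis (v : V) (t : ℝ) (f : j.Fock hbar) : ‖j.heis hbar v t f‖ = ‖f‖ := by
  rw [@norm_eq_sqrt_re_inner ℂ, @norm_eq_sqrt_re_inner ℂ, heis_inner]

theorem herm_add_left (u v w : V) : j.herm (u + v) w = j.herm u w + j.herm v w := by
  simp only [herm, map_add, LinearMap.add_apply]
  push_cast
  ring

theorem herm_add_right (u v w : V) : j.herm u (v + w) = j.herm u v + j.herm u w := by
  simp only [herm, map_add]
  push_cast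
  ring

theorem herm_neg_left (u v : V) : j.herm (-u) v = -j.herm u v := by
  simp only [herm, map_neg, LinearMap.neg_apply]
  push_cast
  ring

theorem herm_self (v : V) : j.herm v v = (j.G v v : ℂ) := by
  simp [herm, Ω.alt v]

/-- The Heisenberg group permutes the coherent states up to scalars. -/
theorem heis_coherent (v w : V) (t : ℝ) :
    j.heis hbar v t (j.coherent hbar w) =
      Complex.exp (-Complex.I * t / hbar - j.herm v w / (2 * hbar) - j.G v v / (4 * hbar)) •
        j.coherent hbar (v + w) := by
  have hh : (hbar : ℂ) ≠ 0 := Complex.ofReal_ne_zero.mpr hb.out.ne'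
  apply j.fock_ext
  intro z
  rw [heis_apply, map_smul, Pi.smul_apply, smul_eq_mul, coherent_apply, coherent_apply, heisFactor,
    ← Complex.exp_add, ← Complex.exp_add, sub_eq_add_neg z v, herm_add_left, herm_neg_left,
    herm_add_right]
  congr 1
  field_simp
  ring

/-- The coherent states are a reproducing kernel. -/
theorem inner_coherent (v : V) (f : j.Fock hbar) : inner ℂ (j.coherent hbar v) f = f v := by
  -- The Heisenberg operator of -v moves e_v to a multiple of e_0 = 1 and f(v) to the origin, which
  -- reduces the claim to evaluation at 0.
  have h := j.inner_coherent_zero (j.heis hbar (-v) 0 f)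
  have h2 := j.heis_coherent (hbar := hbar) (-v) v 0
  rw [neg_add_cancel] at h2
  have h3 : j.coherent hbar 0 = Complex.exp (-(j.G v v / (4 * hbar))) •
      j.heis hbar (-v) 0 (j.coherent hbar v) := by
    rw [h2, smul_smul, ← Complex.exp_add]
    have : (-((j.G v v : ℂ) / (4 * hbar)) + (-Complex.I * (0 : ℝ) / hbar -
        j.herm (-v) v / (2 * hbar) - (j.G (-v) (-v) : ℂ) / (4 * hbar))) = 0 := by
      rw [herm_neg_left, herm_self]
      simp only [map_neg, LinearMap.neg_apply, neg_neg]
      push_cast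
      ring
    rw [this, Complex.exp_zero, one_smul]
  rw [h3, inner_smul_left, heis_inner, heis_apply, heisFactor] at h
  have h4 : starRingEnd ℂ (Complex.exp (-((j.G v v : ℂ) / (4 * hbar)))) =
      Complex.exp (-Complex.I * (0 : ℝ) / hbar + j.herm 0 (-v) / (2 * hbar) -
        (j.G (-v) (-v) : ℂ) / (4 * hbar)) := by
    rw [← Complex.exp_conj]
    congr 1
    simp [herm, map_ofNat]
  rw [h4] at h
  simpa using mul_left_cancel₀ (Complex.exp_ne_zero _) h

theorem inner_coherent_coherent (v w : V) :
    inner ℂ (j.coherent hbar v) (j.coherent hbar w) =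
      Complex.exp (j.herm v w / (2 * hbar)) := by
  rw [inner_coherent, coherent_apply]

end PCCS

/-! ### The Bargmann transform -/

namespace PCCS

variable {V : Type*} [AddCommGroup V] [Module ℝ V] {Ω : SymplecticForm V} {j : PCCS Ω}

/-- Unitary complex coordinates on `(V, j)`, real exactly on the subspace `F`. -/
structure Coord (j : PCCS Ω) (F : Submodule ℝ V) (ι : Type*) [Fintype ι] where
  κ : V ≃ₗ[ℝ] (ι → ℂ)
  map_J : ∀ v, κ (j.J v) = Complex.I • κ v
  herm_eq : ∀ z w, j.herm z w = κ z ⬝ᵥ star (κ w)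
  mem_iff : ∀ v, v ∈ F ↔ ∃ x : ι → ℝ, κ v = Bargmann.toC x

namespace Coord

variable {F : Submodule ℝ V} {ι : Type*} [Fintype ι] (K : j.Coord F ι)

/-- The coordinates as a complex linear equivalence. -/
def complexEquiv : j.Space ≃ₗ[ℂ] (ι → ℂ) :=
  { K.κ with
    toFun := fun z => K.κ (j.toSpace.symm z)
    invFun := fun z => j.toSpace (K.κ.symm z)
    left_inv := fun z => by simp
    right_inv := fun z => by simp
    map_add' := fun z w => by simp
    map_smul' := fun c z => by
      rw [smul_def, LinearEquiv.symm_apply_apply, map_add, map_smul, map_smul, K.map_J]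
      ext i
      simp only [Pi.add_apply, Pi.smul_apply, Complex.real_smul, smul_eq_mul, RingHom.id_apply]
      conv_rhs => rw [← Complex.re_add_im c]
      ring }

theorem complexEquiv_apply (z : j.Space) : K.complexEquiv z = K.κ (j.toSpace.symm z) := rfl

variable [FiniteDimensional ℝ V] {hbar : ℝ} [hb : Fact (0 < hbar)]

theorem differentiable_complexEquiv : Differentiable ℂ K.complexEquiv := by
  have : FiniteDimensional ℂ j.Space := K.complexEquiv.symm.finiteDimensional
  exact (LinearMap.toContinuousLinearMap K.complexEquiv.toLinearMap).differentiable

open Bargmann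

/-- The function on `V` that corresponds to `ψ ∈ L²`. -/
def bargmannFun (ψ : L2 ι) (z : V) : ℂ := inner ℂ (phiL hb.out (K.κ z)) ψ

theorem bargmannFun_differentiable (ψ : L2 ι) :
    Differentiable ℂ fun z : j.Space => K.bargmannFun (hbar := hbar) ψ (j.toSpace.symm z) :=
  (differentiable_inner_phiL hb.out ψ).comp K.differentiable_complexEquiv

/-- The Gaussians and the coherent states have the same Gram matrix, so φ_v ↦ e_v is isometric on
finite combinations. -/
theorem inner_phiL_eq (z w : V) :
    inner ℂ (phiL hb.out (K.κ z)) (phiL hb.out (K.κ w)) =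
      inner ℂ (j.coherent hbar z) (j.coherent hbar w) := by
  rw [inner_phiL_phiL, inner_coherent_coherent, K.herm_eq]

/-- A finite linear combination of Gaussians. -/
def gaussComb (u : V →₀ ℂ) : L2 ι := u.sum fun v c => c • phiL hb.out (K.κ v)

/-- A finite linear combination of coherent states. -/
def cohComb (_ : j.Coord F ι) (u : V →₀ ℂ) : j.Fock hbar := u.sum fun v c => c • j.coherent hbar v

theorem inner_gaussComb (u : V →₀ ℂ) :
    inner ℂ (K.gaussComb (hbar := hbar) u) (K.gaussComb (hbar := hbar) u) =
      inner ℂ (K.cohComb (hbar := hbar) u) (K.cohComb (hbar := hbar) u) := by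
  simp only [gaussComb, cohComb, Finsupp.sum_inner, Finsupp.inner_sum, inner_smul_left,
    inner_smul_right, K.inner_phiL_eq]

theorem norm_gaussComb (u : V →₀ ℂ) :
    ‖K.gaussComb (hbar := hbar) u‖ = ‖K.cohComb (hbar := hbar) u‖ := by
  rw [@norm_eq_sqrt_re_inner ℂ, @norm_eq_sqrt_re_inner ℂ, inner_gaussComb]

theorem bargmannFun_gaussComb (u : V →₀ ℂ) (z : V) :
    K.bargmannFun (hbar := hbar) (K.gaussComb (hbar := hbar) u) z =
      K.cohComb (hbar := hbar) u z := by
  rw [← inner_coherent]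
  simp only [bargmannFun, gaussComb, cohComb, Finsupp.inner_sum, inner_smul_right, K.inner_phiL_eq]

theorem denseRange_gaussComb : DenseRange (K.gaussComb (hbar := hbar)) := by
  have hspan : (range (K.gaussComb (hbar := hbar)) : Set (L2 ι)) =
      (Submodule.span ℂ (range fun v : V => phiL hb.out (K.κ v)) : Set (L2 ι)) := by
    ext ψ
    rw [SetLike.mem_coe, Finsupp.mem_span_range_iff_exists_finsupp]
    rfl
  rw [DenseRange, hspan, Submodule.dense_iff_topologicalClosure_eq_top,
    Submodule.topologicalClosure_eq_top_iff, Submodule.eq_bot_iff]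
  intro ψ hψ
  refine eq_zero_of_inner_phiL hb.out ψ fun v => ?_
  have := (Submodule.mem_orthogonal _ ψ).mp hψ (phiL hb.out (K.κ (K.κ.symm v)))
    (Submodule.subset_span ⟨_, rfl⟩)
  rwa [LinearEquiv.apply_symm_apply] at this

theorem lintegral_fock (f : j.Fock hbar) :
    ∫⁻ z : j.Space, ENNReal.ofReal (‖f (j.toSpace.symm z)‖ ^ 2 * j.weight hbar z) =
      ENNReal.ofReal ((2 * Real.pi * hbar) ^ Module.finrank ℂ j.Space * ‖f‖ ^ 2) := by
  rw [← MeasureTheory.ofReal_integral_eq_lintegral_ofReal (j.fock_integrable f)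
    (Filter.Eventually.of_forall fun z => mul_nonneg (sq_nonneg _) (j.weight_pos hbar z).le),
    fock_norm_sq, ← mul_assoc, mul_inv_cancel₀ j.planck_pos.ne', one_mul]

/-- Finite combinations of Gaussians approximate ψ in norm, and evaluation at each z is continuous
in ψ. Fatou's lemma then carries the norm identity on combinations to an upper bound, without appeal
to completeness of the Fock space. -/
theorem lintegral_bargmannFun_le (ψ : L2 ι) :
    ∫⁻ z : j.Space, ENNReal.ofReal
      (‖K.bargmannFun (hbar := hbar) ψ (j.toSpace.symm z)‖ ^ 2 * j.weight hbar z) ≤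
      ENNReal.ofReal ((2 * Real.pi * hbar) ^ Module.finrank ℂ j.Space * ‖ψ‖ ^ 2) := by
  obtain ⟨s, hs, hlim⟩ := mem_closure_iff_seq_limit.mp
    (K.denseRange_gaussComb (hbar := hbar) ψ)
  choose u hu using hs
  have hcont : ∀ z : V, Continuous fun χ : L2 ι => K.bargmannFun (hbar := hbar) χ z := fun z =>
    (innerSL ℂ (phiL hb.out (K.κ z))).continuous
  have hpt : ∀ z : j.Space, Filter.Tendsto (fun k => ENNReal.ofReal
      (‖K.bargmannFun (hbar := hbar) (s k) (j.toSpace.symm z)‖ ^ 2 * j.weight hbar z))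
      Filter.atTop (nhds (ENNReal.ofReal
        (‖K.bargmannFun (hbar := hbar) ψ (j.toSpace.symm z)‖ ^ 2 * j.weight hbar z))) := by
    intro z
    refine ENNReal.tendsto_ofReal ((Filter.Tendsto.pow ?_ 2).mul_const _)
    exact (((hcont _).tendsto ψ).comp hlim).norm
  have hval : ∀ k, ∫⁻ z : j.Space, ENNReal.ofReal
      (‖K.bargmannFun (hbar := hbar) (s k) (j.toSpace.symm z)‖ ^ 2 * j.weight hbar z) =
      ENNReal.ofReal ((2 * Real.pi * hbar) ^ Module.finrank ℂ j.Space * ‖s k‖ ^ 2) := by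
    intro k
    rw [← hu k]
    simp_rw [bargmannFun_gaussComb]
    rw [lintegral_fock, norm_gaussComb]
  have hlim2 : Filter.Tendsto (fun k => ENNReal.ofReal
      ((2 * Real.pi * hbar) ^ Module.finrank ℂ j.Space * ‖s k‖ ^ 2)) Filter.atTop
      (nhds (ENNReal.ofReal ((2 * Real.pi * hbar) ^ Module.finrank ℂ j.Space * ‖ψ‖ ^ 2))) :=
    ENNReal.tendsto_ofReal ((hlim.norm.pow 2).const_mul _)
  have hF := MeasureTheory.lintegral_liminf_le (u := Filter.atTop) (μ := (MeasureTheory.volume :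
    MeasureTheory.Measure j.Space)) (f := fun k z => ENNReal.ofReal
      (‖K.bargmannFun (hbar := hbar) (s k) (j.toSpace.symm z)‖ ^ 2 * j.weight hbar z))
    (fun k => by
      refine ENNReal.measurable_ofReal.comp (Continuous.measurable ?_)
      exact ((K.bargmannFun_differentiable (s k)).continuous.norm.pow 2).mul
        (j.continuous_weight hbar))
  have hlf := fun z => (hpt z).liminf_eq
  simp only [hlf, hval, hlim2.liminf_eq] at hF
  exact hF

/-- The Bargmann transform `L² → H(V, Ω, j)`. -/
def bargmannLM : L2 ι →ₗ[ℂ] j.Fock hbar where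
  toFun ψ := ⟨K.bargmannFun (hbar := hbar) ψ, K.bargmannFun_differentiable ψ, by
    refine ⟨Continuous.aestronglyMeasurable ?_, ?_⟩
    · exact ((K.bargmannFun_differentiable ψ).continuous.norm.pow 2).mul
        (j.continuous_weight hbar)
    · rw [MeasureTheory.hasFiniteIntegral_iff_ofReal (Filter.Eventually.of_forall fun z =>
        mul_nonneg (sq_nonneg _) (j.weight_pos hbar z).le)]
      exact (K.lintegral_bargmannFun_le ψ).trans_lt ENNReal.ofReal_lt_top⟩
  map_add' ψ χ := j.fock_ext fun z => inner_add_right (phiL hb.out (K.κ z)) ψ χ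
  map_smul' c ψ := j.fock_ext fun z => inner_smul_right (phiL hb.out (K.κ z)) ψ c

theorem bargmannLM_apply (ψ : L2 ι) (z : V) :
    K.bargmannLM (hbar := hbar) ψ z = inner ℂ (phiL hb.out (K.κ z)) ψ := rfl

theorem bargmannLM_gaussComb (u : V →₀ ℂ) :
    K.bargmannLM (hbar := hbar) (K.gaussComb (hbar := hbar) u) = K.cohComb u :=
  j.fock_ext (K.bargmannFun_gaussComb u)

theorem norm_bargmannLM_le (ψ : L2 ι) : ‖K.bargmannLM (hbar := hbar) ψ‖ ≤ ‖ψ‖ := by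
  have h := K.lintegral_bargmannFun_le (hbar := hbar) ψ
  have h2 := lintegral_fock (j := j) (K.bargmannLM (hbar := hbar) ψ)
  have h3 := h2.symm.trans_le h
  rw [ENNReal.ofReal_le_ofReal_iff (mul_nonneg j.planck_pos.le (sq_nonneg _))] at h3
  exact (sq_le_sq₀ (norm_nonneg _) (norm_nonneg _)).mp (le_of_mul_le_mul_left h3 j.planck_pos)

/-- The bound makes the transform continuous, so the equality known for combinations of Gaussians
extends from this dense set. -/
theorem norm_bargmannLM (ψ : L2 ι) : ‖K.bargmannLM (hbar := hbar) ψ‖ = ‖ψ‖ := by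
  have hc : Continuous (K.bargmannLM (hbar := hbar)) :=
    AddMonoidHomClass.continuous_of_bound (K.bargmannLM (hbar := hbar)) 1 fun ψ => by
      rw [one_mul]; exact K.norm_bargmannLM_le ψ
  have := (K.denseRange_gaussComb (hbar := hbar)).equalizer hc.norm continuous_norm (by
    ext u
    simp only [Function.comp]
    rw [bargmannLM_gaussComb, norm_gaussComb])
  exact congrFun this ψ

theorem bargmannLM_phiL (v : V) :
    K.bargmannLM (hbar := hbar) (phiL hb.out (K.κ v)) = j.coherent hbar v := by
  apply j.fock_ext
  intro z
  rw [bargmannLM_apply, K.inner_phiL_eq, inner_coherent]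

/-- The isometric image of the complete space L² is complete, so it is everything once its
orthogonal complement is zero. It contains every e_z, and a function orthogonal to e_z vanishes at
z. -/
theorem bargmannLM_surjective : Function.Surjective (K.bargmannLM (hbar := hbar)) := by
  let B : L2 ι →ₗᵢ[ℂ] j.Fock hbar := ⟨K.bargmannLM, K.norm_bargmannLM⟩
  have hcomplete : IsComplete (LinearMap.range B.toLinearMap : Set (j.Fock hbar)) := by
    have := B.isometry.isUniformInducing.isComplete_range
    exact this
  have : CompleteSpace (LinearMap.range B.toLinearMap) := hcomplete.completeSpace_coe
  rw [← LinearMap.range_eq_top]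
  change LinearMap.range B.toLinearMap = ⊤
  rw [← Submodule.orthogonal_eq_bot_iff, Submodule.eq_bot_iff]
  intro f hf
  apply j.fock_ext
  intro z
  have := (Submodule.mem_orthogonal _ f).mp hf (j.coherent hbar z)
    ⟨phiL hb.out (K.κ z), K.bargmannLM_phiL z⟩
  rw [← inner_coherent, this]
  simp

variable (hbar) in
/-- The Bargmann transform, as a unitary equivalence. -/
def bargmann : L2 ι ≃ₗᵢ[ℂ] j.Fock hbar :=
  LinearIsometryEquiv.ofSurjective ⟨K.bargmannLM, K.norm_bargmannLM⟩ K.bargmannLM_surjective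

theorem bargmann_apply (ψ : L2 ι) (z : V) :
    K.bargmann hbar ψ z = inner ℂ (phiL hb.out (K.κ z)) ψ := rfl

theorem bargmann_phiL (v : V) : K.bargmann hbar (phiL hb.out (K.κ v)) = j.coherent hbar v :=
  K.bargmannLM_phiL v

theorem bargmann_symm_coherent (v : V) :
    (K.bargmann hbar).symm (j.coherent hbar v) = phiL hb.out (K.κ v) := by
  rw [← K.bargmann_phiL, LinearIsometryEquiv.symm_apply_apply]

include K in
/-- Continuous linear maps that agree on the coherent states are equal. -/
theorem eq_of_eqOn_coherent {E : Type*} [NormedAddCommGroup E] [NormedSpace ℂ E]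
    {S T : j.Fock hbar →L[ℂ] E} (h : ∀ v, S (j.coherent hbar v) = T (j.coherent hbar v)) :
    S = T := by
  have hd : DenseRange (K.cohComb (hbar := hbar)) := by
    have hc : K.cohComb (hbar := hbar) = K.bargmann hbar ∘ K.gaussComb (hbar := hbar) :=
      funext fun u => (K.bargmannLM_gaussComb u).symm
    rw [hc]
    exact (K.bargmann hbar).surjective.denseRange.comp (K.denseRange_gaussComb (hbar := hbar))
      (K.bargmann hbar).continuous
  refine ContinuousLinearMap.ext fun f => congrFun (hd.equalizer S.continuous T.continuous ?_) f
  ext u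
  simp only [Function.comp, cohComb, map_finsuppSum, map_smul, h]

end Coord

end PCCS

/-! ### Coordinates adapted to the Lagrangian subspace -/

namespace PCCS

variable {V : Type*} [AddCommGroup V] [Module ℝ V] {Ω : SymplecticForm V} {j : PCCS Ω}
  {F : Submodule ℝ V} [FiniteDimensional ℝ V]

open Bargmann

theorem toSpace_J (v : V) : j.toSpace (j.J v) = Complex.I • j.toSpace v := by
  rw [smul_def]
  simp

variable (j) in
/-- A Lagrangian subspace is the real part of `(V, j)` in suitable unitary coordinates. -/
theorem exists_coord (hF : Ω.IsLagrangian F) : ∃ n : ℕ, Nonempty (j.Coord F (Fin n)) := by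
  let FS : Submodule ℝ j.Space := F.map (j.toSpace : V →ₗ[ℝ] j.Space)
  let b := stdOrthonormalBasis ℝ FS
  let c : Fin (Module.finrank ℝ FS) → j.Space := fun i => (b i : j.Space)
  have hcF : ∀ i, j.toSpace.symm (c i) ∈ F := by
    intro i
    obtain ⟨w, hw, hw2⟩ := (b i).2
    have : c i = j.toSpace w := hw2.symm
    rw [this, LinearEquiv.symm_apply_apply]
    exact hw
  -- On F the form Ω vanishes, so the Hermitian product is real there. Hence a G_j-orthonormal basis
  -- of F is orthonormal over ℂ, and it spans because V = F ⊕ jF.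
  have hreal : ∀ v w : V, v ∈ F → w ∈ F →
      inner ℂ (j.toSpace v) (j.toSpace w) = (j.G w v : ℂ) := by
    intro v w hv hw
    rw [inner_def, herm, (hF w).mp hw v hv]
    simp
  have hon : Orthonormal ℂ c := by
    rw [orthonormal_iff_ite]
    intro i k
    have h1 := hreal _ _ (hcF i) (hcF k)
    rw [LinearEquiv.apply_symm_apply, LinearEquiv.apply_symm_apply] at h1
    have h2 := orthonormal_iff_ite.mp b.orthonormal i k
    have h3 : inner ℝ (b i) (b k) = (inner ℂ (c i) (c k) : ℂ).re := rfl
    rw [h3, h1, Complex.ofReal_re] at h2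
    rw [h1, h2]
    split_ifs <;> simp
  have hsF : ∀ v ∈ F, j.toSpace v ∈ Submodule.span ℂ (range c) := by
    intro v hv
    have h1 : (⟨j.toSpace v, v, hv, rfl⟩ : FS) = ∑ i, b.repr ⟨j.toSpace v, v, hv, rfl⟩ i • b i :=
      (b.sum_repr _).symm
    have h2 := congrArg Subtype.val h1
    simp only [Submodule.coe_sum, Submodule.coe_smul] at h2
    rw [h2]
    refine Submodule.sum_mem _ fun i _ => ?_
    exact Submodule.smul_mem _ ((b.repr ⟨j.toSpace v, v, hv, rfl⟩ i : ℝ) : ℂ)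
      (Submodule.subset_span ⟨i, rfl⟩)
  have hspan : ⊤ ≤ Submodule.span ℂ (range c) := by
    intro z _
    obtain ⟨v, rfl⟩ := j.toSpace.surjective z
    have hv : v ∈ F ⊔ F.map j.J := by rw [(j.isCompl hF).sup_eq_top]; trivial
    obtain ⟨f, hf, _, ⟨f', hf', rfl⟩, rfl⟩ := Submodule.mem_sup.mp hv
    rw [map_add, toSpace_J]
    exact Submodule.add_mem _ (hsF f hf) (Submodule.smul_mem _ _ (hsF f' hf'))
  let B := OrthonormalBasis.mk hon hspan
  have hB : ∀ i, B i = c i := fun i => by simp [B]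
  let κ : V ≃ₗ[ℝ] (Fin (Module.finrank ℝ FS) → ℂ) :=
    j.toSpace.trans ((B.repr.toLinearEquiv.trans (WithLp.linearEquiv 2 ℂ _)).restrictScalars ℝ)
  have hκ : ∀ v i, κ v i = inner ℂ (c i) (j.toSpace v) := by
    intro v i
    rw [← hB, ← B.repr_apply_apply]
    rfl
  refine ⟨_, ⟨⟨κ, ?_, ?_, ?_⟩⟩⟩
  · intro v
    ext i
    rw [hκ, toSpace_J, inner_smul_right, Pi.smul_apply, hκ, smul_eq_mul]
  · intro z w
    rw [← inner_def, ← B.sum_inner_mul_inner, dotProduct]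
    refine Finset.sum_congr rfl fun i _ => ?_
    rw [hB, Pi.star_apply, hκ, hκ, RCLike.star_def, inner_conj_symm, mul_comm]
  · intro v
    constructor
    · intro hv
      refine ⟨fun i => j.G v (j.toSpace.symm (c i)), ?_⟩
      ext i
      have := hreal _ _ (hcF i) hv
      rw [LinearEquiv.apply_symm_apply] at this
      rw [hκ, this]
      rfl
    · rintro ⟨x, hx⟩
      have h1 : j.toSpace v = ∑ i, (x i : ℂ) • c i := by
        rw [← B.sum_repr (j.toSpace v)]
        refine Finset.sum_congr rfl fun i _ => ?_
        rw [hB, B.repr_apply_apply, hB, ← hκ, hx]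
        rfl
      have h2 : v = ∑ i, x i • j.toSpace.symm (c i) := by
        apply j.toSpace.injective
        rw [h1, map_sum]
        refine Finset.sum_congr rfl fun i _ => ?_
        rw [map_smul, LinearEquiv.apply_symm_apply]
        rfl
      rw [h2]
      exact Submodule.sum_mem _ fun i _ => Submodule.smul_mem _ _ (hcF i)

namespace Coord

variable {ι : Type*} [Fintype ι] [DecidableEq ι] (K : j.Coord F ι)

/-- The vector with real part `x` and imaginary part `y`. -/
def vec (x y : ι → ℝ) : V := K.κ.symm (toC x + Complex.I • toC y)

theorem κ_vec (x y : ι → ℝ) : K.κ (K.vec x y) = toC x + Complex.I • toC y := by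
  rw [vec, LinearEquiv.apply_symm_apply]

theorem exists_vec (v : V) : ∃ x y, v = K.vec x y := by
  refine ⟨fun i => (K.κ v i).re, fun i => (K.κ v i).im, K.κ.injective ?_⟩
  rw [κ_vec]
  ext i
  simp only [Pi.add_apply, Pi.smul_apply, toC, Function.comp, smul_eq_mul]
  rw [mul_comm]
  exact (Complex.re_add_im _).symm

theorem vec_injective {x y x' y' : ι → ℝ} (h : K.vec x y = K.vec x' y') : x = x' ∧ y = y' := by
  have h1 := congrArg K.κ h
  rw [κ_vec, κ_vec] at h1
  constructor
  · ext i
    have := congrArg Complex.re (congrFun h1 i)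
    simpa using this
  · ext i
    have := congrArg Complex.im (congrFun h1 i)
    simpa using this

theorem vec_add (x y x' y' : ι → ℝ) : K.vec x y + K.vec x' y' = K.vec (x + x') (y + y') := by
  apply K.κ.injective
  rw [map_add, κ_vec, κ_vec, κ_vec, toC_add, toC_add]
  module

theorem J_vec (x y : ι → ℝ) : j.J (K.vec x y) = K.vec (-y) x := by
  apply K.κ.injective
  rw [K.map_J, κ_vec, κ_vec]
  ext i
  simp only [Pi.add_apply, Pi.smul_apply, toC, Function.comp, smul_eq_mul, Pi.neg_apply,
    Complex.ofReal_neg]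
  linear_combination (y i : ℂ) * Complex.I_mul_I

theorem vec_mem (x : ι → ℝ) : K.vec x 0 ∈ F := by
  rw [K.mem_iff]
  refine ⟨x, ?_⟩
  rw [κ_vec]
  ext i
  simp

theorem herm_vec (x y x' y' : ι → ℝ) : j.herm (K.vec x y) (K.vec x' y') =
    ((x ⬝ᵥ x' + y ⬝ᵥ y' : ℝ) : ℂ) + Complex.I * ((y ⬝ᵥ x' - x ⬝ᵥ y' : ℝ) : ℂ) := by
  rw [K.herm_eq, κ_vec, κ_vec, star_add, star_smul, star_toC, star_toC]
  simp only [add_dotProduct, dotProduct_add, smul_dotProduct, dotProduct_smul, toC_dotProduct,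
    smul_eq_mul, RCLike.star_def, Complex.conj_I]
  push_cast
  linear_combination -((y ⬝ᵥ y' : ℝ) : ℂ) * Complex.I_mul_I

theorem G_vec (x y x' y' : ι → ℝ) : j.G (K.vec x y) (K.vec x' y') = x ⬝ᵥ x' + y ⬝ᵥ y' := by
  have h := congrArg Complex.re (K.herm_vec x y x' y')
  rw [herm_re] at h
  simpa using h

theorem form_vec (x y x' y' : ι → ℝ) : Ω (K.vec x y) (K.vec x' y') = x ⬝ᵥ y' - y ⬝ᵥ x' := by
  have h := congrArg Complex.im (K.herm_vec x y x' y')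
  simp [herm] at h
  linarith

/-- The real coordinates on `F`. -/
def realEquiv : F ≃ₗ[ℝ] (ι → ℝ) where
  toFun u := fun i => (K.κ u i).re
  invFun x := ⟨K.vec x 0, K.vec_mem x⟩
  map_add' u w := by ext i; simp
  map_smul' r u := by ext i; simp
  left_inv u := by
    obtain ⟨x, hx⟩ := (K.mem_iff u).mp u.2
    apply Subtype.ext
    apply K.κ.injective
    change K.κ (K.vec _ 0) = _
    rw [κ_vec, hx]
    ext i
    simp [hx]
  right_inv x := by
    ext i
    simp [κ_vec]

theorem realEquiv_symm_apply (x : ι → ℝ) : (K.realEquiv.symm x : V) = K.vec x 0 := rfl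

theorem vec_realEquiv (u : F) : K.vec (K.realEquiv u) 0 = u := by
  rw [← realEquiv_symm_apply, LinearEquiv.symm_apply_apply]

/-- The orthonormal basis of `F` that corresponds to the coordinates. -/
def realBasis : Module.Basis ι ℝ F := Module.Basis.ofEquivFun K.realEquiv

/-- The matrix of an endomorphism of `F`. -/
def mat : Module.End ℝ F ≃ₐ[ℝ] Matrix ι ι ℝ := LinearMap.toMatrixAlgEquiv K.realBasis

theorem mat_mulVec (T : Module.End ℝ F) (u : F) :
    K.mat T *ᵥ K.realEquiv u = K.realEquiv (T u) :=
  LinearMap.toMatrix_mulVec_repr K.realBasis K.realBasis T u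

theorem vec_mat_mulVec (T : Module.End ℝ F) (x : ι → ℝ) :
    K.vec (K.mat T *ᵥ x) 0 = (T (K.realEquiv.symm x) : V) := by
  rw [← K.vec_realEquiv, ← mat_mulVec, LinearEquiv.apply_symm_apply]

theorem G_realEquiv (u w : F) : j.G u w = K.realEquiv u ⬝ᵥ K.realEquiv w := by
  rw [← K.vec_realEquiv u, ← K.vec_realEquiv w, G_vec]
  simp

theorem mat_transpose (T : Module.End ℝ F) : K.mat (j.transpose F T) = (K.mat T)ᵀ := by
  apply Matrix.ext_of_mulVec_single
  intro i
  refine dotProduct_eq _ _ fun w => ?_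
  obtain ⟨u, hu⟩ := K.realEquiv.surjective (Pi.single i 1)
  obtain ⟨w, rfl⟩ := K.realEquiv.surjective w
  rw [← hu, mat_mulVec, ← K.G_realEquiv, j.transpose_spec, K.G_realEquiv, ← mat_mulVec,
    Matrix.dotProduct_mulVec, ← Matrix.mulVec_transpose]

/-- The matrix of `A_g`. -/
def matA (g : Ω.stabilizer F) : Matrix ι ι ℝ := K.mat (A g).toLinearMap

/-- The matrix of `S_g`. -/
def matS (hF : Ω.IsLagrangian F) (g : Ω.stabilizer F) : Matrix ι ι ℝ := K.mat (j.S hF g)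

variable (hF : Ω.IsLagrangian F) (g : Ω.stabilizer F)

theorem det_matA : (K.matA g).det = LinearMap.det (A g).toLinearMap :=
  LinearMap.det_toMatrix K.realBasis _

theorem det_matA_ne_zero : (K.matA g).det ≠ 0 := by
  rw [det_matA]
  exact (LinearEquiv.isUnit_det' (A g)).ne_zero

theorem apply_vec_real (x : ι → ℝ) :
    ((g : Ω.Sp) : V ≃ₗ[ℝ] V) (K.vec x 0) = K.vec (K.matA g *ᵥ x) 0 := by
  rw [matA, vec_mat_mulVec]
  rfl

/-- The F-component is A S y by definition of S. The jF-component is forced to be A⁻ᵀ y because g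
preserves the pairing between jF and F. -/
theorem apply_vec_imag (y : ι → ℝ) :
    ((g : Ω.Sp) : V ≃ₗ[ℝ] V) (K.vec 0 y) =
      K.vec (K.matA g *ᵥ K.matS hF g *ᵥ y) ((K.matA g)ᵀ⁻¹ *ᵥ y) := by
  obtain ⟨p, q, hpq⟩ := K.exists_vec (((g : Ω.Sp) : V ≃ₗ[ℝ] V) (K.vec 0 y))
  have hdet : IsUnit (K.matA g)ᵀ.det := by
    rw [Matrix.det_transpose]; exact (K.det_matA_ne_zero g).isUnit
  have hq : (K.matA g)ᵀ *ᵥ q = y := by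
    refine dotProduct_eq _ _ fun x => ?_
    have h1 : Ω (((g : Ω.Sp) : V ≃ₗ[ℝ] V) (K.vec 0 y)) (((g : Ω.Sp) : V ≃ₗ[ℝ] V) (K.vec x 0)) =
        Ω (K.vec 0 y) (K.vec x 0) := g.1.2 _ _
    rw [hpq, apply_vec_real, form_vec, form_vec] at h1
    simp only [dotProduct_zero, zero_sub, neg_inj] at h1
    rw [← h1, Matrix.dotProduct_mulVec, ← Matrix.mulVec_transpose]
  have hq' : (K.matA g)ᵀ⁻¹ *ᵥ y = q := by
    rw [← hq, Matrix.mulVec_mulVec, Matrix.nonsing_inv_mul _ hdet, Matrix.one_mulVec]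
  have hp : K.vec p 0 = K.vec (K.matA g *ᵥ K.matS hF g *ᵥ y) 0 := by
    have h1 : F.projectionOnto (F.map j.J) (j.isCompl hF) (K.vec p q) =
        ⟨K.vec p 0, K.vec_mem p⟩ := by
      have e : K.vec p q = ((⟨K.vec p 0, K.vec_mem p⟩ : F) : V) +
          ((⟨j.J (K.vec q 0), K.vec q 0, K.vec_mem q, rfl⟩ : F.map j.J) : V) := by
        simp only
        rw [J_vec, vec_add]
        simp
      rw [e, map_add, Submodule.projectionOnto_apply_left, Submodule.projectionOnto_apply_right,
        add_zero]
    have h2 : (A g (j.S hF g (K.realEquiv.symm y)) : F) =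
        F.projectionOnto (F.map j.J) (j.isCompl hF) (K.vec p q) := by
      have e : j.J (K.vec y 0) = K.vec 0 y := by rw [J_vec]; simp
      rw [← hpq, ← e]
      change A g ((A g).symm _) = _
      rw [LinearEquiv.apply_symm_apply]
      rfl
    rw [matS, matA, vec_mat_mulVec]
    have h3 : K.realEquiv.symm (K.mat (j.S hF g) *ᵥ y) = j.S hF g (K.realEquiv.symm y) := by
      apply K.realEquiv.injective
      rw [LinearEquiv.apply_symm_apply, ← mat_mulVec, LinearEquiv.apply_symm_apply]
    rw [h3]
    exact (congrArg Subtype.val (h2.trans h1)).symm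
  rw [hpq, hq', (K.vec_injective hp).1]

theorem apply_vec (x y : ι → ℝ) :
    ((g : Ω.Sp) : V ≃ₗ[ℝ] V) (K.vec x y) =
      K.vec (K.matA g *ᵥ x + K.matA g *ᵥ K.matS hF g *ᵥ y) ((K.matA g)ᵀ⁻¹ *ᵥ y) := by
  have e : K.vec x y = K.vec x 0 + K.vec 0 y := by rw [vec_add]; simp
  rw [e, map_add, apply_vec_real, K.apply_vec_imag hF, vec_add, zero_add]

/-- The subspace jF is isotropic, so g(jF) is too; pairing two of its vectors gives y·Sw = w·Sy. -/
theorem matS_transpose : (K.matS hF g)ᵀ = K.matS hF g := by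
  apply Matrix.ext_of_mulVec_single
  intro i
  refine dotProduct_eq _ _ fun w => ?_
  generalize (Pi.single i 1 : ι → ℝ) = y
  have h1 : Ω (((g : Ω.Sp) : V ≃ₗ[ℝ] V) (K.vec 0 y)) (((g : Ω.Sp) : V ≃ₗ[ℝ] V) (K.vec 0 w)) =
      Ω (K.vec 0 y) (K.vec 0 w) := g.1.2 _ _
  have hdet : IsUnit (K.matA g).det := (K.det_matA_ne_zero g).isUnit
  have h2 : ∀ a b : ι → ℝ, (K.matA g *ᵥ a) ⬝ᵥ ((K.matA g)ᵀ⁻¹ *ᵥ b) = a ⬝ᵥ b := by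
    intro a b
    rw [Matrix.dotProduct_mulVec, ← Matrix.mulVec_transpose, Matrix.transpose_nonsing_inv,
      Matrix.transpose_transpose, Matrix.mulVec_mulVec, Matrix.nonsing_inv_mul _ hdet,
      Matrix.one_mulVec]
  rw [K.apply_vec_imag hF, K.apply_vec_imag hF, form_vec, form_vec, h2, dotProduct_comm _ (K.matA g *ᵥ _), h2] at h1
  simp only [dotProduct_zero, zero_dotProduct, sub_zero] at h1
  rw [Matrix.mulVec_transpose, ← Matrix.dotProduct_mulVec, dotProduct_comm]
  linarith

theorem matA_mul (h : Ω.stabilizer F) : K.matA (g * h) = K.matA g * K.matA h := by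
  rw [matA, matA, matA, ← map_mul]
  rfl

theorem matA_one : K.matA (1 : Ω.stabilizer F) = 1 := by
  rw [matA, ← map_one K.mat]
  rfl

/-- This is the cocycle rule behind the homomorphism property of ρ. It is the F-component of
g(h(jy)), with A_g and A_h cancelled. -/
theorem matS_mul (h : Ω.stabilizer F) :
    K.matS hF (g * h) = K.matS hF h + (K.matA h)⁻¹ * K.matS hF g * (K.matA h)ᵀ⁻¹ := by
  have hg : IsUnit (K.matA g).det := (K.det_matA_ne_zero g).isUnit
  have hh : IsUnit (K.matA h).det := (K.det_matA_ne_zero h).isUnit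
  apply Matrix.ext_of_mulVec_single
  intro i
  generalize (Pi.single i 1 : ι → ℝ) = y
  have h1 : (((g * h : Ω.stabilizer F) : Ω.Sp) : V ≃ₗ[ℝ] V) (K.vec 0 y) =
      ((g : Ω.Sp) : V ≃ₗ[ℝ] V) (((h : Ω.Sp) : V ≃ₗ[ℝ] V) (K.vec 0 y)) := rfl
  rw [K.apply_vec_imag hF, K.apply_vec_imag hF, K.apply_vec hF] at h1
  have h2 := (K.vec_injective h1).1
  rw [matA_mul] at h2
  have h3 := congrArg (fun v => (K.matA h)⁻¹ *ᵥ (K.matA g)⁻¹ *ᵥ v) h2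
  simp only [Matrix.mulVec_add, Matrix.mulVec_mulVec] at h3
  have e1 : (K.matA g)⁻¹ * K.matA g = 1 := Matrix.nonsing_inv_mul _ hg
  have e2 : (K.matA h)⁻¹ * K.matA h = 1 := Matrix.nonsing_inv_mul _ hh
  have c1 : ∀ N, (K.matA g)⁻¹ * (K.matA g * N) = N := fun N => by
    rw [← Matrix.mul_assoc, e1, Matrix.one_mul]
  have c2 : ∀ N, (K.matA h)⁻¹ * (K.matA h * N) = N := fun N => by
    rw [← Matrix.mul_assoc, e2, Matrix.one_mul]
  simp only [Matrix.mul_assoc, c1, c2] at h3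
  rw [h3, Matrix.add_mulVec]
  simp only [Matrix.mul_assoc]

theorem matS_one : K.matS hF (1 : Ω.stabilizer F) = 0 := by
  have := K.matS_mul hF 1 1
  rw [mul_one, matA_one] at this
  simpa using this

end Coord

end PCCS

/-! ### The maps C_g and Z_g in coordinates -/

namespace PCCS

variable {V : Type*} [AddCommGroup V] [Module ℝ V] {Ω : SymplecticForm V} {j : PCCS Ω}
  {F : Submodule ℝ V} [FiniteDimensional ℝ V]

open Bargmann

namespace Coord

variable {ι : Type*} [Fintype ι] [DecidableEq ι] (K : j.Coord F ι)
  (hF : Ω.IsLagrangian F) (g : Ω.stabilizer F)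

theorem map_ofReal_mul (M N : Matrix ι ι ℝ) : (M * N).map Complex.ofReal =
    M.map Complex.ofReal * N.map Complex.ofReal := Matrix.map_mul (f := Complex.ofRealHom)

theorem map_ofReal_inv (M : Matrix ι ι ℝ) (hM : M.det ≠ 0) : (M⁻¹).map Complex.ofReal =
    (M.map Complex.ofReal)⁻¹ := by
  symm
  apply Matrix.inv_eq_right_inv
  rw [← map_ofReal_mul, Matrix.mul_nonsing_inv _ hM.isUnit]
  simp

theorem det_map_ofReal (M : Matrix ι ι ℝ) : (M.map Complex.ofReal).det = (M.det : ℂ) :=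
  (RingHom.map_det Complex.ofRealHom M).symm

/-- The matrix of `A_g` over the complex numbers. -/
def cmatA : Matrix ι ι ℂ := (K.matA g).map Complex.ofReal

/-- The real part of the matrix of `(1 + (A_gᵀ A_g)⁻¹ - i S_g) / 2`. -/
def matP : Matrix ι ι ℝ := (1 / 2 : ℝ) • (1 + ((K.matA g)ᵀ * K.matA g)⁻¹)

/-- The matrix of `(1 + (A_gᵀ A_g)⁻¹ - i S_g) / 2`. -/
def matX : Matrix ι ι ℂ :=
  (K.matP g).map Complex.ofReal + Complex.I • ((-(1 / 2) : ℝ) • K.matS hF g).map Complex.ofReal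

theorem isUnit_det_cmatA : IsUnit (K.cmatA g).det := by
  rw [cmatA, det_map_ofReal]
  exact (Complex.ofReal_ne_zero.mpr (K.det_matA_ne_zero g)).isUnit

theorem matP_posDef : (K.matP g).PosDef := by
  have h1 : ((K.matA g)ᵀ * K.matA g).PosDef := by
    have := Matrix.PosDef.conjTranspose_mul_self (K.matA g)
      (Matrix.mulVec_injective_iff_isUnit.mpr
        ((Matrix.isUnit_iff_isUnit_det _).mpr (K.det_matA_ne_zero g).isUnit))
    rwa [Matrix.conjTranspose_eq_transpose_of_trivial] at this
  exact (Matrix.PosDef.one.add h1.inv).smul (by norm_num)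

theorem matX_mem_posRe : K.matX hF g ∈ Matrix.posRe ι := by
  have hs : ((-(1 / 2) : ℝ) • K.matS hF g)ᵀ = (-(1 / 2) : ℝ) • K.matS hF g := by
    rw [Matrix.transpose_smul, matS_transpose]
  obtain ⟨R, d, hR, h1, h2⟩ := (K.matP_posDef g).exists_congr_diagonal hs
  rw [matX, h1, h2, ← Matrix.complexCongr_eq]
  exact Matrix.complexCongr_mem_posRe hR d

theorem isUnit_det_matX : IsUnit (K.matX hF g).det :=
  (Matrix.det_ne_zero_of_mem_posRe (K.matX_mem_posRe hF g)).isUnit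

theorem matP_transpose : (K.matP g)ᵀ = K.matP g := by
  rw [matP, Matrix.transpose_smul, Matrix.transpose_add, Matrix.transpose_one,
    Matrix.transpose_nonsing_inv, Matrix.transpose_mul, Matrix.transpose_transpose]

theorem matX_transpose : (K.matX hF g)ᵀ = K.matX hF g := by
  rw [matX, Matrix.transpose_add, Matrix.transpose_smul, ← Matrix.transpose_map,
    ← Matrix.transpose_map, Matrix.transpose_smul, matS_transpose, matP_transpose]

theorem cmatA_mul_matX : K.cmatA g * K.matX hF g =
    (1 / 2 : ℂ) • (K.cmatA g + ((K.matA g)ᵀ⁻¹).map Complex.ofReal -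
      Complex.I • (K.matA g * K.matS hF g).map Complex.ofReal) := by
  have h1 : K.matA g * K.matP g = (1 / 2 : ℝ) • (K.matA g + (K.matA g)ᵀ⁻¹) := by
    rw [matP, Matrix.mul_smul, Matrix.mul_add, Matrix.mul_one, Matrix.mul_inv_rev,
      ← Matrix.mul_assoc, Matrix.mul_nonsing_inv _ (K.det_matA_ne_zero g).isUnit, Matrix.one_mul]
  rw [matX, Matrix.mul_add, Matrix.mul_smul, cmatA, ← map_ofReal_mul, ← map_ofReal_mul, h1,
    Matrix.mul_smul]
  ext i k
  simp
  ring

/-- A real linear map has the form z ↦ Cz + D z̄. Here C = AX, and C + D = A because g restricts to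
A on real vectors. -/
theorem κ_apply (v : V) : K.κ (((g : Ω.Sp) : V ≃ₗ[ℝ] V) v) =
    (K.cmatA g * K.matX hF g) *ᵥ K.κ v +
      (K.cmatA g - K.cmatA g * K.matX hF g) *ᵥ star (K.κ v) := by
  obtain ⟨x, y, rfl⟩ := K.exists_vec v
  rw [K.apply_vec hF, κ_vec, κ_vec, cmatA_mul_matX, star_add, star_smul, star_toC, star_toC,
    toC_add, toC_mulVec, Matrix.mulVec_mulVec, toC_mulVec, toC_mulVec, ← cmatA]
  simp only [Matrix.sub_mulVec, Matrix.add_mulVec, Matrix.smul_mulVec, Matrix.mulVec_add,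
    Matrix.mulVec_smul, RCLike.star_def, Complex.conj_I]
  ext i
  simp only [Pi.add_apply, Pi.sub_apply, Pi.smul_apply, smul_eq_mul]
  linear_combination (((K.matA g * K.matS hF g).map Complex.ofReal *ᵥ toC y) i) *
    Complex.I_mul_I

theorem κ_linPart (v : V) : K.κ (j.linPart ((g : Ω.Sp) : V ≃ₗ[ℝ] V) v) =
    (K.cmatA g * K.matX hF g) *ᵥ K.κ v := by
  simp only [linPart, LinearMap.smul_apply, LinearMap.sub_apply, LinearMap.comp_apply,
    LinearEquiv.coe_coe, map_smul, map_sub, K.map_J]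
  rw [K.κ_apply hF, K.κ_apply hF, K.map_J, star_smul, Matrix.mulVec_smul, Matrix.mulVec_smul]
  ext i
  simp only [Pi.add_apply, Pi.sub_apply, Pi.smul_apply, smul_eq_mul, Complex.real_smul,
    RCLike.star_def, Complex.conj_I]
  push_cast
  linear_combination (1 / 2 * (((K.cmatA g - K.cmatA g * K.matX hF g) *ᵥ star (K.κ v)) i) -
    1 / 2 * (((K.cmatA g * K.matX hF g) *ᵥ (K.κ v)) i)) * Complex.I_mul_I

theorem κ_antiPart (v : V) : K.κ (j.antiPart ((g : Ω.Sp) : V ≃ₗ[ℝ] V) v) =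
    (K.cmatA g - K.cmatA g * K.matX hF g) *ᵥ star (K.κ v) := by
  have h : j.antiPart ((g : Ω.Sp) : V ≃ₗ[ℝ] V) v = ((g : Ω.Sp) : V ≃ₗ[ℝ] V) v -
      j.linPart ((g : Ω.Sp) : V ≃ₗ[ℝ] V) v := by
    simp only [linPart, antiPart, LinearMap.smul_apply, LinearMap.sub_apply, LinearMap.add_apply,
      LinearMap.comp_apply, LinearEquiv.coe_coe]
    module
  rw [h, map_sub, K.κ_linPart hF, K.κ_apply hF, add_sub_cancel_left]

theorem κ_C_symm (v : V) : K.κ ((j.C (g : Ω.Sp)).symm v) =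
    ((K.matX hF g)⁻¹ * (K.cmatA g)⁻¹) *ᵥ K.κ v := by
  obtain ⟨w, rfl⟩ := (j.C (g : Ω.Sp)).surjective v
  rw [LinearEquiv.symm_apply_apply, C_apply, K.κ_linPart hF, Matrix.mulVec_mulVec,
    ← Matrix.mul_inv_rev, Matrix.nonsing_inv_mul _ (by
      rw [Matrix.det_mul]; exact (K.isUnit_det_cmatA g).mul (K.isUnit_det_matX hF g)),
    Matrix.one_mulVec]

/-- From C = AX and D = A - AX one gets C⁻¹D = X⁻¹ - 1, followed by conjugation. -/
theorem κ_Z (v : V) : K.κ (j.Z (g : Ω.Sp) v) = ((K.matX hF g)⁻¹ - 1) *ᵥ star (K.κ v) := by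
  change K.κ ((j.C (g : Ω.Sp)).symm (j.antiPart ((g : Ω.Sp) : V ≃ₗ[ℝ] V) v)) = _
  rw [K.κ_C_symm hF, K.κ_antiPart hF, Matrix.mulVec_mulVec, Matrix.mul_sub, Matrix.mul_assoc,
    Matrix.nonsing_inv_mul _ (K.isUnit_det_cmatA g), Matrix.mul_one, ← Matrix.mul_assoc,
    Matrix.mul_assoc (K.matX hF g)⁻¹, Matrix.nonsing_inv_mul _ (K.isUnit_det_cmatA g),
    Matrix.mul_one, Matrix.nonsing_inv_mul _ (K.isUnit_det_matX hF g)]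

theorem detC_eq : j.detC (g : Ω.Sp) = (K.matA g).det * (K.matX hF g).det := by
  have h : LinearMap.det (K.complexEquiv.toLinearMap ∘ₗ
      (j.complexLinear (j.linPart ((g : Ω.Sp) : V ≃ₗ[ℝ] V)) (j.linPart_J _)) ∘ₗ
      K.complexEquiv.symm.toLinearMap) = j.detC (g : Ω.Sp) := by
    rw [detC]
    exact LinearMap.det_conj _ K.complexEquiv
  rw [← h]
  have h2 : K.complexEquiv.toLinearMap ∘ₗ
      (j.complexLinear (j.linPart ((g : Ω.Sp) : V ≃ₗ[ℝ] V)) (j.linPart_J _)) ∘ₗ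
      K.complexEquiv.symm.toLinearMap = Matrix.toLin' (K.cmatA g * K.matX hF g) := by
    refine LinearMap.ext fun z => ?_
    rw [Matrix.toLin'_apply]
    obtain ⟨w, rfl⟩ := K.complexEquiv.surjective z
    simp only [LinearMap.comp_apply, LinearEquiv.coe_coe, LinearEquiv.symm_apply_apply]
    rw [complexEquiv_apply, complexEquiv_apply, ← K.κ_linPart hF]
    simp [complexLinear]
  rw [h2, LinearMap.det_toLin', Matrix.det_mul, cmatA, det_map_ofReal]

theorem matS_inv : K.matS hF g⁻¹ = -(K.matA g * K.matS hF g * (K.matA g)ᵀ) := by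
  have h := K.matS_mul hF g⁻¹ g
  rw [inv_mul_cancel, matS_one] at h
  have hg : IsUnit (K.matA g).det := (K.det_matA_ne_zero g).isUnit
  have hgT : IsUnit (K.matA g)ᵀ.det := by rwa [Matrix.det_transpose]
  have h2 : (K.matA g)⁻¹ * K.matS hF g⁻¹ * (K.matA g)ᵀ⁻¹ = -K.matS hF g :=
    eq_neg_of_add_eq_zero_right h.symm
  calc K.matS hF g⁻¹ = (K.matA g * (K.matA g)⁻¹) * K.matS hF g⁻¹ *
        ((K.matA g)ᵀ⁻¹ * (K.matA g)ᵀ) := by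
        rw [Matrix.mul_nonsing_inv _ hg, Matrix.nonsing_inv_mul _ hgT, Matrix.one_mul,
          Matrix.mul_one]
    _ = K.matA g * ((K.matA g)⁻¹ * K.matS hF g⁻¹ * (K.matA g)ᵀ⁻¹) * (K.matA g)ᵀ := by
        simp only [Matrix.mul_assoc]
    _ = _ := by rw [h2, Matrix.mul_neg, Matrix.neg_mul]

theorem matA_inv : K.matA g⁻¹ = (K.matA g)⁻¹ := by
  symm
  apply Matrix.inv_eq_right_inv
  rw [← matA_mul, mul_inv_cancel, matA_one]

/-- The kernel also involves Z of the inverse of g. This formula expresses it through the data of g,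
with a complex conjugate that the antilinear slot of the Hermitian product undoes. -/
theorem matX_inv : K.matX hF g⁻¹ =
    K.cmatA g * (K.matX hF g).map (starRingEnd ℂ) * (K.cmatA g)ᵀ := by
  have hg : IsUnit (K.matA g).det := (K.det_matA_ne_zero g).isUnit
  have hgT : IsUnit (K.matA g)ᵀ.det := by rwa [Matrix.det_transpose]
  have h1 : (K.matX hF g).map (starRingEnd ℂ) = (K.matP g).map Complex.ofReal +
      Complex.I • ((1 / 2 : ℝ) • K.matS hF g).map Complex.ofReal := by
    ext i k
    simp [matX, map_ofNat]
  have h2 : K.matP g⁻¹ = K.matA g * K.matP g * (K.matA g)ᵀ := by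
    rw [matP, matP, matA_inv, Matrix.mul_inv_rev, Matrix.mul_inv_rev, Matrix.nonsing_inv_nonsing_inv _ hg,
      ← Matrix.transpose_nonsing_inv, Matrix.transpose_nonsing_inv, Matrix.transpose_nonsing_inv,
      Matrix.nonsing_inv_nonsing_inv _ hgT, Matrix.mul_smul, Matrix.smul_mul, Matrix.mul_add,
      Matrix.add_mul, Matrix.mul_one, ← Matrix.mul_assoc, Matrix.mul_nonsing_inv _ hg,
      Matrix.one_mul, Matrix.nonsing_inv_mul _ hgT, add_comm]
  rw [h1, matX, h2, matS_inv, cmatA, ← Matrix.transpose_map, Matrix.mul_add, Matrix.add_mul,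
    Matrix.mul_smul, Matrix.smul_mul, ← map_ofReal_mul, ← map_ofReal_mul, ← map_ofReal_mul,
    ← map_ofReal_mul, Matrix.mul_smul, Matrix.smul_mul, smul_neg, neg_smul, neg_neg]

end Coord

end PCCS

/-! ### The representation on L² and its Berezin kernel -/

namespace PCCS

variable {V : Type*} [AddCommGroup V] [Module ℝ V] {Ω : SymplecticForm V} {j : PCCS Ω}
  {F : Submodule ℝ V} [FiniteDimensional ℝ V]

open Bargmann

namespace Coord

variable {ι : Type*} [Fintype ι] [DecidableEq ι] (K : j.Coord F ι)
  (hF : Ω.IsLagrangian F) (g h : Ω.stabilizer F) (hbar : ℝ)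

/-- The phase of the operator on `L²` that corresponds to `g`. -/
def phase (x : ι → ℝ) : ℝ :=
  1 / (2 * hbar) * (((K.matA g)ᵀ *ᵥ x) ⬝ᵥ K.matS hF g *ᵥ (K.matA g)ᵀ *ᵥ x)

theorem continuous_phase : Continuous (K.phase hF g hbar) := by
  unfold phase
  fun_prop

theorem det_matA_transpose : (K.matA g)ᵀ.det ≠ 0 := by
  rw [Matrix.det_transpose]
  exact K.det_matA_ne_zero g

/-- The operator `(ρ(g) ψ)(x) = |det A_g|^(1/2) exp(i ⟨S_g A_gᵀ x, A_gᵀ x⟩ / 2ħ) ψ(A_gᵀ x)`. -/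
def rho : L2 ι →ₗᵢ[ℂ] L2 ι :=
  phaseOp (K.det_matA_transpose g) (K.continuous_phase hF g hbar)

/-- Composition with Aᵀ reverses products twice, so the order is kept. The phases add by the cocycle
rule for S, evaluated at A_hᵀ A_gᵀ x, where A_h⁻ᵀ cancels A_hᵀ. -/
theorem rho_mul (ψ : L2 ι) :
    K.rho hF g hbar (K.rho hF h hbar ψ) = K.rho hF (g * h) hbar ψ := by
  refine phaseOp_phaseOp _ _ _ _ _ _ ?_ (fun x => ?_) ψ
  · rw [matA_mul, Matrix.transpose_mul]
  · have hh : IsUnit (K.matA h).det := (K.det_matA_ne_zero h).isUnit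
    have hhT : IsUnit (K.matA h)ᵀ.det := by rwa [Matrix.det_transpose]
    simp only [phase]
    rw [matA_mul, Matrix.transpose_mul, ← Matrix.mulVec_mulVec, matS_mul, ← mul_add]
    congr 1
    rw [Matrix.add_mulVec, dotProduct_add, add_comm]
    congr 1
    have e1 : (K.matA h)ᵀ⁻¹ * (K.matA h)ᵀ = 1 := Matrix.nonsing_inv_mul _ hhT
    have e2 : ∀ y : ι → ℝ, (K.matA h)ᵀ⁻¹ *ᵥ (K.matA h)ᵀ *ᵥ y = y := fun y => by
      rw [Matrix.mulVec_mulVec, e1, Matrix.one_mulVec]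
    rw [← Matrix.mulVec_mulVec, ← Matrix.mulVec_mulVec, e2, Matrix.dotProduct_mulVec _ (K.matA h)⁻¹,
      ← Matrix.mulVec_transpose, Matrix.transpose_nonsing_inv, e2]

theorem rho_one (ψ : L2 ι) : K.rho hF 1 hbar ψ = ψ := by
  refine phaseOp_one _ _ ?_ (fun x => ?_) ψ
  · rw [matA_one, Matrix.transpose_one]
  · simp [phase, matS_one]

/-- `rho` as a unitary equivalence. -/
def rhoEquiv : L2 ι ≃ₗᵢ[ℂ] L2 ι where
  toLinearEquiv := LinearEquiv.ofLinearMap (K.rho hF g hbar).toLinearMap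
    (K.rho hF g⁻¹ hbar).toLinearMap
    (LinearMap.ext fun ψ => (K.rho_mul hF g g⁻¹ hbar ψ).trans (by
      rw [mul_inv_cancel, rho_one]; rfl))
    (LinearMap.ext fun ψ => (K.rho_mul hF g⁻¹ g hbar ψ).trans (by
      rw [inv_mul_cancel, rho_one]; rfl))
  norm_map' := (K.rho hF g hbar).norm_map

variable [hb : Fact (0 < hbar)]

/-- The unitary operator on the Fock space that corresponds to `g`. -/
def fockOp : j.Fock hbar ≃ₗᵢ[ℂ] j.Fock hbar :=
  (K.bargmann hbar).symm.trans ((K.rhoEquiv hF g hbar).trans (K.bargmann hbar))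

theorem fockOp_apply (f : j.Fock hbar) : K.fockOp hF g hbar f =
    K.bargmann hbar (K.rho hF g hbar ((K.bargmann hbar).symm f)) := rfl

theorem fockOp_mul : K.fockOp hF (g * h) hbar = K.fockOp hF g hbar * K.fockOp hF h hbar := by
  refine LinearIsometryEquiv.ext fun f => ?_
  change _ = K.fockOp hF g hbar (K.fockOp hF h hbar f)
  rw [fockOp_apply, fockOp_apply, fockOp_apply, LinearIsometryEquiv.symm_apply_apply, rho_mul]

variable {a : Matrix ι ι ℂ → ℂ} (ha : Matrix.IsLogDet a)

/-- The quadratic form in the Berezin kernel of `fockOp`. -/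
def kernelForm (z w : ι → ℂ) : ℂ :=
  z ⬝ᵥ z + w ⬝ᵥ w -
    (w - (K.cmatA g)⁻¹ *ᵥ z) ⬝ᵥ (K.matX hF g)⁻¹ *ᵥ (w - (K.cmatA g)⁻¹ *ᵥ z)

variable {hbar}

include ha in
-- The left side is ⟨φ_z, ρ(g)φ_v⟩, a Gaussian integral with matrix X; its branch exp(-a(X)/2) is
-- exactly the constant in the parameters.
theorem fockOp_coherent (v z : V) : K.fockOp hF g hbar (j.coherent hbar v) z =
    ((|(K.matA g).det| ^ (-(1 / 2) : ℝ) : ℝ) : ℂ) *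
      Complex.exp (-(1 / 2) * a (K.matX hF g)) *
      Complex.exp (1 / (4 * hbar) * K.kernelForm hF g (K.κ z) (star (K.κ v))) := by
  have hh : (hbar : ℂ) ≠ 0 := Complex.ofReal_ne_zero.mpr hb.out.ne'
  have hg : IsUnit (K.matA g).det := (K.det_matA_ne_zero g).isUnit
  set zc := K.κ z
  set vc := star (K.κ v) with hvc
  set w := vc - (K.cmatA g)⁻¹ *ᵥ zc with hw
  set s : ℝ := Real.sqrt |(K.matA g)ᵀ.det| with hs
  rw [fockOp_apply, bargmann_symm_coherent, bargmann_apply, inner_phiL_left]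
  -- H is the integrand in the variable y = Aᵀx. The Gaussian of z contributes |A⁻ᵀy|²/2, that of v
  -- contributes |y|²/2 and the phase -i y·Sy/2, which add up to y·Xy.
  let H : (ι → ℝ) → ℂ := fun y =>
    (gaussConst ι hbar * gaussConst ι hbar * s *
      Complex.exp (1 / (4 * hbar) * (zc ⬝ᵥ zc + vc ⬝ᵥ vc))) *
    Complex.exp (-((1 / hbar : ℝ) : ℂ) * (toC y ⬝ᵥ K.matX hF g *ᵥ toC y) +
      ((Complex.I / hbar) • w) ⬝ᵥ toC y)
  have hX : ∀ y : ι → ℝ, toC y ⬝ᵥ K.matX hF g *ᵥ toC y =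
      1 / 2 * ((y ⬝ᵥ y : ℝ) : ℂ) + 1 / 2 * ((((K.matA g)⁻¹ᵀ *ᵥ y) ⬝ᵥ ((K.matA g)⁻¹ᵀ *ᵥ y) : ℝ) : ℂ) -
        1 / 2 * Complex.I * ((y ⬝ᵥ K.matS hF g *ᵥ y : ℝ) : ℂ) := by
    intro y
    rw [matX, Matrix.add_mulVec, Matrix.smul_mulVec, ← toC_mulVec, ← toC_mulVec, dotProduct_add,
      dotProduct_smul, toC_dotProduct, toC_dotProduct, matP, Matrix.smul_mulVec,
      Matrix.add_mulVec, Matrix.one_mulVec, Matrix.smul_mulVec, dotProduct_smul, dotProduct_smul,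
      dotProduct_add, Matrix.mul_inv_rev, ← Matrix.mulVec_mulVec,
      Matrix.dotProduct_mulVec y (K.matA g)⁻¹, ← Matrix.mulVec_transpose,
      ← Matrix.transpose_nonsing_inv]
    simp only [smul_eq_mul]
    push_cast
    ring
  have hint : (fun x => starRingEnd ℂ (phi hbar zc x) *
      K.rho hF g hbar (phiL hb.out (K.κ v)) x) =ᵐ[MeasureTheory.volume]
      fun x => H ((K.matA g)ᵀ *ᵥ x) := by
    have h1 := coeFn_phaseOp (K.det_matA_transpose g) (K.continuous_phase hF g hbar)
      (phiL hb.out (K.κ v))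
    have h2 := phaseComp_congr (K.det_matA_transpose g) (K.phase hF g hbar)
      (coeFn_phiL hb.out (K.κ v))
    filter_upwards [h1, h2] with x e1 e2
    have e3 : K.rho hF g hbar (phiL hb.out (K.κ v)) x =
        phaseComp (K.matA g)ᵀ (K.phase hF g hbar) (phi hbar (K.κ v)) x := e1.trans e2
    rw [e3, phaseComp, conj_phi, phi, ← hvc]
    have hx : x = (K.matA g)⁻¹ᵀ *ᵥ ((K.matA g)ᵀ *ᵥ x) := by
      rw [Matrix.mulVec_mulVec, ← Matrix.transpose_mul, Matrix.mul_nonsing_inv _ hg,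
        Matrix.transpose_one, Matrix.one_mulVec]
    simp only [H, phase]
    set y := (K.matA g)ᵀ *ᵥ x with hy
    have hzx : zc ⬝ᵥ toC x = ((K.cmatA g)⁻¹ *ᵥ zc) ⬝ᵥ toC y := by
      conv_lhs => rw [hx]
      rw [toC_mulVec, Matrix.transpose_map, map_ofReal_inv _ (K.det_matA_ne_zero g),
        Matrix.dotProduct_mulVec, Matrix.vecMul_transpose]
      rfl
    have hxx : toC x ⬝ᵥ toC x =
        ((((K.matA g)⁻¹ᵀ *ᵥ y) ⬝ᵥ ((K.matA g)⁻¹ᵀ *ᵥ y) : ℝ) : ℂ) := by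
      rw [toC_dotProduct, ← hx]
    rw [hX, hzx, hxx, toC_dotProduct y y, smul_dotProduct, hw, sub_dotProduct]
    simp only [smul_eq_mul]
    set q := (((K.matA g)⁻¹ᵀ *ᵥ y) ⬝ᵥ ((K.matA g)⁻¹ᵀ *ᵥ y) : ℝ)
    set r := y ⬝ᵥ K.matS hF g *ᵥ y
    set n := y ⬝ᵥ y
    set p := ((K.cmatA g)⁻¹ *ᵥ zc) ⬝ᵥ toC y
    set m := vc ⬝ᵥ toC y
    have e4 : ∀ c s E1 E2 E3 : ℂ, c * Complex.exp E1 * (s * Complex.exp E2 * (c * Complex.exp E3)) =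
        c * c * s * Complex.exp (E1 + E2 + E3) := by
      intro c s E1 E2 E3
      rw [Complex.exp_add, Complex.exp_add]
      ring
    rw [e4, mul_assoc (_ * _) (Complex.exp _) (Complex.exp _), ← Complex.exp_add]
    congr 2
    push_cast
    field_simp
    ring
  rw [MeasureTheory.integral_congr_ae hint, Matrix.integral_comp_mulVec (K.det_matA_transpose g) H]
  simp only [H]
  have hs' : ((-(1 / 2) : ℝ) • K.matS hF g)ᵀ = (-(1 / 2) : ℝ) • K.matS hF g := by
    rw [Matrix.transpose_smul, matS_transpose]
  have hc : (0 : ℝ) < 1 / hbar := by have := hb.out; positivity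
  rw [MeasureTheory.integral_const_mul, ha.integral_gaussian (M := K.matX hF g) (K.matP_posDef g) hs' rfl hc]
  have hconst : (gaussConst ι hbar : ℂ) * gaussConst ι hbar *
      ((Real.sqrt (Real.pi / (1 / hbar)) ^ Fintype.card ι : ℝ) : ℂ) = 1 := by
    exact_mod_cast gaussConst_sq (ι := ι) hb.out
  -- The Jacobian |det A|⁻¹ meets the unitarity factor |det A|^(1/2).
  have hdet : (|(K.matA g)ᵀ.det|⁻¹ : ℝ) * s = |(K.matA g).det| ^ (-(1 / 2) : ℝ) := by
    have hpos : 0 < |(K.matA g).det| := abs_pos.mpr (K.det_matA_ne_zero g)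
    rw [hs, Matrix.det_transpose, Real.sqrt_eq_rpow, ← Real.rpow_neg_one, ← Real.rpow_add hpos]
    norm_num
  have hexp : 1 / (4 * (hbar : ℂ)) * K.kernelForm hF g zc vc =
      1 / (4 * hbar) * (zc ⬝ᵥ zc + vc ⬝ᵥ vc) +
        ((Complex.I / hbar) • w) ⬝ᵥ (K.matX hF g)⁻¹ *ᵥ ((Complex.I / hbar) • w) /
          (4 * ((1 / hbar : ℝ) : ℂ)) := by
    rw [kernelForm, ← hw, Matrix.mulVec_smul, smul_dotProduct, dotProduct_smul]
    simp only [smul_eq_mul]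
    push_cast
    field_simp
    rw [Complex.I_sq]
    ring
  rw [hexp, Complex.exp_add, ← hdet]
  push_cast at hconst ⊢
  linear_combination (((|(K.matA g)ᵀ.det| : ℝ) : ℂ)⁻¹ * s * Complex.exp (-(1 / 2) * a (K.matX hF g)) *
    Complex.exp (1 / (4 * hbar) * (zc ⬝ᵥ zc + vc ⬝ᵥ vc)) *
    Complex.exp (((Complex.I / hbar) • w) ⬝ᵥ (K.matX hF g)⁻¹ *ᵥ ((Complex.I / hbar) • w) /
          (4 * (1 / (hbar : ℂ))))) * hconst

end Coord

end PCCS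

/-! ### Heisenberg covariance and the lift to Mp^c -/

/-- This is the comparison of exponents in the covariance relation, with N = A⁻¹, u and c the
coordinates of v and gv, and u' and c' their conjugates. Putting r = u' + w - Nz, translation by c
changes r to r + X(u - u'), and X⁻¹ cancels against X in every new term. -/
theorem Matrix.kernelForm_translate {ι : Type*} [Fintype ι] [DecidableEq ι] {N X : Matrix ι ι ℂ}
    (hX : Xᵀ = X) (hu : IsUnit X.det) {u u' c c' : ι → ℂ}
    (h1 : N *ᵥ c = u' + X *ᵥ (u - u')) (h2 : c' = c - Nᵀ *ᵥ (u - u')) (z w : ι → ℂ) :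
    2 * (z ⬝ᵥ c') - c ⬝ᵥ c' + ((z - c) ⬝ᵥ (z - c) + w ⬝ᵥ w -
      (w - N *ᵥ (z - c)) ⬝ᵥ X⁻¹ *ᵥ (w - N *ᵥ (z - c))) =
    -(u ⬝ᵥ u') - 2 * (u ⬝ᵥ w) + (z ⬝ᵥ z + (u' + w) ⬝ᵥ (u' + w) -
      (u' + w - N *ᵥ z) ⬝ᵥ X⁻¹ *ᵥ (u' + w - N *ᵥ z)) := by
  obtain ⟨d, rfl⟩ : ∃ d, u = u' + d := ⟨u - u', by abel⟩
  rw [add_sub_cancel_left] at h1 h2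
  obtain ⟨r, hr⟩ : ∃ r, r = u' + w - N *ᵥ z := ⟨_, rfl⟩
  have e1 : w - N *ᵥ (z - c) = r + X *ᵥ d := by
    rw [Matrix.mulVec_sub, h1, hr]
    abel
  have e2 : X⁻¹ *ᵥ X *ᵥ d = d := by
    rw [Matrix.mulVec_mulVec, Matrix.nonsing_inv_mul _ hu, Matrix.one_mulVec]
  have e3 : (X *ᵥ d) ⬝ᵥ X⁻¹ *ᵥ r = r ⬝ᵥ d := by
    rw [dotProduct_comm, ← Matrix.dotProduct_transpose_mulVec, hX, Matrix.mulVec_mulVec,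
      Matrix.mul_nonsing_inv _ hu, Matrix.one_mulVec, dotProduct_comm]
  have e4 : ∀ y : ι → ℂ, y ⬝ᵥ Nᵀ *ᵥ d = (N *ᵥ y) ⬝ᵥ d := fun y => by
    rw [Matrix.dotProduct_mulVec, Matrix.vecMul_transpose]
  rw [e1, h2, ← hr, Matrix.mulVec_add, e2]
  simp only [dotProduct_sub, sub_dotProduct, dotProduct_add, add_dotProduct, e3, e4, h1]
  rw [hr]
  simp only [sub_dotProduct, add_dotProduct]
  rw [dotProduct_comm c z, dotProduct_comm w u']
  rw [dotProduct_comm w d, dotProduct_comm d u']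
  ring

namespace PCCS

variable {V : Type*} [AddCommGroup V] [Module ℝ V] {Ω : SymplecticForm V} {j : PCCS Ω}
  {F : Submodule ℝ V} [FiniteDimensional ℝ V]

open Bargmann

namespace Coord

variable {ι : Type*} [Fintype ι] [DecidableEq ι] (K : j.Coord F ι)
  (hF : Ω.IsLagrangian F) (g : Ω.stabilizer F) {hbar : ℝ}

theorem inv_cmatA_mulVec (v : V) : (K.cmatA g)⁻¹ *ᵥ K.κ (((g : Ω.Sp) : V ≃ₗ[ℝ] V) v) =
    star (K.κ v) + K.matX hF g *ᵥ (K.κ v - star (K.κ v)) := by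
  have h := Matrix.nonsing_inv_mul _ (K.isUnit_det_cmatA g)
  rw [K.κ_apply hF, Matrix.mulVec_add, Matrix.mulVec_mulVec, Matrix.mulVec_mulVec, Matrix.mul_sub,
    ← Matrix.mul_assoc, h, Matrix.one_mul, Matrix.sub_mulVec, Matrix.one_mulVec, Matrix.mulVec_sub]
  abel

include hF in
theorem star_κ_apply (v : V) : star (K.κ (((g : Ω.Sp) : V ≃ₗ[ℝ] V) v)) =
    K.κ (((g : Ω.Sp) : V ≃ₗ[ℝ] V) v) - (K.cmatA g)⁻¹ᵀ *ᵥ (K.κ v - star (K.κ v)) := by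
  obtain ⟨x, y, rfl⟩ := K.exists_vec v
  have hI : toC x + Complex.I • toC y - (toC x - Complex.I • toC y) =
      (2 * Complex.I) • toC y := by
    module
  rw [K.apply_vec hF, κ_vec, κ_vec, star_add, star_smul, star_toC, star_toC, star_add, star_smul,
    star_toC, star_toC, RCLike.star_def, Complex.conj_I, neg_smul, neg_smul, ← sub_eq_add_neg,
    ← sub_eq_add_neg, hI, cmatA, ← map_ofReal_inv _ (K.det_matA_ne_zero g), ← Matrix.transpose_map,
    Matrix.mulVec_smul, ← toC_mulVec, Matrix.transpose_nonsing_inv]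
  module

variable [hb : Fact (0 < hbar)]

/-- Both sides are continuous in f and coherent states are total, so f = e_w suffices. The
Heisenberg operators map these to multiples of coherent states, and only the exponents have to be
compared. -/
theorem heis_fockOp {a : Matrix ι ι ℂ → ℂ} (ha : Matrix.IsLogDet a) (v : V) (t : ℝ)
    (f : j.Fock hbar) :
    j.heis hbar (((g : Ω.Sp) : V ≃ₗ[ℝ] V) v) t (K.fockOp hF g hbar f) =
      K.fockOp hF g hbar (j.heis hbar v t f) := by
  let T : V → (j.Fock hbar →L[ℂ] j.Fock hbar) := fun v =>
    (⟨j.heis hbar v t, fun f => j.norm_heis v t f⟩ :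
      j.Fock hbar →ₗᵢ[ℂ] j.Fock hbar).toContinuousLinearMap
  let U : j.Fock hbar →L[ℂ] j.Fock hbar := (K.fockOp hF g hbar : j.Fock hbar ≃L[ℂ] j.Fock hbar)
  have key : (T (((g : Ω.Sp) : V ≃ₗ[ℝ] V) v)).comp U = U.comp (T v) := by
    refine K.eq_of_eqOn_coherent fun w => ?_
    change j.heis hbar (((g : Ω.Sp) : V ≃ₗ[ℝ] V) v) t (K.fockOp hF g hbar (j.coherent hbar w)) =
      K.fockOp hF g hbar (j.heis hbar v t (j.coherent hbar w))
    apply j.fock_ext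
    intro z
    rw [heis_coherent, map_smul, heis_apply, map_smul, Pi.smul_apply, smul_eq_mul,
      K.fockOp_coherent hF g ha, K.fockOp_coherent hF g ha, heisFactor, mul_left_comm,
      mul_left_comm (Complex.exp _), ← Complex.exp_add, ← Complex.exp_add]
    congr 2
    rw [← herm_self, ← herm_self, K.herm_eq, K.herm_eq, K.herm_eq, K.herm_eq, kernelForm,
      kernelForm, map_sub, map_add, star_add]
    have h := Matrix.kernelForm_translate (K.matX_transpose hF g) (K.isUnit_det_matX hF g)
      (K.inv_cmatA_mulVec hF g v) (K.star_κ_apply hF g v) (K.κ z) (star (K.κ w))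
    linear_combination 1 / (4 * (hbar : ℂ)) * h
  exact congrArg (fun L => L f) key

theorem star_matX_inv_mulVec (y : ι → ℂ) : star ((K.matX hF g⁻¹)⁻¹ *ᵥ y) =
    ((K.cmatA g)⁻¹ᵀ * (K.matX hF g)⁻¹ * (K.cmatA g)⁻¹) *ᵥ star y := by
  have h1 : (K.matX hF g⁻¹)⁻¹.map (starRingEnd ℂ) =
      (K.cmatA g)⁻¹ᵀ * (K.matX hF g)⁻¹ * (K.cmatA g)⁻¹ := by
    have h2 : (K.cmatA g).map (starRingEnd ℂ) = K.cmatA g := by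
      ext i k
      simp [cmatA]
    have h3 : (K.matX hF g⁻¹).map (starRingEnd ℂ) =
        K.cmatA g * K.matX hF g * (K.cmatA g)ᵀ := by
      rw [matX_inv, Matrix.map_mul, Matrix.map_mul, Matrix.transpose_map, h2, Matrix.map_map]
      congr 2
      ext i k
      simp
    have h4 : (K.matX hF g⁻¹)⁻¹.map (starRingEnd ℂ) =
        ((K.matX hF g⁻¹).map (starRingEnd ℂ))⁻¹ := by
      symm
      apply Matrix.inv_eq_left_inv
      rw [← Matrix.map_mul, Matrix.nonsing_inv_mul _ (K.isUnit_det_matX hF g⁻¹)]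
      simp
    rw [h4, h3, Matrix.mul_inv_rev, Matrix.mul_inv_rev, Matrix.transpose_nonsing_inv,
      Matrix.mul_assoc]
  rw [← h1]
  ext i
  simp [Matrix.mulVec, dotProduct]

/-- Expanding the square in X⁻¹ gives one term for each parameter: the mixed term is C_g⁻¹, and the
pure terms, corrected by z·z and w·w, are Z of the inverse of g and Z_g. -/
theorem kernelForm_eq (z w : V) : K.kernelForm hF g (K.κ z) (star (K.κ w)) =
    2 * j.herm ((j.C (g : Ω.Sp)).symm z) w - j.herm z (j.Z (g : Ω.Sp)⁻¹ z) -
      j.herm (j.Z (g : Ω.Sp) w) w := by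
  have e1 : K.κ (j.Z (g : Ω.Sp)⁻¹ z) = _ := K.κ_Z hF g⁻¹ z
  have e2 : ∀ y y' : ι → ℂ, y ⬝ᵥ (K.cmatA g)⁻¹ᵀ *ᵥ y' = ((K.cmatA g)⁻¹ *ᵥ y) ⬝ᵥ y' :=
    fun y y' => by rw [Matrix.dotProduct_mulVec, Matrix.vecMul_transpose]
  have e3 : ∀ y y' : ι → ℂ, y ⬝ᵥ (K.matX hF g)⁻¹ *ᵥ y' = y' ⬝ᵥ (K.matX hF g)⁻¹ *ᵥ y :=
    fun y y' => by
      rw [Matrix.dotProduct_mulVec, ← Matrix.mulVec_transpose, Matrix.transpose_nonsing_inv,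
        matX_transpose, dotProduct_comm]
  rw [K.herm_eq, K.herm_eq, K.herm_eq, e1, K.κ_Z hF, K.κ_C_symm hF, Matrix.sub_mulVec, star_sub,
    star_matX_inv_mulVec, star_star, Matrix.one_mulVec, star_star, Matrix.sub_mulVec,
    Matrix.one_mulVec, kernelForm, dotProduct_sub, ← Matrix.mulVec_mulVec, ← Matrix.mulVec_mulVec,
    ← Matrix.mulVec_mulVec, e2, Matrix.mulVec_sub, sub_dotProduct, sub_dotProduct, dotProduct_sub,
    dotProduct_sub, e3 ((K.cmatA g)⁻¹ *ᵥ K.κ z) (star (K.κ w)),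
    dotProduct_comm (_ *ᵥ _ *ᵥ _) (star (K.κ w)), dotProduct_comm (_ *ᵥ _) (star (K.κ w))]
  ring

/-- The square of the constant is |det A|⁻¹ (det X)⁻¹, whereas Det_j C_g = det A · det X. -/
theorem norm_sq_mul_detC {a : Matrix ι ι ℂ → ℂ} (ha : Matrix.IsLogDet a) :
    ‖(((|(K.matA g).det| ^ (-(1 / 2) : ℝ) : ℝ) : ℂ) *
      Complex.exp (-(1 / 2) * a (K.matX hF g))) ^ 2 * j.detC (g : Ω.Sp)‖ = 1 := by
  have hpos : 0 < |(K.matA g).det| := abs_pos.mpr (K.det_matA_ne_zero g)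
  have h1 : (|(K.matA g).det| ^ (-(1 / 2) : ℝ)) ^ 2 = |(K.matA g).det|⁻¹ := by
    rw [← Real.rpow_natCast, ← Real.rpow_mul hpos.le, ← Real.rpow_neg_one]
    norm_num
  rw [mul_pow, ha.exp_neg_half_sq (K.matX_mem_posRe hF g), K.detC_eq hF, ← Complex.ofReal_pow, h1,
    norm_mul, norm_mul, norm_mul, norm_inv, Complex.norm_real, Complex.norm_real, Real.norm_eq_abs,
    Real.norm_eq_abs, abs_inv, abs_abs]
  have h2 : ‖(K.matX hF g).det‖ ≠ 0 := norm_ne_zero_iff.mpr (K.isUnit_det_matX hF g).ne_zero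
  field_simp

section Lift

variable {a : Matrix ι ι ℂ → ℂ} (ha : Matrix.IsLogDet a)

include ha in
theorem fockOp_mem_Mpc : (K.fockOp hF g hbar, (g : Ω.Sp)) ∈ j.Mpc hbar := by
  intro v t f
  have h := K.heis_fockOp hF g ha v t ((K.fockOp hF g hbar)⁻¹ f)
  have e : K.fockOp hF g hbar ((K.fockOp hF g hbar)⁻¹ f) = f :=
    (K.fockOp hF g hbar).apply_symm_apply f
  rw [e] at h
  exact h

/-- The lift of the stabiliser of `F` to `Mp^c`. -/
def lift : Ω.stabilizer F →* j.Mpc hbar :=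
  MonoidHom.mk' (fun g => ⟨(K.fockOp hF g hbar, (g : Ω.Sp)), K.fockOp_mem_Mpc hF g ha⟩)
    fun g h => Subtype.ext (Prod.ext (K.fockOp_mul hF g h hbar) rfl)

theorem hasParameters_lift : j.HasParameters hbar (K.lift hF ha g) (g : Ω.Sp)
    (((|(K.matA g).det| ^ (-(1 / 2) : ℝ) : ℝ) : ℂ) *
      Complex.exp (-(1 / 2) * a (K.matX hF g))) := by
  refine ⟨rfl, K.norm_sq_mul_detC hF g ha, fun z v => ?_⟩
  rw [← K.kernelForm_eq hF]
  exact K.fockOp_coherent hF g ha v z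

include K in
/-- An element of `Mp^c` is determined by its parameters. -/
theorem eq_of_hasParameters {p q : j.Mpc hbar} {g : Ω.Sp} {l : ℂ}
    (hp : j.HasParameters hbar p g l) (hq : j.HasParameters hbar q g l) : p = q := by
  refine Subtype.ext (Prod.ext ?_ (hp.1.trans hq.1.symm))
  have h : p.1.1.toLinearIsometry.toContinuousLinearMap =
      q.1.1.toLinearIsometry.toContinuousLinearMap :=
    K.eq_of_eqOn_coherent fun v => j.fock_ext fun z =>
      (hp.2.2 z v).trans (hq.2.2 z v).symm
  exact LinearIsometryEquiv.ext fun f => congrArg (fun L => L f) h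

end Lift

end Coord

end PCCS

/-! ### Openness and smoothness for matrix-valued functions -/

namespace Matrix

variable {ι : Type*} [Fintype ι] [DecidableEq ι]

/-- By homogeneity positivity need only be tested on the unit sphere, and compactness makes it
stable under small changes of the matrix. -/
theorem isOpen_posRe : IsOpen (posRe ι) := by
  rw [isOpen_iff_mem_nhds]
  intro M hM
  let f : Matrix ι ι ℂ × (ι → ℂ) → ℝ := fun p => (star p.2 ⬝ᵥ p.1 *ᵥ p.2).re
  have hf : Continuous f :=
    Complex.continuous_re.comp ((continuous_star.comp continuous_snd).dotProduct
      (continuous_fst.matrix_mulVec continuous_snd))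
  have h := (isCompact_sphere (0 : ι → ℂ) 1).eventually_forall_of_forall_eventually
    (x₀ := M) (P := fun N x => 0 < f (N, x)) (fun x hx =>
      hf.continuousAt.eventually (lt_mem_nhds (hM x (ne_zero_of_mem_unit_sphere ⟨x, hx⟩))))
  filter_upwards [h] with N hN x hx
  have hx' : 0 < ‖x‖ := norm_pos_iff.mpr hx
  have h1 := hN ((‖x‖⁻¹ : ℂ) • x) (by
    rw [mem_sphere_zero_iff_norm, norm_smul, norm_inv, Complex.norm_real, norm_norm,
      inv_mul_cancel₀ hx'.ne'])
  have h2 : f (N, (‖x‖⁻¹ : ℂ) • x) = ‖x‖⁻¹ * ‖x‖⁻¹ * (star x ⬝ᵥ N *ᵥ x).re := by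
    have h3 : star ((‖x‖⁻¹ : ℂ) • x) = (‖x‖⁻¹ : ℂ) • star x := by
      rw [star_smul]
      simp
    change (star ((‖x‖⁻¹ : ℂ) • x) ⬝ᵥ N *ᵥ ((‖x‖⁻¹ : ℂ) • x)).re = _
    rw [h3, mulVec_smul, smul_dotProduct, dotProduct_smul, smul_eq_mul, smul_eq_mul, ← mul_assoc,
      ← Complex.ofReal_inv, ← Complex.ofReal_mul, Complex.re_ofReal_mul]
  rw [h2] at h1
  exact pos_of_mul_pos_right h1 (by positivity)

section Smooth

variable {E : Type*} [NormedAddCommGroup E] [NormedSpace ℝ E] {𝕜 : Type*} [RCLike 𝕜] {s : Set E}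
  {M : E → Matrix ι ι 𝕜}

theorem contDiffOn_det (h : ∀ i k, ContDiffOn ℝ ∞ (fun x => M x i k) s) :
    ContDiffOn ℝ ∞ (fun x => (M x).det) s := by
  simp only [det_apply']
  exact ContDiffOn.sum fun σ _ => contDiffOn_const.mul (contDiffOn_prod fun i _ => h _ _)

theorem contDiffOn_inv (h : ∀ i k, ContDiffOn ℝ ∞ (fun x => M x i k) s)
    (h0 : ∀ x ∈ s, (M x).det ≠ 0) (i k : ι) : ContDiffOn ℝ ∞ (fun x => (M x)⁻¹ i k) s := by
  simp only [inv_def, Ring.inverse_eq_inv', smul_apply, smul_eq_mul, adjugate_apply]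
  refine ((contDiffOn_det h).inv h0).mul (contDiffOn_det fun i' k' => ?_)
  by_cases hk : i' = k
  · simp only [hk, updateRow_self]
    exact contDiffOn_const
  · simp only [updateRow_ne hk]
    exact h _ _

theorem contDiffOn_mul {N : E → Matrix ι ι 𝕜} (hM : ∀ i k, ContDiffOn ℝ ∞ (fun x => M x i k) s)
    (hN : ∀ i k, ContDiffOn ℝ ∞ (fun x => N x i k) s) (i k : ι) :
    ContDiffOn ℝ ∞ (fun x => (M x * N x) i k) s := by
  simp only [mul_apply]
  exact ContDiffOn.sum fun l _ => (hM _ _).mul (hN _ _)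

end Smooth

end Matrix

theorem LinearMap.contDiff_of_finiteDimensional {E E' : Type*} [NormedAddCommGroup E]
    [NormedSpace ℝ E] [FiniteDimensional ℝ E] [NormedAddCommGroup E'] [NormedSpace ℝ E']
    (L : E →ₗ[ℝ] E') : ContDiff ℝ ∞ L :=
  (LinearMap.toContinuousLinearMap L).contDiff

/-- Smoothness can be checked in one linear coordinate system. -/
theorem smoothOn_iff {W : Type*} [AddCommGroup W] [Module ℝ W] [FiniteDimensional ℝ W]
    {f : W → ℂ} {s : Set W} (e₀ : (Fin (Module.finrank ℝ W) → ℝ) ≃ₗ[ℝ] W) :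
    SmoothOn f s ↔ ContDiffOn ℝ ∞ (f ∘ e₀) (e₀ ⁻¹' s) := by
  refine ⟨fun h => h e₀, fun h e => ?_⟩
  have h1 := h.comp (e.trans e₀.symm).toLinearMap.contDiff_of_finiteDimensional.contDiffOn
    (s := e ⁻¹' s) (fun x hx => by
      change e₀ (e₀.symm (e x)) ∈ s
      rwa [e₀.apply_symm_apply])
  refine h1.congr fun x _ => ?_
  change f (e x) = f (e₀ (e₀.symm (e x)))
  rw [e₀.apply_symm_apply]

/-! ### Endomorphisms of the complexification as matrices -/

namespace PCCS

variable {V : Type*} [AddCommGroup V] [Module ℝ V] {Ω : SymplecticForm V} {j : PCCS Ω}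
  {F : Submodule ℝ V} [FiniteDimensional ℝ V]

open Bargmann

namespace Coord

variable {ι : Type*} [Fintype ι] [DecidableEq ι] (K : j.Coord F ι)
  (hF : Ω.IsLagrangian F) (g : Ω.stabilizer F)

/-- The matrix of an endomorphism of the complexification of `F`. -/
def cmat : Module.End ℂ (ℂ ⊗[ℝ] F) ≃ₐ[ℂ] Matrix ι ι ℂ :=
  LinearMap.toMatrixAlgEquiv (Algebra.TensorProduct.basis ℂ K.realBasis)

/-- The complexified basis is orthonormal for the Hermitian extension; thus positivity of the real
part can be read off the matrix. -/
theorem hermC_eq (x y : ℂ ⊗[ℝ] F) : j.hermC F x y =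
    star ⇑((Algebra.TensorProduct.basis ℂ K.realBasis).repr y) ⬝ᵥ ⇑((Algebra.TensorProduct.basis ℂ K.realBasis).repr x) := by
  induction x with
  | zero => simp [hermC]
  | add x x' hx hx' =>
    rw [map_add, Finsupp.coe_add, dotProduct_add, ← hx, ← hx']
    simp [hermC]
  | tmul a v =>
    induction y with
    | zero => simp [hermC]
    | add y y' hy hy' =>
      rw [map_add, Finsupp.coe_add, star_add, add_dotProduct, ← hy, ← hy']
      simp [hermC]
    | tmul b w =>
      have h : ∀ (u : F) i, K.realBasis.repr u i = K.realEquiv u i := fun u i => rfl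
      rw [hermC_tmul, K.G_realEquiv]
      simp only [dotProduct, Pi.star_apply, Algebra.TensorProduct.basis_repr_tmul]
      push_cast
      rw [Finset.mul_sum]
      refine Finset.sum_congr rfl fun i _ => ?_
      simp [h]
      ring

theorem mem_GLpos_iff (X : Module.End ℂ (ℂ ⊗[ℝ] F)) :
    X ∈ j.GLpos F ↔ K.cmat X ∈ Matrix.posRe ι := by
  have h : ∀ x, (j.hermC F (X x) x) = star ⇑((Algebra.TensorProduct.basis ℂ K.realBasis).repr x) ⬝ᵥ
      K.cmat X *ᵥ ⇑((Algebra.TensorProduct.basis ℂ K.realBasis).repr x) := fun x => by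
    rw [K.hermC_eq]
    congr 1
    exact (LinearMap.toMatrix_mulVec_repr (Algebra.TensorProduct.basis ℂ K.realBasis)
      (Algebra.TensorProduct.basis ℂ K.realBasis) X x).symm
  constructor
  · intro hX x hx
    obtain ⟨y, rfl⟩ := (Algebra.TensorProduct.basis ℂ K.realBasis).equivFun.surjective x
    have h1 := hX y (fun h0 => hx (by rw [h0, map_zero]))
    rw [h] at h1
    exact h1
  · intro hX x hx
    rw [h]
    exact hX _ (fun h0 => hx ((Algebra.TensorProduct.basis ℂ K.realBasis).equivFun.injective (by
      rw [map_zero]; exact h0)))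

theorem cmat_baseChange (T : Module.End ℝ F) :
    K.cmat (LinearMap.baseChange ℂ T) = (K.mat T).map Complex.ofReal :=
  T.toMatrix_baseChange ℂ K.realBasis K.realBasis

theorem det_cmat (X : Module.End ℂ (ℂ ⊗[ℝ] F)) : (K.cmat X).det = LinearMap.det X :=
  LinearMap.det_toMatrix _ X

theorem cmat_arg : K.cmat (j.arg hF g) = K.matX hF g := by
  have h1 : K.mat (Ring.inverse (j.transpose F (A g).toLinearMap * (A g).toLinearMap)) =
      ((K.matA g)ᵀ * K.matA g)⁻¹ := by
    rw [matA, ← mat_transpose, ← map_mul]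
    -- `Ring.inverse` is a genuine inverse only at units; here the determinant is (det A)², which is
    -- nonzero.
    have hu : IsUnit (j.transpose F (A g).toLinearMap * (A g).toLinearMap) := by
      rw [← MulEquiv.isUnit_map K.mat, map_mul, mat_transpose, Matrix.isUnit_iff_isUnit_det,
        Matrix.det_mul, Matrix.det_transpose, isUnit_iff_ne_zero]
      exact mul_ne_zero (K.det_matA_ne_zero g) (K.det_matA_ne_zero g)
    symm
    apply Matrix.inv_eq_right_inv
    rw [← map_mul, Ring.mul_inverse_cancel _ hu, map_one]
  rw [arg, map_smul, map_sub, map_add, map_one, map_smul, cmat_baseChange, cmat_baseChange, h1,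
    matX, matP, matS]
  ext i k
  simp [Matrix.one_apply]
  split_ifs <;> simp <;> ring

include K in
theorem arg_mem : j.arg hF g ∈ j.GLpos F := by
  rw [K.mem_GLpos_iff, K.cmat_arg]
  exact K.matX_mem_posRe hF g

end Coord

end PCCS

/-! ### Existence and uniqueness of a_F, smoothness of f_F -/

namespace PCCS

variable {V : Type*} [AddCommGroup V] [Module ℝ V] {Ω : SymplecticForm V} {j : PCCS Ω}
  {F : Submodule ℝ V} [FiniteDimensional ℝ V]

open Bargmann

theorem convex_GLpos : Convex ℝ (j.GLpos F) := by
  intro X hX Y hY s t hs ht hst x hx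
  have h1 := hX x hx
  have h2 := hY x hx
  have h3 : j.hermC F ((s • X + t • Y) x) x = s * j.hermC F (X x) x + t * j.hermC F (Y x) x := by
    simp [hermC]
  rw [h3, Complex.add_re, Complex.re_ofReal_mul, Complex.re_ofReal_mul]
  rcases hs.eq_or_lt with rfl | hs'
  · rw [zero_add] at hst
    simpa [hst] using h2
  · have := mul_pos hs' h1
    have := mul_nonneg ht h2.le
    linarith

variable (F) in
-- Two continuous logarithms on a convex, hence connected, set differ by a constant multiple of 2πi,
-- which is zero by the normalisation at I.
theorem IsLogDet.eqOn {a b : Module.End ℂ (ℂ ⊗[ℝ] F) → ℂ} (ha : j.IsLogDet F a)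
    (hb : j.IsLogDet F b) (h1 : (1 : Module.End ℂ (ℂ ⊗[ℝ] F)) ∈ j.GLpos F) :
    EqOn b a (j.GLpos F) := by
  let e := (Module.finBasis ℝ (Module.End ℂ (ℂ ⊗[ℝ] F))).equivFun.symm
  have hc : Convex ℝ (e ⁻¹' j.GLpos F) := convex_GLpos.linear_preimage e.toLinearMap
  have h := hc.isPreconnected.eqOn_of_exp_eq (hb.1 e).continuousOn (ha.1 e).continuousOn
    (fun x hx => (hb.2.1 _ hx).symm.trans (ha.2.1 _ hx)) (x₀ := e.symm 1)
    (by change e (e.symm 1) ∈ j.GLpos F; rwa [e.apply_symm_apply])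
    (by simp only [Function.comp_apply, e.apply_symm_apply, ha.2.2, hb.2.2])
  intro X hX
  have h2 := h (x := e.symm X) (by change e (e.symm X) ∈ j.GLpos F; rwa [e.apply_symm_apply])
  simpa only [Function.comp_apply, e.apply_symm_apply] using h2

namespace Coord

variable {ι : Type*} [Fintype ι] [DecidableEq ι] (K : j.Coord F ι)
  (hF : Ω.IsLagrangian F) (g : Ω.stabilizer F)

include K in
theorem one_mem_GLpos : (1 : Module.End ℂ (ℂ ⊗[ℝ] F)) ∈ j.GLpos F := by
  rw [K.mem_GLpos_iff, map_one]
  exact Matrix.one_mem_posRe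

include K in
-- In linear coordinates the domain is open and convex, and the determinant is a polynomial without
-- zeros on it, so a smooth logarithm exists.
theorem exists_isLogDet : ∃ a, j.IsLogDet F a := by
  let e := (Module.finBasis ℝ (Module.End ℂ (ℂ ⊗[ℝ] F))).equivFun.symm
  let L : (Fin (Module.finrank ℝ (Module.End ℂ (ℂ ⊗[ℝ] F))) → ℝ) →ₗ[ℝ] Matrix ι ι ℂ :=
    (K.cmat.toLinearMap.restrictScalars ℝ) ∘ₗ e.toLinearMap
  have hL : ∀ x, L x = K.cmat (e x) := fun x => rfl
  have hs : e ⁻¹' j.GLpos F = L ⁻¹' Matrix.posRe ι := by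
    ext x
    exact K.mem_GLpos_iff (e x)
  have ho : IsOpen (e ⁻¹' j.GLpos F) := by
    rw [hs]
    exact Matrix.isOpen_posRe.preimage L.continuous_of_finiteDimensional
  have hd : ContDiff ℝ ∞ fun x => LinearMap.det (e x) := by
    have h : ∀ x, LinearMap.det (e x) = (L x).det := fun x => (K.det_cmat (e x)).symm
    simp only [h]
    rw [← contDiffOn_univ]
    refine Matrix.contDiffOn_det fun i k => ContDiff.contDiffOn ?_
    exact (Matrix.entryLinearMap ℝ ℂ i k ∘ₗ L).contDiff_of_finiteDimensional
  obtain ⟨a, ha, ha', ha1⟩ := (convex_GLpos.linear_preimage e.toLinearMap).exists_contDiffOn_log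
    ho hd (fun x hx => by
      rw [← K.det_cmat]
      exact Matrix.det_ne_zero_of_mem_posRe ((K.mem_GLpos_iff _).mp hx)) (x₀ := e.symm 1)
    (by change e (e.symm 1) ∈ j.GLpos F; rw [e.apply_symm_apply]; exact K.one_mem_GLpos)
    (by rw [e.apply_symm_apply, map_one])
  refine ⟨a ∘ e.symm, (smoothOn_iff e).mpr (ha.congr fun x _ => ?_), fun X hX => ?_, ha1⟩
  · simp only [Function.comp_apply, e.symm_apply_apply]
  · have h := ha' (e.symm X) (by change e (e.symm X) ∈ j.GLpos F; rwa [e.apply_symm_apply])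
    rwa [e.apply_symm_apply] at h

variable {a : Module.End ℂ (ℂ ⊗[ℝ] F) → ℂ} (ha : j.IsLogDet F a)

include ha in
-- Only continuity survives in the matrix version; this is all that the choice of square root in the
-- Gaussian integral needs.
theorem isLogDet_cmat : Matrix.IsLogDet (a ∘ K.cmat.symm) := by
  have hmem : ∀ M ∈ Matrix.posRe ι, K.cmat.symm M ∈ j.GLpos F := fun M hM => by
    rwa [K.mem_GLpos_iff, AlgEquiv.apply_symm_apply]
  refine ⟨?_, fun M hM => ?_, ?_⟩
  · let e := (Module.finBasis ℝ (Module.End ℂ (ℂ ⊗[ℝ] F))).equivFun.symm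
    let L : Matrix ι ι ℂ →ₗ[ℝ] (Fin (Module.finrank ℝ (Module.End ℂ (ℂ ⊗[ℝ] F))) → ℝ) :=
      e.symm.toLinearMap ∘ₗ (K.cmat.symm.toLinearMap.restrictScalars ℝ)
    have he : ∀ M, e (L M) = K.cmat.symm M := fun M => e.apply_symm_apply _
    have h := (ha.1 e).continuousOn.comp L.continuous_of_finiteDimensional.continuousOn
      (s := Matrix.posRe ι) (fun M hM => by
        change e (L M) ∈ j.GLpos F
        rw [he]
        exact hmem M hM)
    refine h.congr fun M _ => ?_
    simp only [Function.comp_apply, he]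
  · rw [Function.comp_apply, ← ha.2.1 _ (hmem M hM), ← K.det_cmat, AlgEquiv.apply_symm_apply]
  · rw [Function.comp_apply, map_one, ha.2.2]

theorem fF_eq : j.fF hF a g = ((|(K.matA g).det| ^ (-(1 / 2) : ℝ) : ℝ) : ℂ) *
    Complex.exp (-(1 / 2) * (a ∘ K.cmat.symm) (K.matX hF g)) := by
  rw [fF, K.det_matA, ← cmat_arg, Function.comp_apply, AlgEquiv.symm_apply_apply]

/-- The `F`-`F` block of an endomorphism of `V`. -/
def blockA (T : Module.End ℝ V) : Matrix ι ι ℝ :=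
  Matrix.of fun i k => j.G (K.vec (Pi.single i 1) 0) (T (K.vec (Pi.single k 1) 0))

/-- The `F`-`jF` block of an endomorphism of `V`. -/
def blockB (T : Module.End ℝ V) : Matrix ι ι ℝ :=
  Matrix.of fun i k => j.G (K.vec (Pi.single i 1) 0) (T (K.vec 0 (Pi.single k 1)))

include hF in
theorem blockA_eq : K.blockA ((g : Ω.Sp) : V ≃ₗ[ℝ] V).toLinearMap = K.matA g := by
  ext i k
  rw [blockA, Matrix.of_apply, LinearEquiv.coe_coe, K.apply_vec hF, G_vec]
  simp

theorem blockB_eq : K.blockB ((g : Ω.Sp) : V ≃ₗ[ℝ] V).toLinearMap = K.matA g * K.matS hF g := by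
  ext i k
  rw [blockB, Matrix.of_apply, LinearEquiv.coe_coe, K.apply_vec hF, G_vec]
  simp only [Matrix.mulVec_single_one, Matrix.mulVec_zero, zero_add, zero_dotProduct, add_zero,
    single_one_dotProduct]
  rfl

/-- The extension of `matX` to endomorphisms of `V`. -/
def blockX (T : Module.End ℝ V) : Matrix ι ι ℂ :=
  ((1 / 2 : ℝ) • (1 + ((K.blockA T)ᵀ * K.blockA T)⁻¹)).map Complex.ofReal +
    Complex.I • ((-(1 / 2) : ℝ) • ((K.blockA T)⁻¹ * K.blockB T)).map Complex.ofReal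

theorem blockX_eq : K.blockX ((g : Ω.Sp) : V ≃ₗ[ℝ] V).toLinearMap = K.matX hF g := by
  rw [blockX, K.blockA_eq hF, K.blockB_eq hF, ← Matrix.mul_assoc,
    Matrix.nonsing_inv_mul _ (K.det_matA_ne_zero g).isUnit, Matrix.one_mul]
  rfl

include K ha in
theorem smoothOnStabilizer_fF : Ω.SmoothOnStabilizer F (j.fF hF a) := by
  -- The extension to End(V) uses that A and AS are blocks of g, linear in its entries, and recovers
  -- S as A⁻¹(AS). Invertibility of A and positivity of X are needed, and known, only on the
  -- stabiliser.
  refine ⟨fun T => ((|(K.blockA T).det| ^ (-(1 / 2) : ℝ) : ℝ) : ℂ) *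
    Complex.exp (-(1 / 2) * (a ∘ K.cmat.symm) (K.blockX T)), ?_, fun g => ?_⟩
  swap
  · beta_reduce
    rw [K.fF_eq hF, K.blockA_eq hF, K.blockX_eq hF]
  intro e
  set R := e ⁻¹' range fun g : Ω.stabilizer F => ((g : Ω.Sp) : V ≃ₗ[ℝ] V).toLinearMap with hR
  have hdet : ∀ x ∈ R, (K.blockA (e x)).det ≠ 0 := by
    rintro x ⟨g, hg⟩
    rw [← hg, K.blockA_eq hF]
    exact K.det_matA_ne_zero g
  have hXmem : ∀ x ∈ R, K.blockX (e x) ∈ Matrix.posRe ι := by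
    rintro x ⟨g, hg⟩
    rw [← hg, K.blockX_eq hF]
    exact K.matX_mem_posRe hF g
  have hG : ∀ v w : V, ContDiffOn ℝ ∞ (fun x => j.G v (e x w)) R := fun v w =>
    ((j.G v ∘ₗ LinearMap.applyₗ w) ∘ₗ e.toLinearMap).contDiff_of_finiteDimensional.contDiffOn
  have hA : ∀ i k, ContDiffOn ℝ ∞ (fun x => K.blockA (e x) i k) R := fun i k => hG _ _
  have hB : ∀ i k, ContDiffOn ℝ ∞ (fun x => K.blockB (e x) i k) R := fun i k => hG _ _
  have hP := Matrix.contDiffOn_inv (Matrix.contDiffOn_mul (M := fun x => (K.blockA (e x))ᵀ)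
    (fun i k => hA k i) hA) (fun x hx => by
      rw [Matrix.det_mul, Matrix.det_transpose]
      exact mul_ne_zero (hdet x hx) (hdet x hx))
  have hS := Matrix.contDiffOn_mul (Matrix.contDiffOn_inv hA hdet) hB
  have hre : ∀ {f : (Fin (Module.finrank ℝ (Module.End ℝ V)) → ℝ) → ℝ},
      ContDiffOn ℝ ∞ f R → ContDiffOn ℝ ∞ (fun x => (f x : ℂ)) R := fun hf =>
    Complex.ofRealCLM.contDiff.comp_contDiffOn hf
  have hX : ∀ i k, ContDiffOn ℝ ∞ (fun x => K.blockX (e x) i k) R := by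
    intro i k
    simp only [blockX, Matrix.add_apply, Matrix.smul_apply, Matrix.map_apply, smul_eq_mul]
    exact (hre (contDiffOn_const.mul (contDiffOn_const.add (hP i k)))).add
      (contDiffOn_const.mul (hre (contDiffOn_const.mul (hS i k))))
  have hpow : ContDiffOn ℝ ∞ (fun x => |(K.blockA (e x)).det| ^ (-(1 / 2) : ℝ)) R := by
    -- The real logarithm depends only on |det A|, so |det A|^(-1/2) = exp(-(1/2) log(det A)) is
    -- smooth for either sign of the determinant.
    have h := ((Matrix.contDiffOn_det hA).log hdet).mul (contDiffOn_const (c := (-(1 / 2) : ℝ)))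
    refine h.exp.congr fun x hx => ?_
    rw [Real.rpow_def_of_pos (abs_pos.mpr (hdet x hx)), Real.log_abs]
  have hlog : ContDiffOn ℝ ∞ (fun x => (a ∘ K.cmat.symm) (K.blockX (e x))) R := by
    let e' := (Module.finBasis ℝ (Module.End ℂ (ℂ ⊗[ℝ] F))).equivFun.symm
    let L : (ι → ι → ℂ) →ₗ[ℝ] (Fin (Module.finrank ℝ (Module.End ℂ (ℂ ⊗[ℝ] F))) → ℝ) :=
      e'.symm.toLinearMap ∘ₗ (K.cmat.symm.toLinearMap.restrictScalars ℝ) ∘ₗ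
        (Matrix.ofLinearEquiv ℝ).toLinearMap
    have he : ∀ M : Matrix ι ι ℂ, e' (L M) = K.cmat.symm M := fun M => e'.apply_symm_apply _
    have h1 : ContDiffOn ℝ (F := ι → ι → ℂ) ∞ (fun x => K.blockX (e x)) R :=
      contDiffOn_pi.mpr fun i => contDiffOn_pi.mpr fun k => hX i k
    have h := (ha.1 e').comp (L.contDiff_of_finiteDimensional.comp_contDiffOn h1)
      (fun x hx => by
        change e' (L (K.blockX (e x))) ∈ j.GLpos F
        rw [he, K.mem_GLpos_iff, AlgEquiv.apply_symm_apply]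
        exact hXmem x hx)
    refine h.congr fun x _ => ?_
    exact congrArg a (he _).symm
  exact (hre hpow).mul (contDiffOn_const.mul hlog).cexp

end Coord

end PCCS

end

theorem mainTheorem4 {V : Type*} [AddCommGroup V] [Module ℝ V] [FiniteDimensional ℝ V]
    (Ω : SymplecticForm V) (j : PCCS Ω) (hbar : ℝ) [Fact (0 < hbar)]
    (F : Submodule ℝ V) (hF : Ω.IsLagrangian F) :
    ∃ a : Module.End ℂ (ℂ ⊗[ℝ] F) → ℂ,
      j.IsLogDet F a ∧
      (∀ b, j.IsLogDet F b → Set.EqOn b a (j.GLpos F)) ∧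
      (∀ g : Ω.stabilizer F, j.arg hF g ∈ j.GLpos F) ∧
      Ω.SmoothOnStabilizer F (j.fF hF a) ∧
      ∃! Φ : Ω.stabilizer F →* j.Mpc hbar,
        ∀ g : Ω.stabilizer F, j.HasParameters hbar (Φ g) (g : Ω.Sp) (j.fF hF a g) := by
  obtain ⟨n, ⟨K⟩⟩ := j.exists_coord hF
  obtain ⟨a, ha⟩ := K.exists_isLogDet
  have hΦ : ∀ g : Ω.stabilizer F, j.HasParameters hbar (K.lift hF (K.isLogDet_cmat ha) g) (g : Ω.Sp)
      (j.fF hF a g) := fun g => by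
    rw [K.fF_eq hF]
    exact K.hasParameters_lift hF g (K.isLogDet_cmat ha)
  -- Uniqueness of the homomorphism is pointwise and does not use multiplicativity: each value is
  -- already fixed by its parameters.
  exact ⟨a, ha, fun b hb => ha.eqOn F hb K.one_mem_GLpos, K.arg_mem hF,
    K.smoothOnStabilizer_fF hF ha, K.lift hF (K.isLogDet_cmat ha), hΦ,
    fun Ψ hΨ => MonoidHom.ext fun g => K.eq_of_hasParameters (hΨ g) (hΦ g)⟩
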